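/- Let $d\ge 2$ and $[d]=\{1,\dots,d\}$; $\log$ is to base two, $\log 0=-\infty$, $0\cdot\infty=0$, $\min\emptyset=+\infty$. Let $\mathfrak P(X)$ be the set of probability distributions on a finite set $X$. *Setting.* Let $e_1,\dots,e_d$ be the standard basis of $\mathbb C^d$. The group $S_n$ acts on $(\mathbb C^d)^{\otimes n}$ by permuting tensor factors. For a frequency $f:[d]\to\mathbb N$, $\sum_i f(i)=n$, let $V_f$ be the span of the vectors $e_{i_1}\otimes\cdots\otimes e_{i_n}$ in which every $i$ occurs exactly $f(i)$ times. For a Young frame $\lambda=(\lambda_1\ge\dots\ge\lambda_d\ge 0)$ with $n$ boxes let $F_\lambda$ be the corresponding irreducible representation of $S_n$, let $V_{f,\lambda}\subset V_f$ be the isotypical component of $F_\lambda$ in $V_f$, and let $P_{f,\lambda}$ be the orthogonal projection onto $V_{f,\lambda}$; $P_{\lambda,\lambda}$ is the case $f(i)=\lambda_i$. For $A\in M_d$ put $t_n(\lambda,f)=\mathrm{tr}\{P_{\lambda,\lambda}A^{\otimes n}P_{f,\lambda}A^{\dagger\otimes n}\}$. Let $s\in\mathfrak P([d])$ with $s(1)\ge\dots\ge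 s(d)$ and let $q\in\mathfrak P([d])$. Consider sequences of Young frames $\lambda^{(n)}$ with $n$ boxes and at most $d$ rows and of frequencies $f^{(n)}$ with sum $n$ such that $\tfrac1n\lambda^{(n)}\to s$ and $\tfrac1n f^{(n)}\to q$. We say that $\Theta(q,s,A)=\theta\in[-\infty,\infty]$ if either * $\theta<\infty$, there are such sequences with $t_n(\lambda^{(n)},f^{(n)})\ne0$ for all large $n$, and $-\tfrac1n\log t_n(\lambda^{(n)},f^{(n)})\to\theta$ for all such sequences with $t_n(\lambda^{(n)},f^{(n)})\neq 0$ for all large $n$; or * $\theta=\infty$ and $-\tfrac1n\log t_n(\lambda^{(n)},f^{(n)})\to\infty$ for all such sequences. There is at most one such $\theta$. Put $H(s)=-\sum_i s(i)\log s(i)$, and $D(p\|r)=\sum_x p(x)\log\frac{p(x)}{r(x)}$ for $p,r\ge 0$ on a finite set, with $D(p\|r)=\infty$ if $p(x)\neq0=r(x)$ for some $x$. Let $\hat s(k)=k\,(s(k)-s(k+1))$ with $s(d+1)=0$. For $1\le k\le d$ and $r\in\mathfrak P([d])$ let $\mathfrak P(r,k)$ be the set of $p\in\mathfrak P([d]^k)$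 that vanish on all words with a repeated letter and satisfy $p(\{x: i\text{ occurs exactly once in }x\})=k\,r(i)$ for all $i\in[d]$. Let $$v_k=\frac1{\sqrt{k!}}\sum_{\tau\in S_k}\mathrm{sgn}(\tau)\,e_{\tau^{-1}(1)}\otimes\cdots\otimes e_{\tau^{-1}(k)},\qquad p_k(i_1,\dots,i_k)=\left|\left\langle e_{i_1}\otimes\cdots\otimes e_{i_k},\,A^{\dagger\otimes k}v_k\right\rangle\right|^2 .$$ **Theorem.** (1) For every $A\in M_d$ and $q\in\mathfrak P([d])$ the exponent $\Theta(q,s,A)$ exists, and $$\Theta(q,s,A)=-H(s)+\min_{W(\hat s)=q}\ \sum_{k=1}^d\hat s(k)\min_{p\in\mathfrak P(W(\delta_k),k)}\tfrac1k D(p\|p_k),$$ where $W$ runs over all channels (stochastic matrices) from $[d]$ to $[d]$ with $\sum_k\hat s(k)W(\delta_k)=q$; the outer minimum is attained, and so is $\min_{p\in\mathfrak P(r,k)}D(p\|p_k)$ for every $k$ and every $r\in\mathfrak P([d])$ with $\mathfrak P(r,k)\ne\emptyset$. (2) For every unitary $U\in M_d$ the function $q\mapsto\Theta(q,s,U)$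 on $\mathfrak P([d])$ assumes its minimum at the distribution $$\tilde q(i)=\sum_{k=1}^d\hat s(k)\sum_{l=1}^k\frac{|u_{li}|^2}{k},$$ and nowhere else. -/

import Mathlib

open scoped BigOperators

namespace QTypes

noncomputable section

/-! ### The tensor power, permutations of the tensor factors, frequency subspaces -/

/-- The Hilbert space `(ℂ^d)^{⊗ n}`, written in its orthonormal product basis
`e_x = e_{x 0} ⊗ ⋯ ⊗ e_{x (n-1)}`, which is indexed by the words `x : Fin n → Fin d`. -/
abbrev TensorSpace (d n : ℕ) : Type := EuclideanSpace ℂ (Fin n → Fin d)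

/-- The product basis vector `e_x`. -/
def basisVec {d n : ℕ} (x : Fin n → Fin d) : TensorSpace d n := EuclideanSpace.single x 1

/-- `A^{⊗ n}` as an operator on `(ℂ^d)^{⊗ n}`; its matrix entries are `∏ i, A (x i) (y i)`. -/
def tensorPow {d : ℕ} (n : ℕ) (A : Matrix (Fin d) (Fin d) ℂ) :
    TensorSpace d n →ₗ[ℂ] TensorSpace d n :=
  Matrix.toEuclideanLin (Matrix.of fun x y : Fin n → Fin d => ∏ i, A (x i) (y i))

/-- The action of `S_n` on `(ℂ^d)^{⊗ n}` by permutation of the tensor factors,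
`τ (v_1 ⊗ ⋯ ⊗ v_n) = v_{τ⁻¹ 1} ⊗ ⋯ ⊗ v_{τ⁻¹ n}`; in coordinates `(τ φ)(y) = φ (y ∘ τ)`. -/
def permRep (d n : ℕ) : Representation ℂ (Equiv.Perm (Fin n)) (TensorSpace d n) where
  toFun τ :=
    { toFun := fun φ => WithLp.toLp 2 fun y => φ (y ∘ τ)
      map_add' := fun _ _ => rfl
      map_smul' := fun _ _ => rfl }
  map_one' := rfl
  map_mul' _ _ := rfl

theorem permRep_basisVec {d n : ℕ} (τ : Equiv.Perm (Fin n)) (x : Fin n → Fin d) :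
    permRep d n τ (basisVec x) = basisVec (x ∘ τ.symm) := by
  ext y
  have h : (y ∘ τ = x) ↔ (y = x ∘ τ.symm) := by
    constructor
    · rintro rfl; ext i; simp
    · rintro rfl; ext i; simp
  change (EuclideanSpace.single x (1 : ℂ)) (y ∘ τ) = (EuclideanSpace.single (x ∘ τ.symm) (1 : ℂ)) y
  simp [h]

/-- The number `N(i | x)` of occurrences of the letter `i` in the word `x`. -/
def count {d n : ℕ} (x : Fin n → Fin d) (i : Fin d) : ℕ :=
  (Finset.univ.filter fun l => x l = i).card

/-- Frequencies (types) of words of length `n` over the alphabet `[d]`. -/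
structure Freq (d n : ℕ) where
  toFun : Fin d → ℕ
  sum_eq : ∑ i, toFun i = n

/-- Young frames with `n` boxes and at most `d` rows; `row i` is the length of row `i`. -/
structure YoungFrame (d n : ℕ) where
  row : Fin d → ℕ
  antitone : Antitone row
  sum_eq : ∑ i, row i = n

/-- A Young frame, read as a frequency. -/
def YoungFrame.toFreq {d n : ℕ} (lam : YoungFrame d n) : Freq d n := ⟨lam.row, lam.sum_eq⟩

/-- The frequency-typical subspace `V_f`. -/
def freqSpace {d n : ℕ} (f : Freq d n) : Submodule ℂ (TensorSpace d n) :=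
  Submodule.span ℂ {v | ∃ x : Fin n → Fin d, (∀ i, count x i = f.toFun i) ∧ v = basisVec x}

/-! ### The irreducible representation `F_λ` of `S_n` and the subspaces `V_{f,λ}` -/

/-- The standard tableau of shape `λ` that is filled row by row: number `m` is sent to its box,
given by its row and its position in this row. -/
def YoungFrame.box {d n : ℕ} (lam : YoungFrame d n) (m : Fin n) : (i : Fin d) × Fin (lam.row i) :=
  finSigmaFinEquiv.symm (Fin.cast lam.sum_eq.symm m)

/-- The permutations that preserve each row of the tableau. -/
def YoungFrame.rowGroup {d n : ℕ} (lam : YoungFrame d n) : Finset (Equiv.Perm (Fin n)) :=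
  Finset.univ.filter fun τ => ∀ m, (lam.box (τ m)).1 = (lam.box m).1

/-- The permutations that preserve each column of the tableau. -/
def YoungFrame.colGroup {d n : ℕ} (lam : YoungFrame d n) : Finset (Equiv.Perm (Fin n)) :=
  Finset.univ.filter fun υ => ∀ m, ((lam.box (υ m)).2 : ℕ) = ((lam.box m).2 : ℕ)

/-- The Young symmetrizer `∑_{υ ∈ C} ∑_{τ ∈ R} sgn(υ) υ τ` in the group algebra of `S_n`. -/
def YoungFrame.symmetrizer {d n : ℕ} (lam : YoungFrame d n) :
    MonoidAlgebra ℂ (Equiv.Perm (Fin n)) :=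
  ∑ υ ∈ lam.colGroup, ∑ τ ∈ lam.rowGroup,
    MonoidAlgebra.single (υ * τ) (((Equiv.Perm.sign υ : ℤ) : ℂ))

/-- The left ideal `ℂ[S_n] c_λ` generated by the Young symmetrizer: the space carrying `F_λ`. -/
def YoungFrame.irrepSpace {d n : ℕ} (lam : YoungFrame d n) :
    Ideal (MonoidAlgebra ℂ (Equiv.Perm (Fin n))) :=
  Ideal.span {lam.symmetrizer}

/-- The irreducible representation `F_λ` of `S_n`: left multiplication on `ℂ[S_n] c_λ`. -/
def YoungFrame.irrep {d n : ℕ} (lam : YoungFrame d n) :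
    Representation ℂ (Equiv.Perm (Fin n)) lam.irrepSpace where
  toFun σ :=
    { toFun := fun x => MonoidAlgebra.of ℂ (Equiv.Perm (Fin n)) σ • x
      map_add' := fun x y => smul_add _ x y
      map_smul' := fun c x => smul_comm _ c x }
  map_one' := by
    ext x : 1
    change MonoidAlgebra.of ℂ (Equiv.Perm (Fin n)) 1 • x = x
    rw [map_one, one_smul]
  map_mul' σ τ := by
    ext x : 1
    change MonoidAlgebra.of ℂ (Equiv.Perm (Fin n)) (σ * τ) • x =
      MonoidAlgebra.of ℂ (Equiv.Perm (Fin n)) σ • MonoidAlgebra.of ℂ (Equiv.Perm (Fin n)) τ • x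
    rw [map_mul, mul_smul]

/-- `V_{f,λ}`: the isotypical component of `F_λ` in `V_f`, that is the sum of all
subrepresentations of `V_f` that are isomorphic to `F_λ`. -/
def isoSpace {d n : ℕ} (f : Freq d n) (lam : YoungFrame d n) : Submodule ℂ (TensorSpace d n) :=
  sSup {W | W ≤ freqSpace f ∧
    ∃ φ : Representation.IntertwiningMap lam.irrep (permRep d n),
      Function.Injective φ ∧ LinearMap.range φ.toLinearMap = W}

/-- `P_{f,λ}`: the orthogonal projection onto `V_{f,λ}`. -/
def isoProj {d n : ℕ} (f : Freq d n) (lam : YoungFrame d n) :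
    TensorSpace d n →ₗ[ℂ] TensorSpace d n :=
  ((isoSpace f lam).starProjection : TensorSpace d n →ₗ[ℂ] TensorSpace d n)

/-- `tr { P_{λ,λ} A^{⊗ n} P_{f,λ} A^{†⊗ n} }` (a non-negative real number). -/
def overlap {d n : ℕ} (A : Matrix (Fin d) (Fin d) ℂ) (lam : YoungFrame d n) (f : Freq d n) : ℝ :=
  (LinearMap.trace ℂ (TensorSpace d n)
    (isoProj lam.toFreq lam ∘ₗ tensorPow n A ∘ₗ isoProj f lam ∘ₗ tensorPow n A.conjTranspose)).re

/-! ### The exponent `Θ(q,s,A)` -/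

/-- The binary logarithm of a non-negative number, with `log 0 = -∞`. -/
def log2 (x : ℝ) : EReal := if x = 0 then ⊥ else ((Real.logb 2 x : ℝ) : EReal)

/-- `-(1/n) log tr { P_{λ,λ} A^{⊗ n} P_{f,λ} A^{†⊗ n} }`. -/
def rate {d : ℕ} (A : Matrix (Fin d) (Fin d) ℂ) (lam : ∀ n, YoungFrame d n) (f : ∀ n, Freq d n)
    (n : ℕ) : EReal :=
  -(((1 / (n : ℝ) : ℝ) : EReal) * log2 (overlap A (lam n) (f n)))

/-- `(1/n) λ^{(n)} → s`. -/
def ShapeLimit {d : ℕ} (lam : ∀ n, YoungFrame d n) (s : Fin d → ℝ) : Prop :=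
  ∀ i, Filter.Tendsto (fun n : ℕ => ((lam n).row i : ℝ) / n) Filter.atTop (nhds (s i))

/-- `(1/n) f^{(n)} → q`. -/
def FreqLimit {d : ℕ} (f : ∀ n, Freq d n) (q : Fin d → ℝ) : Prop :=
  ∀ i, Filter.Tendsto (fun n : ℕ => ((f n).toFun i : ℝ) / n) Filter.atTop (nhds (q i))

/-- `θ` is the exponent of `tr { P_{λ,λ} A^{⊗ n} P_{f,λ} A^{†⊗ n} }` at shape `s` and
frequency `q`.

A finite `θ` has to be the limit along every pair of sequences with limits `s` and `q` for which
the traces do not vanish (a trace that vanishes for infinitely many `n` excludes a finite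
limit), and such a pair has to exist. For `θ = ∞` the limit has to be `∞` along every pair of
sequences with limits `s` and `q`. -/
def HasTheta {d : ℕ} (q s : Fin d → ℝ) (A : Matrix (Fin d) (Fin d) ℂ) (θ : EReal) : Prop :=
  (∀ (lam : ∀ n, YoungFrame d n) (f : ∀ n, Freq d n), ShapeLimit lam s → FreqLimit f q →
    (θ = ⊤ ∨ ∀ᶠ n in Filter.atTop, overlap A (lam n) (f n) ≠ 0) →
      Filter.Tendsto (rate A lam f) Filter.atTop (nhds θ)) ∧
  (θ ≠ ⊤ → ∃ (lam : ∀ n, YoungFrame d n) (f : ∀ n, Freq d n), ShapeLimit lam s ∧ FreqLimit f q ∧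
    ∀ᶠ n in Filter.atTop, overlap A (lam n) (f n) ≠ 0)

/-- There is at most one exponent. -/
theorem HasTheta.unique {d : ℕ} {q s : Fin d → ℝ} {A : Matrix (Fin d) (Fin d) ℂ} {θ θ' : EReal}
    (h : HasTheta q s A θ) (h' : HasTheta q s A θ') : θ = θ' := by
  by_cases ht : θ = ⊤
  · by_cases ht' : θ' = ⊤
    · rw [ht, ht']
    · obtain ⟨lam, f, hl, hf, hne⟩ := h'.2 ht'
      exact tendsto_nhds_unique (h.1 lam f hl hf (Or.inl ht)) (h'.1 lam f hl hf (Or.inr hne))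
  · obtain ⟨lam, f, hl, hf, hne⟩ := h.2 ht
    exact tendsto_nhds_unique (h.1 lam f hl hf (Or.inr hne)) (h'.1 lam f hl hf (Or.inr hne))

/-- The exponent `Θ(q,s,A)`: the unique `θ` with `HasTheta q s A θ` (if there is one). -/
def Theta {d : ℕ} (q s : Fin d → ℝ) (A : Matrix (Fin d) (Fin d) ℂ) : EReal :=
  Classical.epsilon (HasTheta q s A)

/-! ### Entropic quantities -/

/-- The entropy `H(r)` to base two. -/
def entropy {X : Type} [Fintype X] (r : X → ℝ) : ℝ := -∑ x, r x * Real.logb 2 (r x)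

open Classical in
/-- The relative entropy `D(p‖r)` to base two of non-negative functions on a finite set; it is
`∞` if `r` vanishes somewhere on the support of `p`. -/
def relEntropy {X : Type} [Fintype X] (p r : X → ℝ) : EReal :=
  if ∀ x, p x ≠ 0 → r x ≠ 0 then
    ((∑ x, p x * (Real.logb 2 (p x) - Real.logb 2 (r x)) : ℝ) : EReal)
  else ⊤

open Classical in
/-- The set `𝔓(q,k)` of distributions `p` on `[d]^k` that vanish on the words with a repeated
letter and give probability `k q(i)` to the words in which `i` occurs exactly once. -/
def blockDist {d : ℕ} (q : Fin d → ℝ) (k : ℕ) : Set ((Fin k → Fin d) → ℝ) :=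
  {p | p ∈ stdSimplex ℝ (Fin k → Fin d) ∧
    (∀ x, (∃ i, 1 < count x i) → p x = 0) ∧
    ∀ i, (∑ x ∈ Finset.univ.filter fun x : Fin k → Fin d => ∃! l, x l = i, p x) = k * q i}

/-- The antisymmetric unit vector `v_k = (k!)^{-1/2} ∑_τ sgn(τ) τ (e_1 ⊗ ⋯ ⊗ e_k)`. -/
def antisymVec {d k : ℕ} (hk : k ≤ d) : TensorSpace d k :=
  (((Real.sqrt (k.factorial : ℝ))⁻¹ : ℝ) : ℂ) •
    ∑ τ : Equiv.Perm (Fin k),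
      ((Equiv.Perm.sign τ : ℤ) : ℂ) • permRep d k τ (basisVec (Fin.castLE hk))

/-- `p_k(x) = |⟨e_x, A^{†⊗ k} v_k⟩|²`. -/
def blockWeight {d k : ℕ} (A : Matrix (Fin d) (Fin d) ℂ) (hk : k ≤ d) (x : Fin k → Fin d) : ℝ :=
  ‖inner ℂ (basisVec x) (tensorPow k A.conjTranspose (antisymVec hk))‖ ^ 2

/-- `ŝ(k) = k (s(k) - s(k+1))`, with `s(d+1) = 0`. The index `k : Fin d` stands for the number
`k + 1`. -/
def hatS {d : ℕ} (s : Fin d → ℝ) (k : Fin d) : ℝ :=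
  ((k : ℕ) + 1 : ℝ) * (s k - if h : (k : ℕ) + 1 < d then s ⟨(k : ℕ) + 1, h⟩ else 0)

/-- The channels `W` from `[d]` to `[d]` with `W(ŝ) = q`; the distribution `W(δ_k)` is `W k`. -/
def channels {d : ℕ} (s q : Fin d → ℝ) : Set (Fin d → Fin d → ℝ) :=
  {W | (∀ k, W k ∈ stdSimplex ℝ (Fin d)) ∧ ∀ i, ∑ k, hatS s k * W k i = q i}

/-- `min { D(p‖p_k) : p ∈ 𝔓(r,k) }`, which is `∞` if `𝔓(r,k)` is empty; `k : Fin d` stands for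
the number `k + 1`. -/
def blockMin {d : ℕ} (A : Matrix (Fin d) (Fin d) ℂ) (r : Fin d → ℝ) (k : Fin d) : EReal :=
  ⨅ p ∈ blockDist r ((k : ℕ) + 1),
    relEntropy p (blockWeight A (show (k : ℕ) + 1 ≤ d from k.isLt))

/-- `∑_k ŝ(k) (1/k) min { D(p‖p_k) : p ∈ 𝔓(W(δ_k),k) }`, where `0 · ∞ = 0`. -/
def channelCost {d : ℕ} (s : Fin d → ℝ) (A : Matrix (Fin d) (Fin d) ℂ) (W : Fin d → Fin d → ℝ) :
    EReal :=
  ∑ k : Fin d, ((hatS s k * (1 / ((k : ℕ) + 1 : ℝ)) : ℝ) : EReal) * blockMin A (W k) k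

/-- `q̃(i) = ∑_k ŝ(k) ∑_{l ≤ k} |u_{l i}|² / k`. -/
def tildeQ {d : ℕ} (s : Fin d → ℝ) (U : Matrix (Fin d) (Fin d) ℂ) (i : Fin d) : ℝ :=
  ∑ k : Fin d, hatS s k *
    ∑ l ∈ Finset.univ.filter fun l : Fin d => l ≤ k, ‖U l i‖ ^ 2 / ((k : ℕ) + 1 : ℝ)

end

end QTypes

open QTypes

/-! The proof is the method of types, applied to the columns of the Young frame.

In `V_λ` the representation `F_λ` occurs exactly once: the column antisymmetrizer maps all of `V_λ`
to multiples of the highest weight vector `h = hwVec`, so the only copy is the span `specht` of the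
orbit of `h` (`colSym_of_mem_freqSpace`, `isoSpace_self`). On this copy the operator under the trace
commutes with `S_n` and is a scalar. Hence the trace is `dim F_λ` times `‖Π_f A^{†⊗n} h‖² / ‖h‖²`,
where `Π_f` merely selects the coordinates of content `f` (`isoProj_tensorPow`, `overlap_eq`). Up to
the order of the factors and a scalar, `h` is the tensor product of one vector `v_k` for each column
of length `k`. The quotient is therefore the sum, over the words of content `f`, of products of
values `p_k` over the columns (`tensorPow_hwVec`). Words whose columns have the same types
contribute equally (`overlap_eq_sum_types`).

There are only polynomially many types, and each contributes `exp (-typeCost)` up to polynomial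
factors. The dimension has exponent `H(s)`: it is at most the number of words of content `λ`, and at
least the number of ballot words, which a determinantal recursion bounds from below
(`card_ballotWords_le`, `factorial_mul_frameDet_le`). So the exponent is `-H(s)` plus the minimum of
`typeCost / log 2` over the compact polytope of limits of rescaled types. The delicate direction is
that along every pair of sequences with nonvanishing traces there must be admissible integer types
close to the minimizer. Solvability of the integer constraints is enough for that
(`exists_tendsto_of_eventually_nonempty`). If the polytope is empty, the exponent is infinite.

A point `P` of the polytope amounts to a channel together with distributions `p ∈ 𝔓(W(δ_k),k)`:
normalize `P k` and let `W k` be its letter marginal. This turns the cost into the expression in the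
theorem.

For unitary `U` the `p_k` are probability distributions, and orthonormality of the rows of `U` gives
their letter marginals (`sum_norm_det_sq`). Then `typeCost` is the relative entropy of `P` with
respect to `gap s k * p_k`, so by Gibbs' inequality it vanishes only if the two agree, and that
point has frequency `q̃`. -/

namespace QTypes

noncomputable section

open Filter Topology

/-! ### Rows and columns of a Young frame -/

namespace YoungFrame

variable {d n : ℕ} (lam : YoungFrame d n)

/-- The row of the box that contains the number `m`. -/
def rowOf (m : Fin n) : Fin d := (lam.box m).1

/-- The column of the box that contains the number `m`. -/
def colOf (m : Fin n) : ℕ := (lam.box m).2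

/-- The boxes of the frame are in bijection with the numbers in the standard tableau. -/
def boxEquiv : Fin n ≃ (i : Fin d) × Fin (lam.row i) :=
  (finCongr lam.sum_eq.symm).trans finSigmaFinEquiv.symm

theorem boxEquiv_apply (m : Fin n) : lam.boxEquiv m = lam.box m := rfl

theorem box_symm_rowOf (b : (i : Fin d) × Fin (lam.row i)) :
    lam.rowOf (lam.boxEquiv.symm b) = b.1 := by
  simp only [rowOf, ← boxEquiv_apply, Equiv.apply_symm_apply]

theorem box_symm_colOf (b : (i : Fin d) × Fin (lam.row i)) :
    lam.colOf (lam.boxEquiv.symm b) = b.2 := by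
  simp only [colOf, ← boxEquiv_apply]
  rw [Equiv.apply_symm_apply]

theorem colOf_lt (m : Fin n) : lam.colOf m < lam.row (lam.rowOf m) := (lam.box m).2.2

theorem exists_box {i : Fin d} {j : ℕ} (h : j < lam.row i) :
    ∃ m, lam.rowOf m = i ∧ lam.colOf m = j :=
  ⟨lam.boxEquiv.symm ⟨i, ⟨j, h⟩⟩, lam.box_symm_rowOf _, lam.box_symm_colOf _⟩

theorem eq_of_row_col {m m' : Fin n} (h : lam.rowOf m = lam.rowOf m')
    (h' : lam.colOf m = lam.colOf m') : m = m' := by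
  apply lam.boxEquiv.injective
  simp only [boxEquiv_apply]
  simp only [rowOf, colOf] at h h'
  revert h h'
  generalize lam.box m = a
  generalize lam.box m' = b
  rintro h h'
  obtain ⟨a1, a2⟩ := a
  obtain ⟨b1, b2⟩ := b
  obtain rfl : a1 = b1 := h
  simp only at h'
  rw [Fin.ext h']

theorem mem_colGroup {υ : Equiv.Perm (Fin n)} :
    υ ∈ lam.colGroup ↔ ∀ m, lam.colOf (υ m) = lam.colOf m := by
  simp [colGroup, colOf]

theorem mem_rowGroup {τ : Equiv.Perm (Fin n)} :
    τ ∈ lam.rowGroup ↔ ∀ m, lam.rowOf (τ m) = lam.rowOf m := by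
  simp [rowGroup, rowOf]

theorem one_mem_colGroup : 1 ∈ lam.colGroup := by simp [mem_colGroup]

theorem mul_mem_colGroup {υ υ' : Equiv.Perm (Fin n)} (h : υ ∈ lam.colGroup)
    (h' : υ' ∈ lam.colGroup) : υ * υ' ∈ lam.colGroup := by
  rw [mem_colGroup] at *
  intro m
  simp [h, h']

theorem inv_mem_colGroup {υ : Equiv.Perm (Fin n)} (h : υ ∈ lam.colGroup) :
    υ⁻¹ ∈ lam.colGroup := by
  rw [mem_colGroup] at *
  intro m
  have := h (υ⁻¹ m)
  simpa using this.symm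

theorem count_rowOf (i : Fin d) : count lam.rowOf i = lam.row i := by
  have h : (Finset.univ.filter fun l => lam.rowOf l = i) =
      Finset.univ.image fun j : Fin (lam.row i) => lam.boxEquiv.symm ⟨i, j⟩ := by
    ext m
    simp only [Finset.mem_filter, Finset.mem_univ, true_and, Finset.mem_image]
    constructor
    · rintro rfl
      exact ⟨(lam.box m).2, by rw [Equiv.symm_apply_eq]; rfl⟩
    · rintro ⟨j, rfl⟩
      exact lam.box_symm_rowOf _
  rw [count, h, Finset.card_image_of_injective, Finset.card_univ, Fintype.card_fin]
  intro j j' hj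
  simpa using hj

end YoungFrame

/-! ### Words whose letters are distinct in each column -/

/-- Distinct natural numbers, `k` of them, add up at least to `0 + ⋯ + (k - 1)`; in case of
equality they are `0, …, k - 1`. -/
theorem sum_range_card_le_sum (s : Finset ℕ) : ∑ i ∈ Finset.range s.card, i ≤ ∑ i ∈ s, i := by
  induction s using Finset.induction_on_max with
  | empty => simp
  | insert a s ha ih =>
    have hn : a ∉ s := fun h => lt_irrefl _ (ha a h)
    rw [Finset.card_insert_of_notMem hn, Finset.sum_insert hn, Finset.sum_range_succ]
    have hc : s.card ≤ a := by
      calc s.card ≤ (Finset.range a).card := Finset.card_le_card fun x hx => by simpa using ha x hx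
        _ = a := Finset.card_range a
    omega

theorem eq_range_card_of_sum_le (s : Finset ℕ) (h : ∑ i ∈ s, i ≤ ∑ i ∈ Finset.range s.card, i) :
    s = Finset.range s.card := by
  induction s using Finset.induction_on_max with
  | empty => simp
  | insert a s ha ih =>
    have hn : a ∉ s := fun h => lt_irrefl _ (ha a h)
    rw [Finset.card_insert_of_notMem hn, Finset.sum_insert hn, Finset.sum_range_succ] at h
    have hc : s.card ≤ a := by
      calc s.card ≤ (Finset.range a).card := Finset.card_le_card fun x hx => by simpa using ha x hx
        _ = a := Finset.card_range a
    have hs := sum_range_card_le_sum s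
    have h1 : s = Finset.range s.card := ih (by omega)
    have h2 : a = s.card := by omega
    rw [Finset.card_insert_of_notMem hn, Finset.range_add_one, ← h1, ← h2]

theorem sum_eq_sum_count {d n : ℕ} (x : Fin n → Fin d) (g : Fin d → ℕ) :
    ∑ m, g (x m) = ∑ i, count x i * g i := by
  rw [← Finset.sum_fiberwise_of_maps_to (s := Finset.univ) (t := Finset.univ) (g := x)
    (fun _ _ => Finset.mem_univ _)]
  refine Finset.sum_congr rfl fun i _ => ?_
  rw [Finset.sum_congr rfl (g := fun _ => g i), Finset.sum_const, smul_eq_mul, count]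
  intro m hm
  rw [(Finset.mem_filter.1 hm).2]

namespace YoungFrame

variable {d n : ℕ} (lam : YoungFrame d n)

/-- The numbers in column `j`. -/
def column (j : ℕ) : Finset (Fin n) := Finset.univ.filter fun m => lam.colOf m = j

theorem mem_column {j : ℕ} {m : Fin n} : m ∈ lam.column j ↔ lam.colOf m = j := by simp [column]

/-- Row lengths decrease, so a column that reaches some row meets all earlier rows; the rows it
meets form an initial segment. -/
theorem image_rowOf_column (j : ℕ) :
    (lam.column j).image (fun m => (lam.rowOf m : ℕ)) = Finset.range (lam.column j).card := by
  have hinj : Set.InjOn (fun m => (lam.rowOf m : ℕ)) (lam.column j) := by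
    intro m hm m' hm' h
    have h1 := lam.mem_column.1 hm
    have h2 := lam.mem_column.1 hm'
    exact lam.eq_of_row_col (Fin.ext h) (h1.trans h2.symm)
  set s := (lam.column j).image (fun m => (lam.rowOf m : ℕ)) with hs
  have hcard : s.card = (lam.column j).card := Finset.card_image_of_injOn hinj
  have hdown : ∀ a ∈ s, ∀ b < a, b ∈ s := by
    intro a ha b hb
    obtain ⟨m, hm, rfl⟩ := Finset.mem_image.1 ha
    have hb' : b < d := hb.trans (lam.rowOf m).2
    have : j < lam.row ⟨b, hb'⟩ := by
      refine lt_of_lt_of_le ?_ (lam.antitone (show (⟨b, hb'⟩ : Fin d) ≤ lam.rowOf m from hb.le))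
      rw [← lam.mem_column.1 hm]
      exact lam.colOf_lt m
    obtain ⟨m', h1, h2⟩ := lam.exists_box this
    exact Finset.mem_image.2 ⟨m', lam.mem_column.2 h2, by rw [h1]⟩
  have hsub : Finset.range s.card = s := by
    symm
    apply Finset.eq_of_subset_of_card_le
    · intro a ha
      have : Finset.range (a + 1) ⊆ s := by
        intro b hb
        rcases (Nat.lt_succ_iff.1 (Finset.mem_range.1 hb)).lt_or_eq with h | h
        · exact hdown a ha b h
        · rw [h]; exact ha
      have := Finset.card_le_card this
      rw [Finset.card_range] at this
      exact Finset.mem_range.2 this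
    · simp
  rw [← hcard, hsub]

/-- A word of content `λ` with distinct letters in each column is a column permutation of the
word that is constant on rows. -/
theorem exists_colGroup_of_injOn {y : Fin n → Fin d} (hy : ∀ i, count y i = lam.row i)
    (hinj : ∀ m m', lam.colOf m = lam.colOf m' → y m = y m' → m = m') :
    ∃ υ ∈ lam.colGroup, y = lam.rowOf ∘ υ := by
  -- Letters are added up as numbers. Distinct letters in a column have at least the sum `0 + 1 + ⋯`
  -- attained by `rowOf`, while the total sums agree because the contents agree. So equality holds
  -- in each column, and `y` uses the same letters there as `rowOf`.
  have hsum : ∑ m, (y m : ℕ) = ∑ m, (lam.rowOf m : ℕ) := by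
    rw [sum_eq_sum_count y (fun i => (i : ℕ)), sum_eq_sum_count lam.rowOf (fun i => (i : ℕ))]
    simp [hy, count_rowOf]
  have hinjOn : ∀ j, Set.InjOn (fun m => (y m : ℕ)) (lam.column j) := fun j m hm m' hm' h =>
    hinj m m' ((lam.mem_column.1 hm).trans (lam.mem_column.1 hm').symm) (Fin.ext h)
  have hrow : ∀ j, Set.InjOn (fun m => (lam.rowOf m : ℕ)) (lam.column j) := fun j m hm m' hm' h =>
    lam.eq_of_row_col (Fin.ext h) ((lam.mem_column.1 hm).trans (lam.mem_column.1 hm').symm)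
  have hcy : ∀ j, ((lam.column j).image (fun m => (y m : ℕ))).card = (lam.column j).card :=
    fun j => Finset.card_image_of_injOn (hinjOn j)
  have hrs : ∀ j, ∑ m ∈ lam.column j, (lam.rowOf m : ℕ) =
      ∑ i ∈ Finset.range (lam.column j).card, i := by
    intro j
    rw [← image_rowOf_column, Finset.sum_image (hrow j)]
  have hge : ∀ j, ∑ m ∈ lam.column j, (lam.rowOf m : ℕ) ≤ ∑ m ∈ lam.column j, (y m : ℕ) := by
    intro j
    rw [hrs j]
    have := sum_range_card_le_sum ((lam.column j).image (fun m => (y m : ℕ)))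
    rwa [hcy, Finset.sum_image (hinjOn j)] at this
  have hcolsum : ∀ g : Fin n → ℕ, ∑ m, g m =
      ∑ j ∈ Finset.univ.image lam.colOf, ∑ m ∈ lam.column j, g m := by
    intro g
    rw [← Finset.sum_fiberwise_of_maps_to (s := Finset.univ) (t := Finset.univ.image lam.colOf)
      (g := lam.colOf) (fun m _ => Finset.mem_image_of_mem _ (Finset.mem_univ m))]
    rfl
  have heq : ∀ j ∈ Finset.univ.image lam.colOf, ∑ m ∈ lam.column j, (lam.rowOf m : ℕ) =
      ∑ m ∈ lam.column j, (y m : ℕ) := by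
    rw [hcolsum, hcolsum] at hsum
    exact (Finset.sum_eq_sum_iff_of_le fun j _ => hge j).1 hsum.symm
  have himg : ∀ m, ((lam.column (lam.colOf m)).image (fun m => (y m : ℕ))) =
      (lam.column (lam.colOf m)).image (fun m => (lam.rowOf m : ℕ)) := by
    intro m
    rw [image_rowOf_column]
    conv_rhs => rw [← hcy]
    apply eq_range_card_of_sum_le
    rw [hcy, Finset.sum_image (hinjOn _), ← heq _ (Finset.mem_image_of_mem _ (Finset.mem_univ m)),
      hrs]
  have hex : ∀ m, ∃ m', lam.colOf m' = lam.colOf m ∧ lam.rowOf m' = y m := by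
    intro m
    have : (y m : ℕ) ∈ (lam.column (lam.colOf m)).image (fun m => (y m : ℕ)) :=
      Finset.mem_image_of_mem _ (lam.mem_column.2 rfl)
    rw [himg] at this
    obtain ⟨m', h1, h2⟩ := Finset.mem_image.1 this
    exact ⟨m', lam.mem_column.1 h1, Fin.ext h2⟩
  choose υ hυ1 hυ2 using hex
  have hυ : Function.Injective υ := by
    intro m m' h
    apply hinj
    · rw [← hυ1 m, ← hυ1 m', h]
    · rw [← hυ2 m, ← hυ2 m', h]
  refine ⟨Equiv.ofBijective υ (Finite.injective_iff_bijective.1 hυ), ?_, ?_⟩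
  · rw [mem_colGroup]
    exact hυ1
  · ext m : 1
    exact (hυ2 m).symm

end YoungFrame

/-! ### The column antisymmetrizer and the highest weight vector -/

theorem permRep_apply {d n : ℕ} (τ : Equiv.Perm (Fin n)) (φ : TensorSpace d n)
    (y : Fin n → Fin d) : permRep d n τ φ y = φ (y ∘ τ) := rfl

theorem basisVec_apply {d n : ℕ} (x y : Fin n → Fin d) :
    basisVec x y = if y = x then (1 : ℂ) else 0 := by
  simp [basisVec]

theorem inner_permRep {d n : ℕ} (τ : Equiv.Perm (Fin n)) (u v : TensorSpace d n) :
    inner ℂ (permRep d n τ u) v = inner ℂ u (permRep d n τ⁻¹ v) := by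
  simp only [PiLp.inner_apply, permRep_apply]
  refine Fintype.sum_equiv (Equiv.arrowCongr τ⁻¹ (Equiv.refl _)) _ _ fun y => ?_
  have h1 : (Equiv.arrowCongr τ⁻¹ (Equiv.refl _)) y = y ∘ τ := rfl
  have h2 : (y ∘ τ) ∘ (τ⁻¹ : Equiv.Perm (Fin n)) = y := by
    ext m; simp
  rw [h1, h2]

namespace YoungFrame

variable {d n : ℕ} (lam : YoungFrame d n)

/-- The column antisymmetrizer `∑_{υ ∈ C} sgn(υ) υ` as an operator on `(ℂ^d)^{⊗ n}`. -/
def colSym : TensorSpace d n →ₗ[ℂ] TensorSpace d n :=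
  ∑ υ ∈ lam.colGroup, ((Equiv.Perm.sign υ : ℤ) : ℂ) • permRep d n υ

theorem colSym_apply (v : TensorSpace d n) :
    lam.colSym v = ∑ υ ∈ lam.colGroup, ((Equiv.Perm.sign υ : ℤ) : ℂ) • permRep d n υ v := by
  simp [colSym, LinearMap.sum_apply]

theorem sign_mul_sign (υ : Equiv.Perm (Fin n)) :
    (((Equiv.Perm.sign υ : ℤ) : ℂ)) * ((Equiv.Perm.sign υ : ℤ) : ℂ) = 1 := by
  rcases Int.units_eq_one_or (Equiv.Perm.sign υ) with h | h <;> simp [h]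

theorem colSym_permRep {υ : Equiv.Perm (Fin n)} (hυ : υ ∈ lam.colGroup) (v : TensorSpace d n) :
    lam.colSym (permRep d n υ v) = ((Equiv.Perm.sign υ : ℤ) : ℂ) • lam.colSym v := by
  rw [colSym_apply, colSym_apply, Finset.smul_sum]
  refine Finset.sum_bij' (fun τ _ => τ * υ) (fun τ _ => τ * υ⁻¹)
    (fun τ h => lam.mul_mem_colGroup h hυ)
    (fun τ h => lam.mul_mem_colGroup h (lam.inv_mem_colGroup hυ)) (by simp) (by simp) ?_
  intro τ _
  rw [Equiv.Perm.sign_mul, smul_smul, map_mul, Module.End.mul_apply]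
  congr 1
  push_cast
  rw [mul_comm, mul_assoc, sign_mul_sign, mul_one]

theorem permRep_colSym {υ : Equiv.Perm (Fin n)} (hυ : υ ∈ lam.colGroup) (v : TensorSpace d n) :
    permRep d n υ (lam.colSym v) = ((Equiv.Perm.sign υ : ℤ) : ℂ) • lam.colSym v := by
  rw [colSym_apply, Finset.smul_sum, map_sum]
  refine Finset.sum_bij' (fun τ _ => υ * τ) (fun τ _ => υ⁻¹ * τ)
    (fun τ h => lam.mul_mem_colGroup hυ h)
    (fun τ h => lam.mul_mem_colGroup (lam.inv_mem_colGroup hυ) h) (by simp) (by simp) ?_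
  intro τ _
  rw [Equiv.Perm.sign_mul, smul_smul, map_mul, Module.End.mul_apply, map_smul]
  congr 1
  push_cast
  rw [← mul_assoc, sign_mul_sign, one_mul]

theorem colSym_colSym (v : TensorSpace d n) :
    lam.colSym (lam.colSym v) = (lam.colGroup.card : ℂ) • lam.colSym v := by
  conv_lhs => rw [colSym_apply]
  rw [Finset.sum_congr rfl (g := fun _ => lam.colSym v), Finset.sum_const, Nat.cast_smul_eq_nsmul]
  intro υ hυ
  rw [lam.permRep_colSym hυ, smul_smul, sign_mul_sign, one_smul]

theorem inner_colSym (u v : TensorSpace d n) :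
    inner ℂ (lam.colSym u) v = inner ℂ u (lam.colSym v) := by
  rw [colSym_apply, colSym_apply, sum_inner, inner_sum]
  refine Finset.sum_bij' (fun τ _ => τ⁻¹) (fun τ _ => τ⁻¹)
    (fun τ h => lam.inv_mem_colGroup h) (fun τ h => lam.inv_mem_colGroup h)
    (by simp) (by simp) ?_
  intro τ _
  rw [inner_smul_left, inner_smul_right, inner_permRep, Equiv.Perm.sign_inv]
  simp

/-- The (unnormalized) highest weight vector `∑_{υ ∈ C} sgn(υ) υ e_x`, where `x` is the word that
is constant on rows. -/
def hwVec : TensorSpace d n := lam.colSym (basisVec lam.rowOf)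

theorem colSym_hwVec : lam.colSym lam.hwVec = (lam.colGroup.card : ℂ) • lam.hwVec :=
  lam.colSym_colSym _

theorem card_colGroup_ne_zero : (lam.colGroup.card : ℂ) ≠ 0 := by
  rw [Nat.cast_ne_zero, Finset.card_ne_zero]
  exact ⟨1, lam.one_mem_colGroup⟩

theorem hwVec_apply (z : Fin n → Fin d) :
    lam.hwVec z =
      ∑ υ ∈ lam.colGroup, ((Equiv.Perm.sign υ : ℤ) : ℂ) * if z ∘ υ = lam.rowOf then 1 else 0 := by
  rw [hwVec, colSym_apply]
  simp [permRep_apply, basisVec_apply]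

theorem eq_one_of_colGroup {υ : Equiv.Perm (Fin n)} (hυ : υ ∈ lam.colGroup)
    (h : lam.rowOf ∘ υ = lam.rowOf) : υ = 1 := by
  ext m : 1
  exact lam.eq_of_row_col (congrFun h m) (lam.mem_colGroup.1 hυ m)

theorem hwVec_rowOf : lam.hwVec lam.rowOf = 1 := by
  rw [hwVec_apply, Finset.sum_eq_single 1]
  · simp
  · intro υ hυ hne
    rw [if_neg fun h => hne (lam.eq_one_of_colGroup hυ h), mul_zero]
  · intro h
    exact absurd lam.one_mem_colGroup h

theorem hwVec_ne_zero : lam.hwVec ≠ 0 := by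
  intro h
  have := lam.hwVec_rowOf
  rw [h] at this
  simp at this

theorem inner_hwVec_self : inner ℂ lam.hwVec lam.hwVec = (lam.colGroup.card : ℂ) := by
  conv_lhs => lhs; rw [hwVec]
  rw [inner_colSym, colSym_hwVec, inner_smul_right, basisVec, EuclideanSpace.inner_single_left,
    hwVec_rowOf]
  simp

/-- The column antisymmetrizer maps every basis vector of content `λ` to a multiple of the
highest weight vector. -/
theorem colSym_basisVec {y : Fin n → Fin d} (hy : ∀ i, count y i = lam.row i) :
    ∃ c : ℂ, lam.colSym (basisVec y) = c • lam.hwVec := by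
  by_cases hinj : ∀ m m', lam.colOf m = lam.colOf m' → y m = y m' → m = m'
  · obtain ⟨υ, hυ, rfl⟩ := lam.exists_colGroup_of_injOn hy hinj
    refine ⟨((Equiv.Perm.sign υ⁻¹ : ℤ) : ℂ), ?_⟩
    have : basisVec (lam.rowOf ∘ υ) = permRep d n υ⁻¹ (basisVec lam.rowOf) := by
      rw [permRep_basisVec]; rfl
    rw [this, lam.colSym_permRep (lam.inv_mem_colGroup hυ), hwVec]
  · push Not at hinj
    obtain ⟨m, m', hc, hyy, hne⟩ := hinj
    refine ⟨0, ?_⟩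
    -- Two equal letters in one column: their transposition fixes `e_y` but changes the sign of the
    -- antisymmetrization, which must vanish.
    have hmem : Equiv.swap m m' ∈ lam.colGroup := by
      rw [mem_colGroup]
      intro a
      rw [Equiv.swap_apply_def]
      split_ifs with h1 h2
      · rw [h1, hc]
      · rw [h2, hc]
      · rfl
    have hfix : permRep d n (Equiv.swap m m') (basisVec y) = basisVec y := by
      rw [permRep_basisVec]
      congr 1
      ext a : 1
      simp only [Equiv.symm_swap, Function.comp_apply]
      rw [Equiv.swap_apply_def]
      split_ifs with h1 h2
      · rw [h1, hyy]
      · rw [h2, hyy]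
      · rfl
    have h := lam.colSym_permRep hmem (basisVec y)
    rw [hfix, Equiv.Perm.sign_swap hne] at h
    have h2 : (2 : ℂ) • lam.colSym (basisVec y) = 0 := by
      rw [two_smul]
      nth_rewrite 1 [h]
      simp
    rw [zero_smul]
    exact (smul_eq_zero.1 h2).resolve_left two_ne_zero

/-- This one-dimensionality is what makes `F_λ` occur only once in `V_λ`; it stands in for Schur's
lemma below. -/
theorem colSym_of_mem_freqSpace {v : TensorSpace d n} (hv : v ∈ freqSpace lam.toFreq) :
    ∃ c : ℂ, lam.colSym v = c • lam.hwVec := by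
  induction hv using Submodule.span_induction with
  | mem x hx =>
    obtain ⟨y, hy, rfl⟩ := hx
    exact lam.colSym_basisVec hy
  | zero => exact ⟨0, by simp⟩
  | add x y _ _ hx hy =>
    obtain ⟨a, ha⟩ := hx
    obtain ⟨b, hb⟩ := hy
    exact ⟨a + b, by rw [map_add, ha, hb, add_smul]⟩
  | smul a x _ hx =>
    obtain ⟨b, hb⟩ := hx
    exact ⟨a * b, by rw [map_smul, hb, smul_smul]⟩

end YoungFrame

/-! ### Equivariant operators and frequency subspaces -/

theorem tensorPow_apply {d : ℕ} (n : ℕ) (A : Matrix (Fin d) (Fin d) ℂ) (v : TensorSpace d n)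
    (x : Fin n → Fin d) : tensorPow n A v x = ∑ y, (∏ i, A (x i) (y i)) * v y := by
  simp [tensorPow, Matrix.toLpLin_apply, Matrix.mulVec, dotProduct]

theorem tensorPow_permRep {d n : ℕ} (A : Matrix (Fin d) (Fin d) ℂ) (τ : Equiv.Perm (Fin n))
    (v : TensorSpace d n) :
    tensorPow n A (permRep d n τ v) = permRep d n τ (tensorPow n A v) := by
  ext x
  rw [permRep_apply, tensorPow_apply, tensorPow_apply]
  refine Fintype.sum_equiv (Equiv.arrowCongr τ⁻¹ (Equiv.refl _)) _ _ fun y => ?_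
  have h1 : (Equiv.arrowCongr τ⁻¹ (Equiv.refl _)) y = y ∘ τ := rfl
  rw [h1, permRep_apply]
  congr 1
  exact (Equiv.prod_comp τ fun i => A (x i) (y i)).symm

theorem inner_tensorPow {d n : ℕ} (A : Matrix (Fin d) (Fin d) ℂ) (u v : TensorSpace d n) :
    inner ℂ u (tensorPow n A v) = inner ℂ (tensorPow n A.conjTranspose u) v := by
  have h : tensorPow n A.conjTranspose = LinearMap.adjoint (tensorPow n A) := by
    rw [tensorPow, tensorPow, ← Matrix.toEuclideanLin_conjTranspose_eq_adjoint]
    congr 1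
    ext x y
    simp [Matrix.conjTranspose_apply]
  rw [h, LinearMap.adjoint_inner_left]

theorem count_comp_perm {d n : ℕ} (x : Fin n → Fin d) (τ : Equiv.Perm (Fin n)) (i : Fin d) :
    count (x ∘ τ) i = count x i := by
  rw [count, count]
  refine Finset.card_bij (fun l _ => τ l) (by simp) (by simp) ?_
  intro l hl
  exact ⟨τ⁻¹ l, by simpa using hl, by simp⟩

/-- The coordinate projection onto `V_f`. -/
def freqProj {d n : ℕ} (f : Freq d n) : TensorSpace d n →ₗ[ℂ] TensorSpace d n where
  toFun v := WithLp.toLp 2 fun x => if ∀ i, count x i = f.toFun i then v x else 0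
  map_add' u v := by
    ext x
    simp only [PiLp.add_apply]
    split_ifs <;> simp
  map_smul' c v := by
    ext x
    simp only [PiLp.smul_apply, RingHom.id_apply]
    split_ifs <;> simp

theorem freqProj_apply {d n : ℕ} (f : Freq d n) (v : TensorSpace d n) (x : Fin n → Fin d) :
    freqProj f v x = if ∀ i, count x i = f.toFun i then v x else 0 := rfl

theorem freqProj_permRep {d n : ℕ} (f : Freq d n) (τ : Equiv.Perm (Fin n)) (v : TensorSpace d n) :
    freqProj f (permRep d n τ v) = permRep d n τ (freqProj f v) := by
  ext x
  simp only [permRep_apply, freqProj_apply, count_comp_perm]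

theorem mem_freqSpace_iff {d n : ℕ} {f : Freq d n} {v : TensorSpace d n} :
    v ∈ freqSpace f ↔ ∀ x, (¬ ∀ i, count x i = f.toFun i) → v x = 0 := by
  constructor
  · intro hv x hx
    induction hv using Submodule.span_induction with
    | mem u hu =>
      obtain ⟨y, hy, rfl⟩ := hu
      rw [basisVec_apply, if_neg]
      rintro rfl
      exact hx hy
    | zero => rfl
    | add u w _ _ hu hw => rw [PiLp.add_apply, hu, hw, add_zero]
    | smul a u _ hu => rw [PiLp.smul_apply, hu, smul_zero]
  · intro h
    have hv : v = ∑ x, v x • basisVec x := by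
      ext y
      simp [basisVec_apply, Finset.sum_apply]
    rw [hv]
    refine Submodule.sum_mem _ fun x _ => ?_
    by_cases hx : ∀ i, count x i = f.toFun i
    · exact Submodule.smul_mem _ _ (Submodule.subset_span ⟨x, hx, rfl⟩)
    · rw [h x hx, zero_smul]
      exact Submodule.zero_mem _

theorem freqProj_mem {d n : ℕ} (f : Freq d n) (v : TensorSpace d n) :
    freqProj f v ∈ freqSpace f :=
  mem_freqSpace_iff.2 fun x hx => by rw [freqProj_apply, if_neg hx]

theorem inner_sub_freqProj {d n : ℕ} (f : Freq d n) (v : TensorSpace d n) {w : TensorSpace d n}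
    (hw : w ∈ freqSpace f) : inner ℂ w (v - freqProj f v) = 0 := by
  rw [PiLp.inner_apply]
  refine Finset.sum_eq_zero fun x _ => ?_
  rw [PiLp.sub_apply, freqProj_apply]
  split_ifs with h
  · simp
  · rw [mem_freqSpace_iff.1 hw x h]; simp

theorem permRep_mem_freqSpace {d n : ℕ} {f : Freq d n} {v : TensorSpace d n}
    (hv : v ∈ freqSpace f) (τ : Equiv.Perm (Fin n)) : permRep d n τ v ∈ freqSpace f := by
  rw [mem_freqSpace_iff] at *
  intro x hx
  rw [permRep_apply]
  apply hv
  simpa only [count_comp_perm] using hx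

theorem isoSpace_le_freqSpace {d n : ℕ} (f : Freq d n) (lam : YoungFrame d n) :
    isoSpace f lam ≤ freqSpace f := sSup_le fun _ hW => hW.1

namespace YoungFrame

variable {d n : ℕ} (lam : YoungFrame d n)

/-! ### The irreducible subspace generated by the highest weight vector -/

/-- The subrepresentation generated by the highest weight vector. -/
def specht : Submodule ℂ (TensorSpace d n) :=
  Submodule.span ℂ (Set.range fun σ => permRep d n σ lam.hwVec)

theorem hwVec_mem_specht : lam.hwVec ∈ lam.specht :=
  Submodule.subset_span ⟨1, by simp⟩

theorem permRep_mem_specht (σ : Equiv.Perm (Fin n)) {u : TensorSpace d n} (hu : u ∈ lam.specht) :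
    permRep d n σ u ∈ lam.specht := by
  induction hu using Submodule.span_induction with
  | mem x hx =>
    obtain ⟨τ, rfl⟩ := hx
    exact Submodule.subset_span ⟨σ * τ, by simp only [map_mul, Module.End.mul_apply]⟩
  | zero => simp
  | add x y _ _ hx hy => rw [map_add]; exact Submodule.add_mem _ hx hy
  | smul a x _ hx => rw [map_smul]; exact Submodule.smul_mem _ _ hx

theorem colSym_mem_freqSpace {f : Freq d n} {u : TensorSpace d n} (hu : u ∈ freqSpace f) :
    lam.colSym u ∈ freqSpace f := by
  rw [colSym_apply]
  exact Submodule.sum_mem _ fun υ _ => Submodule.smul_mem _ _ (permRep_mem_freqSpace hu υ)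

theorem hwVec_mem_freqSpace : lam.hwVec ∈ freqSpace lam.toFreq :=
  lam.colSym_mem_freqSpace (Submodule.subset_span ⟨_, lam.count_rowOf, rfl⟩)

theorem specht_le_freqSpace : lam.specht ≤ freqSpace lam.toFreq := by
  refine Submodule.span_le.2 ?_
  rintro _ ⟨σ, rfl⟩
  exact permRep_mem_freqSpace lam.hwVec_mem_freqSpace σ

/-- The highest weight vector lies in the orbit span of every nonzero vector of the irreducible
subspace. -/
theorem exists_colSym_eq {u : TensorSpace d n} (hu : u ∈ lam.specht) (h0 : u ≠ 0) :
    ∃ σ, ∃ c : ℂ, c ≠ 0 ∧ lam.colSym (permRep d n σ u) = c • lam.hwVec := by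
  -- A nonzero vector of a span is not orthogonal to all generators. Self-adjointness of `colSym`
  -- turns the nonzero inner product into one with `colSym (σ⁻¹ u)`, which is a multiple of `hwVec`;
  -- the factor cannot be zero.
  have : ∃ σ, inner ℂ (permRep d n σ lam.hwVec) u ≠ 0 := by
    by_contra! h
    apply h0
    have : ∀ w ∈ lam.specht, inner ℂ w u = 0 := by
      intro w hw
      induction hw using Submodule.span_induction with
      | mem x hx => obtain ⟨σ, rfl⟩ := hx; exact h σ
      | zero => simp
      | add x y _ _ hx hy => rw [inner_add_left, hx, hy, add_zero]
      | smul a x _ hx => rw [inner_smul_left, hx, mul_zero]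
    exact inner_self_eq_zero.1 (this u hu)
  obtain ⟨σ, hσ⟩ := this
  obtain ⟨c, hc⟩ := lam.colSym_of_mem_freqSpace
    (lam.specht_le_freqSpace (lam.permRep_mem_specht σ⁻¹ hu))
  refine ⟨σ⁻¹, c, ?_, hc⟩
  rintro rfl
  apply hσ
  rw [inner_permRep, hwVec, inner_colSym, hc]
  simp

/-- A linear map that commutes with the permutations of the tensor factors. -/
def IsEquivariant (T : TensorSpace d n →ₗ[ℂ] TensorSpace d n) : Prop :=
  ∀ σ v, T (permRep d n σ v) = permRep d n σ (T v)

theorem IsEquivariant.colSym {T : TensorSpace d n →ₗ[ℂ] TensorSpace d n} (hT : IsEquivariant T)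
    (v : TensorSpace d n) : T (lam.colSym v) = lam.colSym (T v) := by
  simp only [colSym_apply, map_sum, map_smul, hT _ _]

theorem IsEquivariant.eq_smul_of_mem_specht {T : TensorSpace d n →ₗ[ℂ] TensorSpace d n}
    (hT : IsEquivariant T) {c : ℂ} (h : T lam.hwVec = c • lam.hwVec) {u : TensorSpace d n}
    (hu : u ∈ lam.specht) : T u = c • u := by
  induction hu using Submodule.span_induction with
  | mem x hx => obtain ⟨σ, rfl⟩ := hx; rw [hT, h, map_smul]
  | zero => simp
  | add x y _ _ hx hy => rw [map_add, hx, hy, smul_add]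
  | smul a x _ hx => rw [map_smul, hx, smul_comm]

/-! ### The left ideal generated by the Young symmetrizer -/

/-- The row symmetrizer `∑_{τ ∈ R} τ` as an operator on `(ℂ^d)^{⊗ n}`. -/
def rowSym : TensorSpace d n →ₗ[ℂ] TensorSpace d n := ∑ τ ∈ lam.rowGroup, permRep d n τ

theorem asAlgebraHom_symmetrizer (v : TensorSpace d n) :
    (permRep d n).asAlgebraHom lam.symmetrizer v = lam.colSym (lam.rowSym v) := by
  rw [symmetrizer, colSym_apply, map_sum, LinearMap.sum_apply]
  refine Finset.sum_congr rfl fun υ _ => ?_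
  rw [map_sum, LinearMap.sum_apply, rowSym, LinearMap.sum_apply, map_sum, Finset.smul_sum]
  refine Finset.sum_congr rfl fun τ _ => ?_
  rw [Representation.asAlgebraHom_single, LinearMap.smul_apply, map_mul, Module.End.mul_apply]

/-- The Young symmetrizer as an element of the left ideal it generates. -/
def symmetrizerMem : lam.irrepSpace := ⟨lam.symmetrizer, Ideal.subset_span rfl⟩

theorem intertwining_smul (φ : Representation.IntertwiningMap lam.irrep (permRep d n))
    (z : MonoidAlgebra ℂ (Equiv.Perm (Fin n))) (y : lam.irrepSpace) :
    φ (z • y) = (permRep d n).asAlgebraHom z (φ y) := by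
  induction z using MonoidAlgebra.induction_linear with
  | zero => simp
  | add a b ha hb => rw [add_smul, map_add, ha, hb, map_add, LinearMap.add_apply]
  | single g a =>
    have h1 : (MonoidAlgebra.single g a : MonoidAlgebra ℂ (Equiv.Perm (Fin n))) • y =
        a • lam.irrep g y := by
      apply Subtype.ext
      change MonoidAlgebra.single g a * (y : MonoidAlgebra ℂ (Equiv.Perm (Fin n))) =
        a • (MonoidAlgebra.single g 1 * (y : MonoidAlgebra ℂ (Equiv.Perm (Fin n))))
      rw [← smul_mul_assoc, MonoidAlgebra.smul_single, smul_eq_mul, mul_one]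
    rw [h1, map_smul, Representation.asAlgebraHom_single, LinearMap.smul_apply]
    congr 1
    exact LinearMap.congr_fun (φ.isIntertwining' g) y

/-- By Maschke the left ideal has an equivariant retraction `r` of the group algebra. The
symmetrizer `c` satisfies `c = r c = c • r 1`, so `φ c` is `c` applied to the vector `φ (r 1)` of
the range. No quasi-idempotence of `c` is needed. -/
theorem exists_intertwining_symmetrizer
    (φ : Representation.IntertwiningMap lam.irrep (permRep d n)) :
    ∃ v ∈ LinearMap.range φ.toLinearMap, φ lam.symmetrizerMem = lam.colSym (lam.rowSym v) := by
  obtain ⟨r, hr⟩ := MonoidAlgebra.exists_leftInverse_of_injective lam.irrepSpace.subtype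
    lam.irrepSpace.ker_subtype
  refine ⟨φ (r 1), ⟨r 1, rfl⟩, ?_⟩
  rw [← asAlgebraHom_symmetrizer, ← intertwining_smul, ← map_smul, smul_eq_mul, mul_one]
  congr 1
  exact (LinearMap.congr_fun hr lam.symmetrizerMem).symm

/-- The evaluation `y ↦ y e_x` at the word `x` that is constant on rows. -/
def evalRow : lam.irrepSpace →ₗ[ℂ] TensorSpace d n :=
  LinearMap.applyₗ (basisVec lam.rowOf) ∘ₗ (permRep d n).asAlgebraHom.toLinearMap ∘ₗ
    (lam.irrepSpace.subtype).restrictScalars ℂ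

theorem evalRow_apply (y : lam.irrepSpace) :
    lam.evalRow y = (permRep d n).asAlgebraHom (y : MonoidAlgebra ℂ (Equiv.Perm (Fin n)))
      (basisVec lam.rowOf) := rfl

theorem evalRow_irrep (σ : Equiv.Perm (Fin n)) (y : lam.irrepSpace) :
    lam.evalRow (lam.irrep σ y) = permRep d n σ (lam.evalRow y) := by
  rw [evalRow_apply, evalRow_apply]
  change (permRep d n).asAlgebraHom (MonoidAlgebra.of ℂ (Equiv.Perm (Fin n)) σ *
    (y : MonoidAlgebra ℂ (Equiv.Perm (Fin n)))) (basisVec lam.rowOf) = _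
  rw [map_mul, Module.End.mul_apply, Representation.asAlgebraHom_of]

theorem symmetrizer_mul_single {τ : Equiv.Perm (Fin n)} (hτ : τ ∈ lam.rowGroup) :
    lam.symmetrizer * MonoidAlgebra.single τ 1 = lam.symmetrizer := by
  rw [symmetrizer, Finset.sum_mul]
  refine Finset.sum_congr rfl fun υ _ => ?_
  rw [Finset.sum_mul]
  refine Finset.sum_bij' (fun σ _ => σ * τ) (fun σ _ => σ * τ⁻¹) ?_ ?_ (by simp) (by simp) ?_
  · intro σ hσ
    rw [mem_rowGroup] at *
    intro m
    simp [hσ, hτ]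
  · intro σ hσ
    rw [mem_rowGroup] at *
    intro m
    have := hτ (τ⁻¹ m)
    simp only [Equiv.Perm.coe_mul, Function.comp_apply, hσ]
    simpa using this.symm
  · intro σ _
    rw [MonoidAlgebra.single_mul_single, mul_one, mul_assoc]

/-- The symmetrizer absorbs row permutations from the right, hence so does every element of the left
ideal it generates. -/
theorem coeff_mul_of_mem_rowGroup (y : lam.irrepSpace) {τ : Equiv.Perm (Fin n)}
    (hτ : τ ∈ lam.rowGroup) (σ : Equiv.Perm (Fin n)) :
    (y : MonoidAlgebra ℂ (Equiv.Perm (Fin n))).coeff (σ * τ) =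
      (y : MonoidAlgebra ℂ (Equiv.Perm (Fin n))).coeff σ := by
  obtain ⟨z, hz⟩ := Ideal.mem_span_singleton'.1 y.2
  have h : (y : MonoidAlgebra ℂ (Equiv.Perm (Fin n))) * MonoidAlgebra.single τ (1 : ℂ) =
      (y : MonoidAlgebra ℂ (Equiv.Perm (Fin n))) := by
    rw [← hz, mul_assoc, lam.symmetrizer_mul_single hτ]
  conv_lhs => rw [← h]
  rw [MonoidAlgebra.coeff_mul_single_eq_coeff_mul σ (by simp), mul_one]

/-- The row group is the stabilizer of the row word. So the coordinate of `y e_x` at `rowOf ∘ σ₀⁻¹`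
sums the coefficients of `y` over the coset of `σ₀`, where they are all equal to the one at `σ₀`. -/
theorem evalRow_injective : Function.Injective lam.evalRow := by
  rw [injective_iff_map_eq_zero]
  intro y hy
  apply Subtype.ext
  refine MonoidAlgebra.ext (Finsupp.ext fun σ₀ => ?_)
  have h1 : lam.evalRow y = ∑ σ, (y : MonoidAlgebra ℂ (Equiv.Perm (Fin n))).coeff σ •
      basisVec (lam.rowOf ∘ σ.symm) := by
    rw [evalRow_apply, Representation.asAlgebraHom_def, MonoidAlgebra.lift_apply,
      Finsupp.sum_fintype _ _ (by simp), LinearMap.sum_apply]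
    refine Finset.sum_congr rfl fun σ _ => ?_
    rw [LinearMap.smul_apply, permRep_basisVec]
  have h2 : lam.evalRow y (lam.rowOf ∘ σ₀.symm) =
      ∑ σ ∈ Finset.univ.filter fun σ : Equiv.Perm (Fin n) =>
        lam.rowOf ∘ σ₀.symm = lam.rowOf ∘ σ.symm,
        (y : MonoidAlgebra ℂ (Equiv.Perm (Fin n))).coeff σ := by
    rw [h1, Finset.sum_filter]
    simp [basisVec_apply]
  rw [hy, Finset.sum_congr rfl (g := fun _ => (y : MonoidAlgebra ℂ (Equiv.Perm (Fin n))).coeff σ₀),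
    Finset.sum_const, nsmul_eq_mul] at h2
  · have h3 : ((Finset.univ.filter fun σ : Equiv.Perm (Fin n) =>
        lam.rowOf ∘ σ₀.symm = lam.rowOf ∘ σ.symm).card : ℂ) ≠ 0 := by
      rw [Nat.cast_ne_zero, Finset.card_ne_zero]
      exact ⟨σ₀, by simp⟩
    exact (mul_eq_zero.1 h2.symm).resolve_left h3
  · intro σ hσ
    have hσ' : lam.rowOf ∘ σ₀.symm = lam.rowOf ∘ σ.symm := (Finset.mem_filter.1 hσ).2
    have : σ₀⁻¹ * σ ∈ lam.rowGroup := by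
      rw [mem_rowGroup]
      intro m
      have := congrFun hσ' (σ m)
      simpa using this
    have h := lam.coeff_mul_of_mem_rowGroup y this σ₀
    rwa [mul_inv_cancel_left] at h

theorem rowSym_basisVec :
    lam.rowSym (basisVec lam.rowOf) = (lam.rowGroup.card : ℂ) • basisVec lam.rowOf := by
  rw [rowSym, LinearMap.sum_apply, Finset.sum_congr rfl (g := fun _ => basisVec lam.rowOf),
    Finset.sum_const, Nat.cast_smul_eq_nsmul]
  intro τ hτ
  rw [permRep_basisVec]
  congr 1
  ext m : 1
  have := lam.mem_rowGroup.1 hτ (τ.symm m)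
  simpa using this.symm

theorem evalRow_symmetrizer :
    lam.evalRow lam.symmetrizerMem = (lam.rowGroup.card : ℂ) • lam.hwVec := by
  rw [evalRow_apply, symmetrizerMem, asAlgebraHom_symmetrizer, rowSym_basisVec, map_smul, hwVec]

theorem card_rowGroup_ne_zero : (lam.rowGroup.card : ℂ) ≠ 0 := by
  rw [Nat.cast_ne_zero, Finset.card_ne_zero]
  exact ⟨1, by simp [mem_rowGroup]⟩

theorem asAlgebraHom_hwVec_mem (z : MonoidAlgebra ℂ (Equiv.Perm (Fin n))) :
    (permRep d n).asAlgebraHom z lam.hwVec ∈ lam.specht := by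
  induction z using MonoidAlgebra.induction_linear with
  | zero => simp
  | add a b ha hb => rw [map_add, LinearMap.add_apply]; exact Submodule.add_mem _ ha hb
  | single g a =>
    rw [Representation.asAlgebraHom_single, LinearMap.smul_apply]
    exact Submodule.smul_mem _ _ (lam.permRep_mem_specht g lam.hwVec_mem_specht)

/-- The symmetrizer sends the row word to `|R|` times `hwVec`. With injectivity this identifies the
ideal that carries `F_λ` with `specht`. -/
theorem range_evalRow : LinearMap.range lam.evalRow = lam.specht := by
  apply le_antisymm
  · rintro _ ⟨y, rfl⟩
    obtain ⟨z, hz⟩ := Ideal.mem_span_singleton'.1 y.2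
    rw [evalRow_apply, ← hz, map_mul, Module.End.mul_apply, asAlgebraHom_symmetrizer,
      rowSym_basisVec, map_smul, map_smul]
    exact Submodule.smul_mem _ _ (lam.asAlgebraHom_hwVec_mem z)
  · refine Submodule.span_le.2 ?_
    rintro _ ⟨σ, rfl⟩
    refine ⟨(lam.rowGroup.card : ℂ)⁻¹ • lam.irrep σ lam.symmetrizerMem, ?_⟩
    rw [map_smul, evalRow_irrep, evalRow_symmetrizer, map_smul, smul_smul,
      inv_mul_cancel₀ lam.card_rowGroup_ne_zero, one_smul]

/-! ### The isotypical components -/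

/-- An equivariant operator that maps the irreducible subspace into `V_f` maps it into
`V_{f,λ}`. -/
theorem IsEquivariant.mem_isoSpace {T : TensorSpace d n →ₗ[ℂ] TensorSpace d n}
    (hT : IsEquivariant T) {f : Freq d n} (hf : ∀ u ∈ lam.specht, T u ∈ freqSpace f)
    {u : TensorSpace d n} (hu : u ∈ lam.specht) : T u ∈ isoSpace f lam := by
  -- Irreducibility as a dichotomy: an injective `T` produces a copy of `F_λ`. If `T` kills some
  -- nonzero vector, it kills `hwVec`, which `exists_colSym_eq` reaches from that vector, and then
  -- everything.
  by_cases hinj : Function.Injective (T ∘ₗ lam.evalRow)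
  · have hle : LinearMap.range (T ∘ₗ lam.evalRow) ≤ isoSpace f lam := by
      refine le_sSup ⟨?_, ⟨T ∘ₗ lam.evalRow, ?_⟩, hinj, rfl⟩
      · rintro _ ⟨y, rfl⟩
        exact hf _ (lam.range_evalRow ▸ ⟨y, rfl⟩)
      · intro g
        ext y : 1
        simp only [LinearMap.comp_apply, evalRow_irrep, hT _ _]
    rw [← range_evalRow] at hu
    obtain ⟨y, rfl⟩ := hu
    exact hle ⟨y, rfl⟩
  · rw [injective_iff_map_eq_zero] at hinj
    push Not at hinj
    obtain ⟨y, hy, hy0⟩ := hinj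
    have h1 : lam.evalRow y ∈ lam.specht := lam.range_evalRow ▸ ⟨y, rfl⟩
    have h2 : lam.evalRow y ≠ 0 := fun h => hy0 (lam.evalRow_injective (by simpa using h))
    obtain ⟨σ, c, hc, h3⟩ := lam.exists_colSym_eq h1 h2
    have h4 : c • T lam.hwVec = 0 := by
      rw [← map_smul, ← h3, hT.colSym, hT]
      have : T (lam.evalRow y) = 0 := hy
      simp [this]
    have h5 : T lam.hwVec = (0 : ℂ) • lam.hwVec := by
      rw [zero_smul]
      exact (smul_eq_zero.1 h4).resolve_left hc
    rw [hT.eq_smul_of_mem_specht lam h5 hu, zero_smul]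
    exact Submodule.zero_mem _

/-- For any copy of `F_λ` inside `V_λ`, the image of the symmetrizer is an antisymmetrization of a
vector of `V_λ`, hence a multiple of `hwVec`. As the symmetrizer generates the ideal, the whole copy
lies in `specht`. -/
theorem isoSpace_self : isoSpace lam.toFreq lam = lam.specht := by
  apply le_antisymm
  · refine sSup_le ?_
    rintro W ⟨hW, φ, -, rfl⟩
    obtain ⟨v, hv, hφ⟩ := lam.exists_intertwining_symmetrizer φ
    have hrow : lam.rowSym v ∈ freqSpace lam.toFreq := by
      rw [rowSym, LinearMap.sum_apply]
      exact Submodule.sum_mem _ fun τ _ => permRep_mem_freqSpace (hW hv) τ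
    obtain ⟨c, hc⟩ := lam.colSym_of_mem_freqSpace hrow
    rintro _ ⟨y, rfl⟩
    obtain ⟨z, hz⟩ := Ideal.mem_span_singleton'.1 y.2
    have : y = z • lam.symmetrizerMem := Subtype.ext hz.symm
    rw [this]
    change φ (z • lam.symmetrizerMem) ∈ _
    rw [intertwining_smul, hφ, hc, map_smul]
    exact Submodule.smul_mem _ _ (lam.asAlgebraHom_hwVec_mem z)
  · intro u hu
    exact IsEquivariant.mem_isoSpace lam (T := LinearMap.id) (fun _ _ => rfl)
      (fun u hu => lam.specht_le_freqSpace hu) hu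

/-- Cutting out the coordinates of content `f` is equivariant, so it already lands in `V_{f,λ}`, and
what it removes is orthogonal to all of `V_f`. Thus the middle projection becomes explicit. -/
theorem isoProj_tensorPow (A : Matrix (Fin d) (Fin d) ℂ) (f : Freq d n) {u : TensorSpace d n}
    (hu : u ∈ lam.specht) : isoProj f lam (tensorPow n A u) = freqProj f (tensorPow n A u) := by
  have hT : IsEquivariant (freqProj f ∘ₗ tensorPow n A) := by
    intro σ v
    simp only [LinearMap.comp_apply, tensorPow_permRep, freqProj_permRep]
  refine Submodule.eq_starProjection_of_mem_orthogonal
    (K := isoSpace f lam) (hT.mem_isoSpace lam (fun u _ => freqProj_mem f _) hu) ?_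
  rw [Submodule.mem_orthogonal]
  intro w hw
  exact inner_sub_freqProj f _ (isoSpace_le_freqSpace f lam hw)

theorem permRep_isoProj_self (σ : Equiv.Perm (Fin n)) (v : TensorSpace d n) :
    isoProj lam.toFreq lam (permRep d n σ v) = permRep d n σ (isoProj lam.toFreq lam v) := by
  have hS := lam.isoSpace_self
  refine Submodule.eq_starProjection_of_mem_orthogonal (K := isoSpace lam.toFreq lam) ?_ ?_
  · rw [hS]
    refine lam.permRep_mem_specht σ ?_
    rw [← hS]
    exact Submodule.starProjection_apply_mem _ _
  · rw [Submodule.mem_orthogonal]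
    intro w hw
    rw [← map_sub, ← inv_inv σ, ← inner_permRep]
    rw [hS] at hw
    have hw' := lam.permRep_mem_specht σ⁻¹ hw
    rw [← hS] at hw'
    exact Submodule.inner_right_of_mem_orthogonal hw' (Submodule.sub_starProjection_mem_orthogonal v)

/-- The trace `tr { P_{λ,λ} A^{⊗ n} P_{f,λ} A^{†⊗ n} }` in terms of the highest weight vector. -/
theorem overlap_eq (A : Matrix (Fin d) (Fin d) ℂ) (f : Freq d n) :
    overlap A lam f = Module.finrank ℂ lam.specht *
      ((∑ x, if ∀ i, count x i = f.toFun i then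
        ‖tensorPow n A.conjTranspose lam.hwVec x‖ ^ 2 else 0) / lam.colGroup.card) := by
  set P := isoProj lam.toFreq lam with hP
  set h := lam.hwVec with hh
  have hS := lam.isoSpace_self
  have hPmem : ∀ v, P v ∈ lam.specht := fun v => by
    rw [← hS]; exact Submodule.starProjection_apply_mem _ _
  have hPid : ∀ v ∈ lam.specht, P v = v := fun v hv => by
    rw [← hS] at hv; exact Submodule.starProjection_eq_self_iff.2 hv
  have hproj : LinearMap.IsProj lam.specht P := ⟨hPmem, hPid⟩
  set T := P ∘ₗ tensorPow n A ∘ₗ freqProj f ∘ₗ tensorPow n A.conjTranspose with hTdef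
  have hT : IsEquivariant T := by
    intro σ v
    simp only [hTdef, LinearMap.comp_apply, tensorPow_permRep, freqProj_permRep]
    exact lam.permRep_isoProj_self σ _
  -- `T h` lies in `V_λ`, so `colSym (T h)` is a multiple of `h`; by equivariance it also equals
  -- `|C| • T h`.
  obtain ⟨c, hc⟩ : ∃ c : ℂ, T h = c • h := by
    obtain ⟨c, hc⟩ := lam.colSym_of_mem_freqSpace (lam.specht_le_freqSpace (hPmem
      ((tensorPow n A ∘ₗ freqProj f ∘ₗ tensorPow n A.conjTranspose) h)))
    have h1 : lam.colSym (T h) = c • h := hc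
    rw [← hT.colSym, hh, colSym_hwVec, map_smul] at h1
    refine ⟨(lam.colGroup.card : ℂ)⁻¹ * c, ?_⟩
    rw [← smul_smul, ← h1, smul_smul, inv_mul_cancel₀ lam.card_colGroup_ne_zero, one_smul]
  have hTS : ∀ u ∈ lam.specht, T u = c • u := fun u hu => hT.eq_smul_of_mem_specht lam hc hu
  -- Writing `P = P ∘ P` and moving one factor around the trace restricts the operator to `specht`,
  -- where it is the scalar `c`.
  have htrace : LinearMap.trace ℂ (TensorSpace d n)
      (P ∘ₗ tensorPow n A ∘ₗ isoProj f lam ∘ₗ tensorPow n A.conjTranspose) =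
      c * Module.finrank ℂ lam.specht := by
    have h1 : P = P ∘ₗ P := by
      ext1 v; exact (hPid _ (hPmem v)).symm
    have h2 : (P ∘ₗ tensorPow n A ∘ₗ isoProj f lam ∘ₗ tensorPow n A.conjTranspose) ∘ₗ P =
        c • P := by
      ext1 v
      simp only [LinearMap.comp_apply, LinearMap.smul_apply]
      rw [lam.isoProj_tensorPow _ _ (hPmem v)]
      exact hTS _ (hPmem v)
    conv_lhs => rw [h1, LinearMap.comp_assoc, LinearMap.trace_comp_comm', h2]
    rw [map_smul, hproj.trace, smul_eq_mul]
  -- Evaluate `⟨h, T h⟩` in two ways. The outer `P` drops out because `h` lies in its range, and the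
  -- left `A^{⊗n}` moves over as its adjoint, which leaves a sum of squared coordinates.
  have hcval : c * lam.colGroup.card = ((∑ x, if ∀ i, count x i = f.toFun i then
        ‖tensorPow n A.conjTranspose h x‖ ^ 2 else 0 : ℝ) : ℂ) := by
    have h1 : inner ℂ h (T h) = c * lam.colGroup.card := by
      rw [hc, inner_smul_right, inner_hwVec_self]
    have h2 : inner ℂ h (T h) = inner ℂ h
        ((tensorPow n A ∘ₗ freqProj f ∘ₗ tensorPow n A.conjTranspose) h) := by
      have hmem : h ∈ isoSpace lam.toFreq lam := by rw [hS]; exact lam.hwVec_mem_specht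
      have h3 := Submodule.starProjection_inner_eq_zero (K := isoSpace lam.toFreq lam)
        ((tensorPow n A ∘ₗ freqProj f ∘ₗ tensorPow n A.conjTranspose) h) h hmem
      rw [inner_sub_left, sub_eq_zero] at h3
      rw [← inner_conj_symm, ← inner_conj_symm h, h3]
      rfl
    rw [← h1, h2, LinearMap.comp_apply, inner_tensorPow, LinearMap.comp_apply, PiLp.inner_apply]
    push_cast
    refine Finset.sum_congr rfl fun x _ => ?_
    rw [freqProj_apply]
    split_ifs
    · rw [RCLike.inner_apply, RCLike.mul_conj]
      norm_cast
    · simp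
  have hcre : c = (((∑ x, if ∀ i, count x i = f.toFun i then
        ‖tensorPow n A.conjTranspose h x‖ ^ 2 else 0) / lam.colGroup.card : ℝ) : ℂ) := by
    rw [Complex.ofReal_div, ← hcval, Complex.ofReal_natCast,
      mul_div_cancel_right₀ _ lam.card_colGroup_ne_zero]
  rw [overlap, htrace, hcre, mul_comm]
  rw [← Complex.ofReal_natCast, ← Complex.ofReal_mul, Complex.ofReal_re]

end YoungFrame

/-! ### Splitting the frame into columns -/

/-- A block diagonal matrix is block triangular for any enumeration of the blocks. The blocks here
have different sizes, as columns do. -/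
theorem det_blockDiagonal' {J R : Type*} [Fintype J] [DecidableEq J] [CommRing R] {κ : J → Type*}
    [∀ j, Fintype (κ j)] [∀ j, DecidableEq (κ j)] (M : ∀ j, Matrix (κ j) (κ j) R) :
    (Matrix.blockDiagonal' M).det = ∏ j, (M j).det := by
  have htri : (Matrix.blockDiagonal' M).BlockTriangular
      (fun p : (j : J) × κ j => Fintype.equivFin J p.1) := by
    intro p q hpq
    apply Matrix.blockDiagonal'_apply_ne
    intro h
    simp only [h, lt_self_iff_false] at hpq
  rw [htri.det_fintype, ← Equiv.prod_comp (Fintype.equivFin J)]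
  refine Finset.prod_congr rfl fun j _ => ?_
  let e : κ j ≃ {p : (j : J) × κ j // Fintype.equivFin J p.1 = Fintype.equivFin J j} :=
    Equiv.ofBijective (fun a => ⟨⟨j, a⟩, rfl⟩) <| by
      constructor
      · intro a b h
        simpa using h
      · rintro ⟨⟨j', a⟩, h⟩
        obtain rfl := (Fintype.equivFin J).injective h
        exact ⟨a, rfl⟩
  rw [← Matrix.det_submatrix_equiv_self e]
  congr 1
  ext a b
  exact Matrix.blockDiagonal'_apply_eq M j a b

namespace YoungFrame

variable {d n : ℕ} (lam : YoungFrame d n)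

/-- The length of the next row. -/
def next (k : Fin d) : ℕ := if h : (k : ℕ) + 1 < d then lam.row ⟨(k : ℕ) + 1, h⟩ else 0

/-- The number of columns of length `k + 1`. -/
def width (k : Fin d) : ℕ := lam.row k - lam.next k

theorem next_le (k : Fin d) : lam.next k ≤ lam.row k := by
  unfold next
  split_ifs with h
  · exact lam.antitone (Fin.mk_le_mk.2 (Nat.le_succ _))
  · exact Nat.zero_le _

theorem row_le_next {k k' : Fin d} (h : k < k') : lam.row k' ≤ lam.next k := by
  have hk : (k : ℕ) + 1 < d := lt_of_le_of_lt (Nat.succ_le_of_lt h) k'.2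
  rw [next, dif_pos hk]
  exact lam.antitone (Fin.mk_le_mk.2 (Nat.succ_le_of_lt h))

/-- The columns, labelled by their length (minus one) and their position among the columns of
this length. -/
abbrev Column : Type := (k : Fin d) × Fin (lam.width k)

/-- The entry in row `l` of a column. -/
def entry (p : (j : lam.Column) × Fin ((j.1 : ℕ) + 1)) : Fin n :=
  lam.boxEquiv.symm ⟨Fin.castLE p.1.1.isLt p.2, ⟨lam.next p.1.1 + p.1.2, by
    have h1 : lam.row p.1.1 ≤ lam.row (Fin.castLE p.1.1.isLt p.2) :=
      lam.antitone (Fin.le_def.2 (Nat.lt_succ_iff.1 p.2.2))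
    have h2 : (p.1.2 : ℕ) < lam.row p.1.1 - lam.next p.1.1 := p.1.2.2
    omega⟩⟩

theorem rowOf_entry (p) : lam.rowOf (lam.entry p) = Fin.castLE p.1.1.isLt p.2 :=
  lam.box_symm_rowOf _

theorem colOf_entry (p) : lam.colOf (lam.entry p) = lam.next p.1.1 + p.1.2 :=
  lam.box_symm_colOf _

/-- The columns of length `k + 1` occupy the positions from `next k` up to `row k`, and these
intervals are disjoint for different `k`. -/
theorem column_eq_of_colOf_eq {p q : (j : lam.Column) × Fin ((j.1 : ℕ) + 1)}
    (h : lam.colOf (lam.entry p) = lam.colOf (lam.entry q)) : p.1 = q.1 := by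
  obtain ⟨⟨k, c⟩, l⟩ := p
  obtain ⟨⟨k', c'⟩, l'⟩ := q
  rw [colOf_entry, colOf_entry] at h
  simp only at h
  have hc : (c : ℕ) < lam.row k - lam.next k := c.2
  have hc' : (c' : ℕ) < lam.row k' - lam.next k' := c'.2
  have hk : k = k' := by
    rcases lt_trichotomy k k' with h1 | h1 | h1
    · have := lam.row_le_next h1
      omega
    · exact h1
    · have := lam.row_le_next h1
      omega
  subst hk
  have : c = c' := Fin.ext (by omega)
  rw [this]

theorem entry_bijective : Function.Bijective lam.entry := by
  constructor
  · intro p q h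
    have h1 := lam.column_eq_of_colOf_eq (congrArg lam.colOf h)
    have h2 := congrArg lam.rowOf h
    rw [rowOf_entry, rowOf_entry] at h2
    obtain ⟨j, l⟩ := p
    obtain ⟨j', l'⟩ := q
    obtain rfl : j = j' := h1
    have : l = l' := Fin.ext (by simpa using congrArg (fun t : Fin d => (t : ℕ)) h2)
    rw [this]
  · intro m
    -- The last row that still reaches the column of `m` determines the length of this column.
    set S := Finset.univ.filter fun k : Fin d => lam.colOf m < lam.row k with hS
    have hne : S.Nonempty := ⟨lam.rowOf m, by simp [hS, lam.colOf_lt m]⟩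
    set k := S.max' hne with hk
    have hkS : lam.colOf m < lam.row k := (Finset.mem_filter.1 (S.max'_mem hne)).2
    have hle : lam.rowOf m ≤ k := S.le_max' _ (by simp [hS, lam.colOf_lt m])
    have hnext : lam.next k ≤ lam.colOf m := by
      unfold next
      split_ifs with h
      · by_contra! hcon
        have : (⟨(k : ℕ) + 1, h⟩ : Fin d) ≤ k := S.le_max' _ (by simp [hS, hcon])
        exact absurd (Fin.le_def.1 this) (by simp)
      · exact Nat.zero_le _
    refine ⟨⟨⟨k, ⟨lam.colOf m - lam.next k, ?_⟩⟩, ⟨lam.rowOf m, Nat.lt_succ_of_le hle⟩⟩, ?_⟩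
    · unfold width
      omega
    · apply lam.eq_of_row_col
      · rw [rowOf_entry]; rfl
      · rw [colOf_entry]
        simp only
        omega

/-- The entries of the frame, read column by column. -/
def entryEquiv : ((j : lam.Column) × Fin ((j.1 : ℕ) + 1)) ≃ Fin n :=
  Equiv.ofBijective lam.entry lam.entry_bijective

/-- The restriction of a word to a column. -/
def colWord (x : Fin n → Fin d) (j : lam.Column) : Fin ((j.1 : ℕ) + 1) → Fin d :=
  fun l => x (lam.entry ⟨j, l⟩)

/-- Words are families of words on the columns. -/
def colWordEquiv : (Fin n → Fin d) ≃ ((j : lam.Column) → Fin ((j.1 : ℕ) + 1) → Fin d) :=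
  (Equiv.arrowCongr lam.entryEquiv.symm (Equiv.refl (Fin d))).trans (Equiv.piCurry fun _ _ => Fin d)

theorem colWordEquiv_apply (x : Fin n → Fin d) : lam.colWordEquiv x = lam.colWord x := rfl

theorem count_eq_sum_colWord (x : Fin n → Fin d) (i : Fin d) :
    count x i = ∑ j, count (lam.colWord x j) i := by
  simp only [count, Finset.card_filter]
  rw [← Equiv.sum_comp lam.entryEquiv, Fintype.sum_sigma]
  rfl

end YoungFrame

/-! ### The tensor power applied to antisymmetric vectors -/

theorem tensorPow_basisVec {d n : ℕ} (A : Matrix (Fin d) (Fin d) ℂ) (y x : Fin n → Fin d) :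
    tensorPow n A (basisVec y) x = ∏ m, A (x m) (y m) := by
  rw [tensorPow_apply, Finset.sum_eq_single y]
  · simp [basisVec_apply]
  · intro z _ hz
    rw [basisVec_apply, if_neg hz, mul_zero]
  · simp

/-- The coordinates are minors from the first `k` columns: the signed sum defining `v_k` is the
Leibniz formula. -/
theorem tensorPow_antisymVec {d k : ℕ} (A : Matrix (Fin d) (Fin d) ℂ) (hk : k ≤ d)
    (w : Fin k → Fin d) :
    tensorPow k A (antisymVec hk) w = (((Real.sqrt (k.factorial : ℝ))⁻¹ : ℝ) : ℂ) *
      (Matrix.of fun a b : Fin k => A (w a) (Fin.castLE hk b)).det := by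
  rw [antisymVec, map_smul, PiLp.smul_apply, smul_eq_mul, map_sum, WithLp.ofLp_sum,
    Finset.sum_apply, Matrix.det_apply']
  congr 1
  refine Finset.sum_congr rfl fun τ _ => ?_
  rw [map_smul, PiLp.smul_apply, smul_eq_mul, tensorPow_permRep, permRep_apply, tensorPow_basisVec]
  rfl

theorem blockWeight_eq {d k : ℕ} (A : Matrix (Fin d) (Fin d) ℂ) (hk : k ≤ d) (w : Fin k → Fin d) :
    blockWeight A hk w = ‖(Matrix.of fun a b : Fin k =>
      A.conjTranspose (w a) (Fin.castLE hk b)).det‖ ^ 2 / k.factorial := by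
  rw [blockWeight, basisVec, EuclideanSpace.inner_single_left, tensorPow_antisymVec, map_one,
    one_mul, norm_mul, mul_pow, Complex.norm_real, Real.norm_eq_abs, sq_abs, inv_pow,
    Real.sq_sqrt (Nat.cast_nonneg _), inv_mul_eq_div]

theorem blockWeight_nonneg {d k : ℕ} (A : Matrix (Fin d) (Fin d) ℂ) (hk : k ≤ d)
    (w : Fin k → Fin d) : 0 ≤ blockWeight A hk w := sq_nonneg _

theorem blockWeight_eq_zero_of_not_injective {d k : ℕ} (A : Matrix (Fin d) (Fin d) ℂ) (hk : k ≤ d)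
    {w : Fin k → Fin d} (hw : ¬ Function.Injective w) : blockWeight A hk w = 0 := by
  rw [Function.Injective] at hw
  push Not at hw
  obtain ⟨a, b, hab, hne⟩ := hw
  rw [blockWeight_eq, Matrix.det_zero_of_row_eq hne, norm_zero]
  · simp
  · ext c
    simp [hab]

theorem norm_antisymVec {d k : ℕ} (hk : k ≤ d) : ‖antisymVec hk‖ ^ 2 = 1 := by
  have h1 : ∀ w : Fin k → Fin d, antisymVec hk w = (((Real.sqrt (k.factorial : ℝ))⁻¹ : ℝ) : ℂ) *
      ∑ τ : Equiv.Perm (Fin k), if w = Fin.castLE hk ∘ τ.symm then ((Equiv.Perm.sign τ : ℤ) : ℂ)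
        else 0 := by
    intro w
    rw [antisymVec, PiLp.smul_apply, smul_eq_mul, WithLp.ofLp_sum, Finset.sum_apply]
    congr 1
    refine Finset.sum_congr rfl fun τ _ => ?_
    rw [PiLp.smul_apply, permRep_basisVec, basisVec_apply, smul_eq_mul, mul_ite, mul_one, mul_zero]
  have hinj : Function.Injective fun τ : Equiv.Perm (Fin k) => Fin.castLE hk ∘ τ.symm := by
    intro τ τ' h
    have : τ.symm = τ'.symm := by
      ext a : 1
      exact Fin.castLE_injective hk (congrFun h a)
    exact Equiv.symm_bijective.injective this
  rw [EuclideanSpace.norm_sq_eq]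
  have h2 : ∀ w ∉ Finset.univ.image fun τ : Equiv.Perm (Fin k) => Fin.castLE hk ∘ τ.symm,
      ‖antisymVec hk w‖ ^ 2 = 0 := by
    intro w hw
    rw [h1, Finset.sum_eq_zero, mul_zero, norm_zero, zero_pow two_ne_zero]
    intro τ _
    rw [if_neg]
    rintro rfl
    exact hw (Finset.mem_image_of_mem _ (Finset.mem_univ τ))
  rw [← Finset.sum_subset (Finset.subset_univ _) fun w _ hw => h2 w hw,
    Finset.sum_image hinj.injOn]
  have h3 : ∀ τ : Equiv.Perm (Fin k), ‖antisymVec hk (Fin.castLE hk ∘ τ.symm)‖ ^ 2 =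
      (k.factorial : ℝ)⁻¹ := by
    intro τ
    rw [h1, Finset.sum_eq_single τ]
    · rw [if_pos rfl, norm_mul, mul_pow, Complex.norm_real, Real.norm_eq_abs, sq_abs, inv_pow,
        Real.sq_sqrt (Nat.cast_nonneg _)]
      rcases Int.units_eq_one_or (Equiv.Perm.sign τ) with h | h <;> simp [h]
    · intro τ' _ hne
      rw [if_neg fun h => hne (hinj h).symm]
    · simp
  rw [Finset.sum_congr rfl fun τ _ => h3 τ, Finset.sum_const, Finset.card_univ, Fintype.card_perm,
    Fintype.card_fin, nsmul_eq_mul, mul_inv_cancel₀ (by positivity)]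

theorem tensorPow_one {d n : ℕ} : tensorPow n (1 : Matrix (Fin d) (Fin d) ℂ) = LinearMap.id := by
  ext v x
  rw [tensorPow_apply, Finset.sum_eq_single x]
  · simp
  · intro y _ hy
    obtain ⟨m, hm⟩ := Function.ne_iff.1 hy
    have h0 : ∏ i, (1 : Matrix (Fin d) (Fin d) ℂ) (x i) (y i) = 0 :=
      Finset.prod_eq_zero (Finset.mem_univ m) (Matrix.one_apply_ne hm.symm)
    rw [h0, zero_mul]
  · simp

theorem tensorPow_mul {d n : ℕ} (A B : Matrix (Fin d) (Fin d) ℂ) (v : TensorSpace d n) :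
    tensorPow n A (tensorPow n B v) = tensorPow n (A * B) v := by
  ext x
  simp only [tensorPow_apply, Finset.mul_sum]
  rw [Finset.sum_comm]
  refine Finset.sum_congr rfl fun z _ => ?_
  have : ∏ i, (A * B) (x i) (z i) = ∑ y : Fin n → Fin d, ∏ i, A (x i) (y i) * B (y i) (z i) := by
    simp only [Matrix.mul_apply]
    rw [Finset.prod_univ_sum]
    simp
  rw [this, Finset.sum_mul]
  refine Finset.sum_congr rfl fun y _ => ?_
  rw [Finset.prod_mul_distrib, mul_assoc]

theorem norm_tensorPow_of_unitary {d n : ℕ} {U : Matrix (Fin d) (Fin d) ℂ}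
    (hU : U ∈ Matrix.unitaryGroup (Fin d) ℂ) (v : TensorSpace d n) :
    ‖tensorPow n U.conjTranspose v‖ ^ 2 = ‖v‖ ^ 2 := by
  have h : inner ℂ (tensorPow n U.conjTranspose v) (tensorPow n U.conjTranspose v) =
      inner ℂ v v := by
    rw [← inner_tensorPow, tensorPow_mul, show U * U.conjTranspose = 1 from
      Matrix.mem_unitaryGroup_iff.1 hU, tensorPow_one]
    rfl
  rw [inner_self_eq_norm_sq_to_K, inner_self_eq_norm_sq_to_K] at h
  exact_mod_cast h

/-- The weights are the squared coordinates of the image of the unit vector `v_k` under an isometry.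
-/
theorem sum_blockWeight_of_unitary {d k : ℕ} {U : Matrix (Fin d) (Fin d) ℂ}
    (hU : U ∈ Matrix.unitaryGroup (Fin d) ℂ) (hk : k ≤ d) :
    ∑ w, blockWeight U hk w = 1 := by
  rw [← norm_antisymVec hk, ← norm_tensorPow_of_unitary hU, EuclideanSpace.norm_sq_eq]
  refine Finset.sum_congr rfl fun w _ => ?_
  rw [blockWeight, basisVec, EuclideanSpace.inner_single_left]
  simp

namespace YoungFrame

variable {d n : ℕ} (lam : YoungFrame d n)

theorem tensorPow_hwVec (A : Matrix (Fin d) (Fin d) ℂ) (x : Fin n → Fin d) :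
    tensorPow n A lam.hwVec x = ∏ j : lam.Column,
      (Matrix.of fun a b => A (lam.colWord x j a) (Fin.castLE j.1.isLt b)).det := by
  -- With the entries between different columns of the frame set to zero, only column permutations
  -- survive in the Leibniz formula, so the antisymmetrization is one determinant. Reading the frame
  -- column by column makes it block diagonal.
  set N : Matrix (Fin n) (Fin n) ℂ := Matrix.of fun a b =>
    if lam.colOf a = lam.colOf b then A (x a) (lam.rowOf b) else 0 with hN
  have h1 : tensorPow n A lam.hwVec x = N.det := by
    rw [hwVec, colSym_apply, map_sum, WithLp.ofLp_sum, Finset.sum_apply, Matrix.det_apply',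
      ← Finset.sum_subset (Finset.subset_univ lam.colGroup)]
    · refine Finset.sum_congr rfl fun υ hυ => ?_
      rw [map_smul, PiLp.smul_apply, smul_eq_mul, tensorPow_permRep, permRep_apply,
        tensorPow_basisVec]
      congr 1
      refine Finset.prod_congr rfl fun m _ => ?_
      rw [hN, Matrix.of_apply, if_pos (lam.mem_colGroup.1 hυ m)]
      rfl
    · intro υ _ hυ
      rw [mem_colGroup] at hυ
      push Not at hυ
      obtain ⟨m, hm⟩ := hυ
      rw [Finset.prod_eq_zero (Finset.mem_univ m), mul_zero]
      rw [hN, Matrix.of_apply, if_neg hm]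
  rw [h1, ← det_blockDiagonal', ← Matrix.det_submatrix_equiv_self lam.entryEquiv]
  congr 1
  ext p q
  rw [Matrix.submatrix_apply, hN, Matrix.of_apply]
  change (if lam.colOf (lam.entry p) = lam.colOf (lam.entry q) then
    A (x (lam.entry p)) (lam.rowOf (lam.entry q)) else 0) = _
  obtain ⟨j, a⟩ := p
  obtain ⟨j', b⟩ := q
  by_cases h : j = j'
  · subst h
    rw [if_pos (by rw [colOf_entry, colOf_entry]), rowOf_entry, Matrix.blockDiagonal'_apply_eq]
    rfl
  · rw [if_neg fun hc => h (lam.column_eq_of_colOf_eq hc), Matrix.blockDiagonal'_apply_ne _ _ _ h]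

theorem norm_tensorPow_hwVec (A : Matrix (Fin d) (Fin d) ℂ) (x : Fin n → Fin d) :
    ‖tensorPow n A.conjTranspose lam.hwVec x‖ ^ 2 =
      (∏ j : lam.Column, (((j.1 : ℕ) + 1).factorial : ℝ)) *
      ∏ j : lam.Column, blockWeight A j.1.isLt (lam.colWord x j) := by
  rw [tensorPow_hwVec, norm_prod, ← Finset.prod_pow, ← Finset.prod_mul_distrib]
  refine Finset.prod_congr rfl fun j _ => ?_
  rw [blockWeight_eq, mul_div_cancel₀ _ (by positivity)]

/-- Both sides are `‖hwVec‖²`; the product comes from the column formula at `A = 1`, where the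
weights sum to one. -/
theorem card_colGroup :
    (lam.colGroup.card : ℝ) = ∏ j : lam.Column, (((j.1 : ℕ) + 1).factorial : ℝ) := by
  have h1 : ‖lam.hwVec‖ ^ 2 = lam.colGroup.card := by
    have := lam.inner_hwVec_self
    rw [inner_self_eq_norm_sq_to_K] at this
    apply Complex.ofReal_injective
    push_cast
    exact this
  have h2 : ‖tensorPow n (1 : Matrix (Fin d) (Fin d) ℂ).conjTranspose lam.hwVec‖ ^ 2 =
      ‖lam.hwVec‖ ^ 2 := by
    rw [Matrix.conjTranspose_one, tensorPow_one]; rfl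
  rw [← h1, ← h2, EuclideanSpace.norm_sq_eq]
  simp only [norm_tensorPow_hwVec]
  rw [← Finset.mul_sum]
  have h3 : ∑ x : Fin n → Fin d, ∏ j : lam.Column,
      blockWeight (1 : Matrix (Fin d) (Fin d) ℂ) j.1.isLt (lam.colWord x j) = 1 := by
    rw [← Equiv.sum_comp lam.colWordEquiv.symm]
    have : ∀ y, lam.colWord (lam.colWordEquiv.symm y) = y := fun y => by
      rw [← colWordEquiv_apply, Equiv.apply_symm_apply]
    simp only [this]
    have h4 := Finset.prod_univ_sum (fun j : lam.Column =>
      (Finset.univ : Finset (Fin ((j.1 : ℕ) + 1) → Fin d)))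
      (fun j w => blockWeight (1 : Matrix (Fin d) (Fin d) ℂ) j.1.isLt w)
    rw [Fintype.piFinset_univ] at h4
    rw [← h4]
    exact Finset.prod_eq_one fun j _ =>
      sum_blockWeight_of_unitary (one_mem _) _
  rw [h3, mul_one]

end YoungFrame

/-! ### The sum over types -/

/-- The words of length `k + 1`. -/
abbrev BlockWord (d : ℕ) (k : Fin d) : Type := Fin ((k : ℕ) + 1) → Fin d

/-- The distribution `p_{k+1}`, up to normalization. -/
def weight {d : ℕ} (A : Matrix (Fin d) (Fin d) ℂ) (k : Fin d) (w : BlockWord d k) : ℝ :=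
  blockWeight A k.isLt w

theorem weight_nonneg {d : ℕ} (A : Matrix (Fin d) (Fin d) ℂ) (k : Fin d) (w : BlockWord d k) :
    0 ≤ weight A k w := blockWeight_nonneg _ _ _

/-- The families of types of the words on the columns of each length. -/
def blockTypes {d n : ℕ} (lam : YoungFrame d n) (f : Freq d n) :
    Finset ((k : Fin d) → BlockWord d k → ℕ) :=
  (Fintype.piFinset fun k => Finset.piAntidiag Finset.univ (lam.width k)).filter fun N =>
    ∀ i, ∑ k, ∑ w, N k w * count w i = f.toFun i

/-- The contribution of the families of columns of given types. -/
def typeWeight {d : ℕ} (A : Matrix (Fin d) (Fin d) ℂ) (N : (k : Fin d) → BlockWord d k → ℕ) : ℝ :=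
  ∏ k, (Nat.multinomial Finset.univ (N k) * ∏ w, weight A k w ^ N k w)

theorem mem_blockTypes {d n : ℕ} {lam : YoungFrame d n} {f : Freq d n}
    {N : (k : Fin d) → BlockWord d k → ℕ} :
    N ∈ blockTypes lam f ↔ (∀ k, ∑ w, N k w = lam.width k) ∧
      ∀ i, ∑ k, ∑ w, N k w * count w i = f.toFun i := by
  simp [blockTypes, Fintype.mem_piFinset, Finset.mem_piAntidiag]

-- Both sides are the coefficient of `X^f` in `∏ k, F k ^ width k`, where `F k` is the generating
-- polynomial of the weights by letter content. The left side expands the product over all columns,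
-- the right side uses the multinomial theorem for each length.
open MvPolynomial in
theorem sum_prod_blockWeight {d n : ℕ} (lam : YoungFrame d n) (f : Freq d n)
    (A : Matrix (Fin d) (Fin d) ℂ) :
    (∑ x, if ∀ i, count x i = f.toFun i then
      ∏ j : lam.Column, blockWeight A j.1.isLt (lam.colWord x j) else 0) =
    ∑ N ∈ blockTypes lam f, typeWeight A N := by
  let cnt : ∀ {k : Fin d}, BlockWord d k → (Fin d →₀ ℕ) :=
    fun w => Finsupp.equivFunOnFinite.symm (count w)
  let F : Fin d → MvPolynomial (Fin d) ℝ := fun k => ∑ w, monomial (cnt w) (weight A k w)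
  let f' : Fin d →₀ ℕ := Finsupp.equivFunOnFinite.symm f.toFun
  have hleft : coeff f' (∏ k, F k ^ lam.width k) = ∑ x, if ∀ i, count x i = f.toFun i then
      ∏ j : lam.Column, blockWeight A j.1.isLt (lam.colWord x j) else 0 := by
    have h1 : ∏ k, F k ^ lam.width k = ∏ j : lam.Column, F j.1 := by
      rw [Fintype.prod_sigma]
      simp
    have h4 := Finset.prod_univ_sum (fun j : lam.Column =>
      (Finset.univ : Finset (BlockWord d j.1)))
      (fun j w => monomial (cnt w) (weight A j.1 w))
    rw [Fintype.piFinset_univ] at h4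
    rw [h1, h4, coeff_sum, ← Equiv.sum_comp lam.colWordEquiv]
    refine Finset.sum_congr rfl fun x _ => ?_
    rw [← monomial_sum_prod, coeff_monomial]
    refine if_congr ?_ rfl rfl
    rw [Finsupp.ext_iff]
    refine forall_congr' fun i => ?_
    rw [lam.count_eq_sum_colWord, Finsupp.finsetSum_apply]
    rfl
  have hright : coeff f' (∏ k, F k ^ lam.width k) = ∑ N ∈ blockTypes lam f, typeWeight A N := by
    simp only [F, Finset.sum_pow_eq_sum_piAntidiag]
    rw [Finset.prod_univ_sum, coeff_sum, blockTypes, Finset.sum_filter]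
    refine Finset.sum_congr rfl fun N _ => ?_
    have h2 : ∏ k, ((Nat.multinomial Finset.univ (N k) : MvPolynomial (Fin d) ℝ) *
        ∏ w, monomial (cnt w) (weight A k w) ^ N k w) =
        monomial (∑ k, ∑ w, N k w • cnt w) (typeWeight A N) := by
      rw [typeWeight, monomial_sum_prod]
      refine Finset.prod_congr rfl fun k _ => ?_
      simp only [monomial_pow]
      rw [← monomial_sum_prod, ← map_natCast (C : ℝ →+* MvPolynomial (Fin d) ℝ), C_mul_monomial]
    rw [h2, coeff_monomial]
    refine if_congr ?_ rfl rfl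
    rw [Finsupp.ext_iff]
    refine forall_congr' fun i => ?_
    simp [Finsupp.finsetSum_apply, cnt, f']
  rw [← hleft, hright]

/-- The trace `tr { P_{λ,λ} A^{⊗ n} P_{f,λ} A^{†⊗ n} }` as a sum over types. -/
theorem overlap_eq_sum_types {d n : ℕ} (lam : YoungFrame d n) (f : Freq d n)
    (A : Matrix (Fin d) (Fin d) ℂ) :
    overlap A lam f =
      Module.finrank ℂ lam.specht * ∑ N ∈ blockTypes lam f, typeWeight A N := by
  rw [lam.overlap_eq, ← sum_prod_blockWeight]
  congr 1
  have h0 : (lam.colGroup.card : ℝ) ≠ 0 := by exact_mod_cast lam.card_colGroup_ne_zero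
  rw [div_eq_iff h0, Finset.sum_mul]
  refine Finset.sum_congr rfl fun x _ => ?_
  rw [ite_mul, zero_mul]
  refine if_congr Iff.rfl ?_ rfl
  rw [lam.norm_tensorPow_hwVec, lam.card_colGroup, mul_comm]

/-! ### The dimension of the irreducible representation: upper bound -/

theorem prod_comp_eq_prod_pow_count {d n : ℕ} (x : Fin n → Fin d) (g : Fin d → ℝ) :
    ∏ m, g (x m) = ∏ i, g i ^ count x i := by
  rw [Finset.prod_comp g x]
  refine Finset.prod_subset (Finset.subset_univ _) fun i _ hi => ?_
  have : count x i = 0 := by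
    rw [count, Finset.card_eq_zero, Finset.filter_eq_empty_iff]
    rintro l - rfl
    exact hi (Finset.mem_image_of_mem _ (Finset.mem_univ l))
  change g i ^ count x i = 1
  rw [this, pow_zero]

/-- Draw letters independently with distribution `f / n`: every word of content `f` has probability
`∏ i, (f i / n) ^ f i`, and the total is at most one. -/
theorem card_filter_count_mul_prod_le {d n : ℕ} (f : Freq d n) :
    ((Finset.univ.filter fun x : Fin n → Fin d => ∀ i, count x i = f.toFun i).card : ℝ) *
      ∏ i, ((f.toFun i : ℝ) / n) ^ f.toFun i ≤ 1 := by
  have h1 : (∑ i, (f.toFun i : ℝ) / n) ^ n = 1 := by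
    rcases Nat.eq_zero_or_pos n with h | h
    · subst h; simp
    · rw [← Finset.sum_div, ← Nat.cast_sum, f.sum_eq, div_self (by positivity), one_pow]
  have h2 : (∑ i, (f.toFun i : ℝ) / n) ^ n = ∑ x : Fin n → Fin d, ∏ m, ((f.toFun (x m) : ℝ) / n) := by
    rw [Fintype.sum_pow]
  rw [← h1, h2, ← nsmul_eq_mul, ← Finset.sum_const]
  calc _ = ∑ x ∈ Finset.univ.filter fun x : Fin n → Fin d => ∀ i, count x i = f.toFun i,
        ∏ m, ((f.toFun (x m) : ℝ) / n) := by
        refine Finset.sum_congr rfl fun x hx => ?_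
        rw [prod_comp_eq_prod_pow_count x fun i => (f.toFun i : ℝ) / n]
        refine Finset.prod_congr rfl fun i _ => ?_
        rw [(Finset.mem_filter.1 hx).2 i]
    _ ≤ _ := Finset.sum_le_sum_of_subset_of_nonneg (Finset.subset_univ _) fun x _ _ => by positivity

theorem finrank_freqSpace_le {d n : ℕ} (f : Freq d n) :
    Module.finrank ℂ (freqSpace f) ≤
      (Finset.univ.filter fun x : Fin n → Fin d => ∀ i, count x i = f.toFun i).card := by
  classical
  have h : freqSpace f = Submodule.span ℂ (((Finset.univ.filter fun x : Fin n → Fin d =>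
      ∀ i, count x i = f.toFun i).image basisVec : Finset (TensorSpace d n)) :
        Set (TensorSpace d n)) := by
    rw [freqSpace]
    congr 1
    ext v
    simp [eq_comm]
  rw [h]
  exact (finrank_span_finset_le_card _).trans Finset.card_image_le

theorem YoungFrame.finrank_specht_mul_prod_le {d n : ℕ} (lam : YoungFrame d n) :
    (Module.finrank ℂ lam.specht : ℝ) * ∏ i, ((lam.row i : ℝ) / n) ^ lam.row i ≤ 1 := by
  refine le_trans ?_ (card_filter_count_mul_prod_le lam.toFreq)
  refine mul_le_mul_of_nonneg_right ?_ (by positivity)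
  exact_mod_cast (Submodule.finrank_mono lam.specht_le_freqSpace).trans
    (finrank_freqSpace_le lam.toFreq)

/-! ### Ballot words and linear independence -/

/-- The number of occurrences of the letter `i` among the first `m` letters. -/
def prefixCount {d n : ℕ} (y : Fin n → Fin d) (m : ℕ) (i : Fin d) : ℕ :=
  (Finset.univ.filter fun l : Fin n => (l : ℕ) < m ∧ y l = i).card

/-- Words of given content each of whose prefixes contains every letter at least as often as the
next one. -/
def ballotWords (d n : ℕ) (c : Fin d → ℕ) : Finset (Fin n → Fin d) :=
  Finset.univ.filter fun y => (∀ i, count y i = c i) ∧ ∀ m ≤ n, Antitone (prefixCount y m)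

theorem exists_card_filter_lt {n : ℕ} (S : Finset (Fin n)) {r : ℕ} (hr : r < S.card) :
    ∃ p ∈ S, (S.filter fun l => l < p).card = r := by
  set e := S.orderIsoOfFin rfl with he
  refine ⟨e ⟨r, hr⟩, (e ⟨r, hr⟩).2, ?_⟩
  have : S.filter (fun l => l < (e ⟨r, hr⟩ : Fin n)) =
      (Finset.univ.filter fun a : Fin S.card => (a : ℕ) < r).image fun a => (e a : Fin n) := by
    ext l
    simp only [Finset.mem_filter, Finset.mem_image, Finset.mem_univ, true_and]
    constructor
    · rintro ⟨hl, hlt⟩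
      refine ⟨e.symm ⟨l, hl⟩, ?_, by simp⟩
      have : e.symm ⟨l, hl⟩ < ⟨r, hr⟩ := by
        rw [OrderIso.symm_apply_lt]; exact hlt
      exact this
    · rintro ⟨a, ha, rfl⟩
      refine ⟨(e a).2, ?_⟩
      exact_mod_cast e.lt_iff_lt.2 (show a < ⟨r, hr⟩ from ha)
  rw [this, Finset.card_image_of_injective _
    (show Function.Injective fun a => (e a : Fin n) from Subtype.val_injective.comp e.injective)]
  rw [Fin.card_filter_val_lt, min_eq_right hr.le]

namespace YoungFrame

variable {d n : ℕ} (lam : YoungFrame d n)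

/-- The zero-based `j`-th occurrence of the letter `i` in `y` is sent to the box in row `i` and
column `j`. -/
theorem exists_standardize {y : Fin n → Fin d} (hy : ∀ i, count y i = lam.row i) :
    ∃ τ : Equiv.Perm (Fin n), ∀ p, lam.rowOf (τ p) = y p ∧
      lam.colOf (τ p) = prefixCount y p (y p) := by
  have hlt : ∀ p : Fin n, prefixCount y p (y p) < lam.row (y p) := by
    intro p
    rw [← hy, prefixCount, count]
    refine Finset.card_lt_card ⟨fun l hl => ?_, fun h => ?_⟩
    · simp only [Finset.mem_filter, Finset.mem_univ, true_and] at *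
      exact hl.2
    · have := h (Finset.mem_filter.2 ⟨Finset.mem_univ p, rfl⟩)
      simp at this
  choose τ hτ using fun p => lam.exists_box (hlt p)
  have hinj : Function.Injective τ := by
    have key : ∀ p q : Fin n, p < q → τ p ≠ τ q := by
      intro p q hpq h
      have h1 : y p = y q := by rw [← (hτ p).1, ← (hτ q).1, h]
      have h2 : prefixCount y p (y p) = prefixCount y q (y q) := by
        rw [← (hτ p).2, ← (hτ q).2, h]
      have h3 : prefixCount y p (y p) < prefixCount y q (y q) := by
        refine Finset.card_lt_card ⟨fun l hl => ?_, fun hs => ?_⟩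
        · simp only [Finset.mem_filter, Finset.mem_univ, true_and] at *
          exact ⟨hl.1.trans hpq, hl.2.trans h1⟩
        · have := hs (Finset.mem_filter.2 ⟨Finset.mem_univ p, hpq, h1⟩)
          simp at this
      exact absurd h2 h3.ne
    intro p q h
    rcases lt_trichotomy p q with h1 | h1 | h1
    · exact absurd h (key p q h1)
    · exact h1
    · exact absurd h.symm (key q p h1)
  exact ⟨Equiv.ofBijective τ (Finite.injective_iff_bijective.1 hinj), hτ⟩

/-- Every ballot word is the lexicographically smallest word in the support of a vector of the
irreducible subspace. -/
theorem exists_vector_of_ballot {y : Fin n → Fin d} (hy : y ∈ ballotWords d n lam.row) :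
    ∃ v ∈ lam.specht, v y = 1 ∧ ∀ z, v z ≠ 0 → toLex y ≤ toLex z := by
  obtain ⟨-, hcount, hballot⟩ := Finset.mem_filter.1 hy
  obtain ⟨τ, hτ⟩ := lam.exists_standardize hcount
  -- The standardization `τ` carries `y` to the row word, so this translate of `hwVec` has
  -- coordinate one at `y`.
  refine ⟨permRep d n τ⁻¹ lam.hwVec, lam.permRep_mem_specht _ lam.hwVec_mem_specht, ?_, ?_⟩
  · rw [permRep_apply]
    have : y ∘ (τ⁻¹ : Equiv.Perm (Fin n)) = lam.rowOf := by
      ext m : 1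
      simp [← (hτ _).1]
    rw [this, hwVec_rowOf]
  · intro z hz
    rw [permRep_apply, hwVec_apply] at hz
    obtain ⟨υ, hυ, hne⟩ := Finset.exists_ne_zero_of_sum_ne_zero hz
    have hrow : (z ∘ (τ⁻¹ : Equiv.Perm (Fin n))) ∘ υ = lam.rowOf := by
      by_contra h
      rw [if_neg h, mul_zero] at hne
      exact hne rfl
    have hzp : ∀ p, z p = lam.rowOf (υ⁻¹ (τ p)) := by
      intro p
      rw [← hrow]
      simp
    have hcol : ∀ m, lam.colOf (υ⁻¹ m) = lam.colOf m :=
      lam.mem_colGroup.1 (lam.inv_mem_colGroup hυ)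
    by_contra! hlt
    obtain ⟨p, hp, hlt⟩ := hlt
    simp only [Pi.toLex_apply] at hp hlt
    -- At the first difference `p` the word `z` has the smaller letter. By the ballot condition this
    -- letter occurs in `y` before `p` often enough to have an occurrence `p'` of the same rank as
    -- `p` has among its own letter. Then `τ p` and `τ p'` share a column while `z p = z p'`, which
    -- puts two distinct boxes into the same row and column.
    have hrank : prefixCount y p (y p) <
        (Finset.univ.filter fun l : Fin n => (l : ℕ) < p ∧ y l = z p).card := by
      have h1 : prefixCount y (p + 1) (y p) ≤ prefixCount y (p + 1) (z p) :=
        hballot _ (Nat.succ_le_of_lt p.2) hlt.le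
      have h2 : prefixCount y p (y p) < prefixCount y (p + 1) (y p) := by
        refine Finset.card_lt_card ⟨fun l hl => ?_, fun h => ?_⟩
        · simp only [Finset.mem_filter, Finset.mem_univ, true_and] at *
          exact ⟨by omega, hl.2⟩
        · have := h (Finset.mem_filter.2 ⟨Finset.mem_univ p, by simp, rfl⟩)
          simp at this
      have h3 : prefixCount y (p + 1) (z p) =
          (Finset.univ.filter fun l : Fin n => (l : ℕ) < p ∧ y l = z p).card := by
        rw [prefixCount]
        congr 1
        ext l
        simp only [Finset.mem_filter, Finset.mem_univ, true_and, and_congr_left_iff]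
        intro hl
        have : (l : ℕ) ≠ p := by
          intro h
          rw [Fin.ext h] at hl
          exact hlt.ne' hl
        omega
      omega
    obtain ⟨p', hp', hcard⟩ := exists_card_filter_lt _ hrank
    simp only [Finset.mem_filter, Finset.mem_univ, true_and] at hp'
    have hrank' : prefixCount y p' (y p') = prefixCount y p (y p) := by
      rw [← hcard, prefixCount]
      congr 1
      ext l
      simp only [Finset.mem_filter, Finset.mem_univ, true_and, hp'.2]
      constructor
      · rintro ⟨h1, h2⟩
        exact ⟨⟨h1.trans hp'.1, h2⟩, h1⟩
      · rintro ⟨⟨-, h2⟩, h1⟩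
        exact ⟨h1, h2⟩
    have h4 : z p' = y p' := hp p' hp'.1
    have h5 : lam.rowOf (υ⁻¹ (τ p)) = lam.rowOf (υ⁻¹ (τ p')) := by
      rw [← hzp, ← hzp, h4, hp'.2]
    have h6 : lam.colOf (υ⁻¹ (τ p)) = lam.colOf (υ⁻¹ (τ p')) := by
      rw [hcol, hcol, (hτ p).2, (hτ p').2, hrank']
    have h7 := τ.injective (υ⁻¹.injective (lam.eq_of_row_col h5 h6))
    rw [← h7] at hp'
    exact lt_irrefl _ hp'.1

/-- The vectors attached to ballot words are triangular with respect to the lexicographic order,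
hence linearly independent. -/
theorem card_ballotWords_le : (ballotWords d n lam.row).card ≤ Module.finrank ℂ lam.specht := by
  classical
  choose v hv hv1 hvle using fun y : ballotWords d n lam.row => lam.exists_vector_of_ballot y.2
  have hli : LinearIndependent ℂ fun y => (⟨v y, hv y⟩ : lam.specht) := by
    rw [Fintype.linearIndependent_iff]
    intro a ha
    by_contra! hcon
    -- At the smallest word with a nonzero coefficient no other vector of the combination
    -- contributes.
    obtain ⟨y, hy, hmin⟩ := Finset.exists_min_image
      (Finset.univ.filter fun y : ballotWords d n lam.row => a y ≠ 0)
      (fun y => toLex (y : Fin n → Fin d)) (by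
        obtain ⟨y, hy⟩ := hcon
        exact ⟨y, by simpa using hy⟩)
    have hay : a y ≠ 0 := (Finset.mem_filter.1 hy).2
    have h1 := congrArg (fun u : lam.specht => (u : TensorSpace d n) (y : Fin n → Fin d)) ha
    simp only [Submodule.coe_sum, Submodule.coe_smul, WithLp.ofLp_sum, Finset.sum_apply,
      PiLp.smul_apply, smul_eq_mul] at h1
    rw [Finset.sum_eq_single y] at h1
    · rw [hv1, mul_one] at h1
      exact hay h1
    · intro y' _ hne
      by_contra h2
      have h3 : a y' ≠ 0 := left_ne_zero_of_mul h2
      have h4 := hvle y' y (right_ne_zero_of_mul h2)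
      have h5 := hmin y' (Finset.mem_filter.2 ⟨Finset.mem_univ _, h3⟩)
      exact hne (Subtype.ext (toLex.injective (le_antisymm h4 h5)))
    · simp
  have := hli.fintype_card_le_finrank
  simpa using this

end YoungFrame

/-! ### The number of ballot words -/

theorem count_snoc {d n : ℕ} (y : Fin n → Fin d) (a i : Fin d) :
    count (Fin.snoc y a : Fin (n + 1) → Fin d) i = count y i + if a = i then 1 else 0 := by
  simp only [count, Finset.card_filter]
  rw [Fin.sum_univ_castSucc]
  simp

theorem prefixCount_eq {d n : ℕ} (y : Fin n → Fin d) (m : ℕ) (i : Fin d) :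
    prefixCount y m i = ∑ l : Fin n, if (l : ℕ) < m ∧ y l = i then 1 else 0 := by
  rw [prefixCount, Finset.card_filter]

theorem prefixCount_snoc {d n : ℕ} (y : Fin n → Fin d) (a i : Fin d) {m : ℕ} (hm : m ≤ n) :
    prefixCount (Fin.snoc y a : Fin (n + 1) → Fin d) m i = prefixCount y m i := by
  rw [prefixCount_eq, prefixCount_eq, Fin.sum_univ_castSucc]
  simp [hm]

theorem prefixCount_self {d n : ℕ} (y : Fin n → Fin d) (i : Fin d) :
    prefixCount y n i = count y i := by
  rw [prefixCount, count]
  congr 1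
  ext l
  simp

theorem snoc_mem_ballotWords {d n : ℕ} {c c' : Fin d → ℕ} (hc : Antitone c) {a : Fin d}
    (hcc : ∀ i, c i = c' i + if a = i then 1 else 0) {y : Fin n → Fin d}
    (hy : y ∈ ballotWords d n c') : (Fin.snoc y a : Fin (n + 1) → Fin d) ∈ ballotWords d (n + 1) c := by
  obtain ⟨-, h1, h2⟩ := Finset.mem_filter.1 hy
  have h3 : ∀ i, count (Fin.snoc y a : Fin (n + 1) → Fin d) i = c i := fun i => by
    rw [count_snoc, h1, hcc]
  refine Finset.mem_filter.2 ⟨Finset.mem_univ _, h3, fun m hm => ?_⟩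
  rcases Nat.lt_or_eq_of_le hm with hlt | rfl
  · intro i j hij
    rw [prefixCount_snoc _ _ _ (Nat.lt_succ_iff.1 hlt), prefixCount_snoc _ _ _ (Nat.lt_succ_iff.1 hlt)]
    exact h2 m (Nat.lt_succ_iff.1 hlt) hij
  · intro i j hij
    rw [prefixCount_self, prefixCount_self, h3, h3]
    exact hc hij

/-- `1 / z!`, which is zero for negative `z`. -/
def invFactorial (z : ℤ) : ℝ := if z < 0 then 0 else ((z.toNat).factorial : ℝ)⁻¹

/-- The zero convention at negative arguments makes this valid for all integers, so the determinant
can be treated formally. -/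
theorem mul_invFactorial (z : ℤ) : (z : ℝ) * invFactorial z = invFactorial (z - 1) := by
  unfold invFactorial
  rcases lt_trichotomy z 0 with h | h | h
  · rw [if_pos h, if_pos (by omega), mul_zero]
  · subst h; simp
  · rw [if_neg (by omega), if_neg (by omega)]
    obtain ⟨m, rfl⟩ : ∃ m : ℕ, z = m + 1 := ⟨(z - 1).toNat, by omega⟩
    have h1 : ((m : ℤ) + 1).toNat = m + 1 := by omega
    have h2 : ((m : ℤ) + 1 - 1).toNat = m := by omega
    rw [h1, h2, Nat.factorial_succ]
    push_cast
    field_simp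

/-- The determinant `det (1 / (c_i - i + j)!)`. -/
def frameDet {d : ℕ} (c : Fin d → ℤ) : ℝ :=
  (Matrix.of fun i j : Fin d => invFactorial (c i - i + j)).det

/-- In the Leibniz term of `σ`, lowering `c a` multiplies by `c a - a + σ⁻¹ a`. Summed over `a`, the
index shifts cancel and every term receives the same factor `∑ c`. -/
theorem sum_frameDet_sub_single {d : ℕ} (c : Fin d → ℤ) :
    ∑ a, frameDet (c - Pi.single a 1) = (∑ i, c i : ℤ) * frameDet c := by
  simp only [frameDet, Matrix.det_apply', Matrix.of_apply]
  rw [Finset.sum_comm, Finset.mul_sum]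
  refine Finset.sum_congr rfl fun σ _ => ?_
  rw [← Finset.mul_sum, mul_left_comm]
  congr 1
  have h1 : ∀ a, ∏ i, invFactorial ((c - Pi.single a 1 : Fin d → ℤ) (σ i) - (σ i : ℕ) + (i : ℕ)) =
      ((c a - (a : ℕ) + (σ.symm a : ℕ) : ℤ) : ℝ) *
        ∏ i, invFactorial (c (σ i) - (σ i : ℕ) + (i : ℕ)) := by
    intro a
    rw [← Finset.mul_prod_erase _ _ (Finset.mem_univ (σ.symm a)),
      ← Finset.mul_prod_erase _ (fun i => invFactorial (c (σ i) - (σ i : ℕ) + (i : ℕ)))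
        (Finset.mem_univ (σ.symm a)), ← mul_assoc]
    congr 1
    · rw [Equiv.apply_symm_apply, mul_invFactorial]
      congr 1
      simp only [Pi.sub_apply, Pi.single_eq_same]
      ring
    · refine Finset.prod_congr rfl fun i hi => ?_
      have : σ i ≠ a := fun h => (Finset.mem_erase.1 hi).1 (by rw [← h, Equiv.symm_apply_apply])
      rw [Pi.sub_apply, Pi.single_eq_of_ne this, sub_zero]
  simp only [h1]
  rw [← Finset.sum_mul]
  congr 1
  rw [← Int.cast_sum]
  congr 1
  rw [Finset.sum_add_distrib, Finset.sum_sub_distrib, Equiv.sum_comp σ.symm fun i => ((i : ℕ) : ℤ)]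
  ring

/-- Removing a box that cannot be removed makes two consecutive matrix rows equal or, in the last
row of the frame, produces a zero row. -/
theorem frameDet_eq_zero {d : ℕ} (c : Fin d → ℕ) (hc : Antitone c) (a : Fin d)
    (ha : c a = 0 ∨ ∃ h : (a : ℕ) + 1 < d, c a = c ⟨a + 1, h⟩) :
    frameDet ((fun i => (c i : ℤ)) - Pi.single a 1) = 0 := by
  by_cases hd : (a : ℕ) + 1 < d
  · have hca : c a = c ⟨a + 1, hd⟩ := by
      rcases ha with h | ⟨_, h⟩
      · have : c ⟨a + 1, hd⟩ ≤ c a := hc (Fin.le_def.2 (Nat.le_succ _))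
        omega
      · exact h
    have hne : a ≠ ⟨a + 1, hd⟩ := fun h => by simpa using congrArg Fin.val h
    refine Matrix.det_zero_of_row_eq hne ?_
    ext j
    simp only [Matrix.of_apply, Pi.sub_apply, Pi.single_eq_same, Pi.single_eq_of_ne hne.symm, hca]
    congr 1
    push_cast
    ring
  · have hca : c a = 0 := by
      rcases ha with h | ⟨h, _⟩
      · exact h
      · exact absurd h hd
    refine Matrix.det_eq_zero_of_row_eq_zero a fun j => ?_
    simp only [Matrix.of_apply, Pi.sub_apply, Pi.single_eq_same, hca]
    rw [invFactorial, if_pos]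
    have := j.2
    push_cast
    omega

/-- Induction on the number of boxes. The determinant satisfies an exact recursion over removable
boxes. On the other side, appending the letter of the removed box to a ballot word gives a ballot
word, injectively; the inequality suffices. -/
theorem factorial_mul_frameDet_le {d : ℕ} (n : ℕ) (c : Fin d → ℕ) (hc : Antitone c)
    (hn : ∑ i, c i = n) :
    (n.factorial : ℝ) * frameDet (fun i => (c i : ℤ)) ≤ (ballotWords d n c).card := by
  induction n generalizing c with
  | zero =>
    have h0 : c = 0 := by
      ext i
      exact (Finset.sum_eq_zero_iff.1 hn) i (Finset.mem_univ i)
    subst h0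
    have h1 : frameDet (fun i : Fin d => (((0 : Fin d → ℕ) i : ℕ) : ℤ)) = 1 := by
      rw [frameDet, Matrix.det_of_isUpperTriangular]
      · simp [invFactorial]
      · intro i j hij
        rw [Matrix.of_apply, invFactorial, if_pos]
        have : (j : ℕ) < i := hij
        simp only [Pi.zero_apply, Nat.cast_zero]
        omega
    have h2 : (ballotWords d 0 (0 : Fin d → ℕ)).card = 1 := by
      rw [Finset.card_eq_one]
      refine ⟨Fin.elim0, ?_⟩
      ext y
      simp only [Finset.mem_singleton]
      refine ⟨fun _ => Subsingleton.elim _ _, fun _ => ?_⟩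
      refine Finset.mem_filter.2 ⟨Finset.mem_univ _, fun i => by simp [count], fun m _ i j _ => ?_⟩
      simp [prefixCount]
    rw [h1, h2]
    simp
  | succ n ih =>
    -- The rows whose last box can be removed so that a Young frame remains.
    set V := Finset.univ.filter fun a : Fin d =>
      ¬ (c a = 0 ∨ ∃ h : (a : ℕ) + 1 < d, c a = c ⟨a + 1, h⟩) with hV
    have hVmem : ∀ a ∈ V, c a ≠ 0 ∧ ∀ h : (a : ℕ) + 1 < d, c a ≠ c ⟨a + 1, h⟩ := by
      intro a ha
      have := (Finset.mem_filter.1 ha).2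
      push Not at this
      exact this
    let c' : Fin d → Fin d → ℕ := fun a i => c i - if a = i then 1 else 0
    have hcc : ∀ a ∈ V, ∀ i, c i = c' a i + if a = i then 1 else 0 := by
      intro a ha i
      have := (hVmem a ha).1
      simp only [c']
      split_ifs with h
      · subst h; omega
      · omega
    have hanti : ∀ a ∈ V, Antitone (c' a) := by
      intro a ha i j hij
      have h1 := hc hij
      simp only [c']
      split_ifs with h2 h3 h3
      · omega
      · omega
      · subst h3
        have h4 : (a : ℕ) + 1 < d := lt_of_le_of_lt
          (Nat.succ_le_of_lt (lt_of_le_of_ne hij (fun h => h2 (Fin.ext h)))) j.2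
        have h5 : c j ≤ c ⟨a + 1, h4⟩ := hc (Fin.le_def.2
          (Nat.succ_le_of_lt (lt_of_le_of_ne hij (fun h => h2 (Fin.ext h)))))
        have h6 : c ⟨a + 1, h4⟩ ≤ c a := hc (Fin.le_def.2 (Nat.le_succ _))
        have h7 := (hVmem a ha).2 h4
        omega
      · omega
    have hsum : ∀ a ∈ V, ∑ i, c' a i = n := by
      intro a ha
      have h1 : ∑ i, c i = ∑ i, c' a i + 1 := by
        rw [Finset.sum_congr rfl fun i _ => hcc a ha i, Finset.sum_add_distrib]
        simp
      omega
    have hdet : ∀ a ∈ V, frameDet (fun i => (c' a i : ℤ)) =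
        frameDet ((fun i => (c i : ℤ)) - Pi.single a 1) := by
      intro a ha
      congr 1
      ext i
      rw [Pi.sub_apply, hcc a ha i, Pi.single_apply]
      push_cast
      simp only [eq_comm (a := i)]
      split_ifs <;> simp
    have h1 : ((n + 1).factorial : ℝ) * frameDet (fun i => (c i : ℤ)) =
        ∑ a ∈ V, (n.factorial : ℝ) * frameDet (fun i => (c' a i : ℤ)) := by
      have h2 := sum_frameDet_sub_single fun i => (c i : ℤ)
      have h3 : (∑ i, (c i : ℤ)) = ((n + 1 : ℕ) : ℤ) := by
        rw [← hn]; push_cast; rfl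
      rw [h3, Int.cast_natCast] at h2
      rw [Nat.factorial_succ, mul_comm (n + 1), Nat.cast_mul, mul_assoc, ← h2, ← Finset.mul_sum]
      congr 1
      rw [Finset.sum_congr rfl hdet]
      symm
      refine Finset.sum_subset (Finset.subset_univ _) fun a _ ha => ?_
      refine frameDet_eq_zero c hc a ?_
      by_contra h
      exact ha (Finset.mem_filter.2 ⟨Finset.mem_univ _, h⟩)
    have h2 : ∑ a ∈ V, (ballotWords d n (c' a)).card ≤ (ballotWords d (n + 1) c).card := by
      rw [← Finset.card_sigma]
      refine Finset.card_le_card_of_injOn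
        (fun p : (_ : Fin d) × (Fin n → Fin d) => (Fin.snoc p.2 p.1 : Fin (n + 1) → Fin d)) ?_ ?_
      · rintro ⟨a, y⟩ hp
        obtain ⟨ha, hy⟩ := Finset.mem_sigma.1 hp
        exact snoc_mem_ballotWords hc (hcc a ha) hy
      · rintro ⟨a, y⟩ _ ⟨b, z⟩ _ h
        obtain ⟨h3, h4⟩ := Fin.snoc_injective2 h
        obtain rfl : y = z := h3
        obtain rfl : a = b := h4
        rfl
    rw [h1]
    calc _ ≤ ∑ a ∈ V, ((ballotWords d n (c' a)).card : ℝ) :=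
          Finset.sum_le_sum fun a ha => ih (c' a) (hanti a ha) (hsum a ha)
      _ ≤ _ := by exact_mod_cast h2

theorem factorial_mul_invFactorial (l t : ℕ) :
    (l.factorial : ℝ) * invFactorial (l - t) = l.descFactorial t := by
  rw [invFactorial]
  split_ifs with h
  · rw [Nat.descFactorial_of_lt (by omega)]; simp
  · have h1 : ((l : ℤ) - t).toNat = l - t := by omega
    have h2 : t ≤ l := by omega
    rw [h1, ← Nat.factorial_mul_descFactorial h2]
    push_cast
    field_simp

/-- Multiplying row `i` by `(c i + d - 1 - i)!` turns the entries into falling factorials, monic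
polynomials in these numbers. So the product is a Vandermonde determinant of strictly monotone
integers. Reversing rows and columns together makes it positive, and a positive integer is at least
one. -/
theorem one_le_prod_factorial_mul_frameDet {d : ℕ} (c : Fin d → ℕ) (hc : Antitone c) :
    1 ≤ (∏ i : Fin d, ((c i + (d - 1 - i)).factorial : ℝ)) * frameDet (fun i => (c i : ℤ)) := by
  set l : Fin d → ℕ := fun i => c i + (d - 1 - i) with hl
  have h1 : (∏ i : Fin d, ((l i).factorial : ℝ)) * frameDet (fun i => (c i : ℤ)) =
      (Matrix.of fun i j : Fin d => ((l i).descFactorial (d - 1 - j) : ℝ)).det := by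
    rw [frameDet, ← Matrix.det_mul_column]
    congr 1
    ext i j
    rw [Matrix.of_apply, Matrix.of_apply, Matrix.of_apply, ← factorial_mul_invFactorial]
    congr 2
    have := i.2
    have := j.2
    simp only [hl]
    push_cast [show (i : ℕ) ≤ d - 1 by omega, show (j : ℕ) ≤ d - 1 by omega, show 1 ≤ d by omega]
    ring
  have h2 : (Matrix.of fun i j : Fin d => ((l i).descFactorial (d - 1 - j) : ℝ)).det =
      (((Matrix.vandermonde fun i : Fin d => (l (Fin.rev i) : ℤ)).det : ℤ) : ℝ) := by
    rw [← Matrix.det_submatrix_equiv_self Fin.revPerm,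
      Matrix.det_eval_matrixOfPolynomials_eq_det_vandermonde (fun i => (l (Fin.rev i) : ℤ))
        (fun i => descPochhammer ℤ i) (fun i => descPochhammer_natDegree ℤ i)
        (fun i => monic_descPochhammer ℤ i)]
    refine Eq.trans ?_ (RingHom.map_det (Int.castRingHom ℝ) _).symm
    congr 1
    ext i j
    have hj : d - 1 - (Fin.rev j : ℕ) = j := by
      rw [Fin.val_rev]
      have := j.2
      omega
    simp only [Matrix.submatrix_apply, Matrix.of_apply, Fin.revPerm_apply, RingHom.mapMatrix_apply,
      Matrix.map_apply, hj, descPochhammer_eval_eq_descFactorial]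
    simp
  rw [h1, h2, Matrix.det_vandermonde]
  have h3 : (1 : ℤ) ≤ ∏ i : Fin d, ∏ j ∈ Finset.Ioi i, ((l (Fin.rev j) : ℤ) - (l (Fin.rev i) : ℤ)) := by
    refine Int.add_one_le_iff.2 (Finset.prod_pos fun i _ => Finset.prod_pos fun j hj => ?_)
    have hij : i < j := Finset.mem_Ioi.1 hj
    have h4 : c (Fin.rev i) ≤ c (Fin.rev j) := hc (Fin.rev_le_rev.2 hij.le)
    have h5 : (Fin.rev j : ℕ) < Fin.rev i := Fin.rev_lt_rev.2 hij
    have h6 := (Fin.rev i).2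
    simp only [hl]
    omega
  exact_mod_cast h3

theorem YoungFrame.factorial_le_finrank_specht_mul {d n : ℕ} (lam : YoungFrame d n) :
    (n.factorial : ℝ) ≤
      Module.finrank ℂ lam.specht * ∏ i : Fin d, ((lam.row i + (d - 1 - i)).factorial : ℝ) := by
  have h1 := factorial_mul_frameDet_le n lam.row lam.antitone lam.sum_eq
  have h2 := one_le_prod_factorial_mul_frameDet lam.row lam.antitone
  have h3 : ((ballotWords d n lam.row).card : ℝ) ≤ Module.finrank ℂ lam.specht := by
    exact_mod_cast lam.card_ballotWords_le
  set Q := ∏ i : Fin d, ((lam.row i + (d - 1 - i)).factorial : ℝ)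
  have hQ : 0 ≤ Q := Finset.prod_nonneg fun _ _ => by positivity
  calc (n.factorial : ℝ) ≤ n.factorial * (Q * frameDet fun i => (lam.row i : ℤ)) :=
        le_mul_of_one_le_right (by positivity) h2
    _ = (n.factorial * frameDet fun i => (lam.row i : ℤ)) * Q := by ring
    _ ≤ _ := mul_le_mul_of_nonneg_right (h1.trans h3) hQ

/-! ### Logarithms of factorials and multinomial coefficients -/

/-- The function `t log t`. -/
def mulLog (t : ℝ) : ℝ := t * Real.log t

theorem continuous_mulLog : Continuous mulLog := Real.continuous_mul_log

theorem mulLog_mul {c t : ℝ} (hc : 0 < c) :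
    mulLog (c * t) = c * mulLog t + c * Real.log c * t := by
  unfold mulLog
  rcases eq_or_ne t 0 with rfl | ht
  · simp
  · rw [Real.log_mul hc.ne' ht]
    ring

/-- With `log_factorial_le` this gives `log n! = n log n - n + O(log n)`, precise enough because all
errors are divided by `n` at the end. -/
theorem le_log_factorial (n : ℕ) : mulLog n - n ≤ Real.log n.factorial := by
  induction n with
  | zero => simp [mulLog]
  | succ n ih =>
    rw [Nat.factorial_succ, Nat.cast_mul, Real.log_mul (by positivity) (by positivity)]
    rcases Nat.eq_zero_or_pos n with rfl | hn
    · simp [mulLog]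
    have hn' : (0 : ℝ) < n := by exact_mod_cast hn
    have h1 : Real.log ((n : ℝ) + 1) - Real.log n ≤ 1 / n := by
      rw [← Real.log_div (by positivity) (by positivity)]
      refine (Real.log_le_sub_one_of_pos (by positivity)).trans (le_of_eq ?_)
      field_simp
      ring
    have h2 : n * (Real.log ((n : ℝ) + 1) - Real.log n) ≤ 1 := by
      calc _ ≤ (n : ℝ) * (1 / n) := mul_le_mul_of_nonneg_left h1 hn'.le
        _ = 1 := by field_simp
    unfold mulLog at *
    push_cast
    nlinarith

theorem log_factorial_le (n : ℕ) :
    Real.log n.factorial ≤ mulLog n - n + (1 + Real.log (n + 1)) := by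
  have key : ∀ n : ℕ, Real.log (n + 1).factorial ≤
      mulLog (n + 1) - (n + 1) + (1 + Real.log (n + 1)) := by
    intro n
    induction n with
    | zero => simp [mulLog]
    | succ n ih =>
      rw [Nat.factorial_succ, Nat.cast_mul, Real.log_mul (by positivity) (by positivity)]
      have h1 : 1 / ((n : ℝ) + 2) ≤ Real.log ((n : ℝ) + 2) - Real.log (n + 1) := by
        have h := Real.log_le_sub_one_of_pos (show (0 : ℝ) < (n + 1) / (n + 2) by positivity)
        rw [Real.log_div (by positivity) (by positivity)] at h
        have h2 : ((n : ℝ) + 1) / (n + 2) - 1 = -(1 / (n + 2)) := by field_simp; ring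
        linarith
      have h2 : 1 ≤ ((n : ℝ) + 2) * (Real.log ((n : ℝ) + 2) - Real.log (n + 1)) := by
        calc (1 : ℝ) = ((n : ℝ) + 2) * (1 / (n + 2)) := by field_simp
          _ ≤ _ := mul_le_mul_of_nonneg_left h1 (by positivity)
      unfold mulLog at *
      push_cast
      have h3 : ((n : ℝ) + 1 + 1) = n + 2 := by ring
      rw [h3]
      nlinarith
  rcases n with _ | n
  · simp [mulLog]
  · refine (key n).trans ?_
    have : Real.log ((n : ℝ) + 1) ≤ Real.log ((n : ℝ) + 1 + 1) :=
      Real.log_le_log (by positivity) (by linarith)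
    push_cast
    linarith

theorem log_multinomial {X : Type*} [Fintype X] (N : X → ℕ) :
    Real.log (Nat.multinomial Finset.univ N) =
      Real.log (∑ w, N w).factorial - ∑ w, Real.log (N w).factorial := by
  have h := Nat.multinomial_spec Finset.univ N
  rw [← h, Nat.cast_mul, Real.log_mul, Nat.cast_prod, Real.log_prod]
  · ring
  · intro w _; positivity
  · rw [Nat.cast_ne_zero]
    exact (Finset.prod_pos fun w _ => Nat.factorial_pos _).ne'
  · rw [Nat.cast_ne_zero]
    exact (Nat.multinomial_pos _ _).ne'

theorem log_multinomial_le {X : Type*} [Fintype X] (N : X → ℕ) {n : ℕ} (hn : ∑ w, N w ≤ n) :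
    Real.log (Nat.multinomial Finset.univ N) ≤
      mulLog (∑ w, (N w : ℝ)) - ∑ w, mulLog (N w) + (1 + Real.log (n + 1)) := by
  rw [log_multinomial]
  have h1 := log_factorial_le (∑ w, N w)
  have h2 : ∑ w, (mulLog (N w) - N w) ≤ ∑ w, Real.log (N w).factorial :=
    Finset.sum_le_sum fun w _ => le_log_factorial _
  have h3 : Real.log (((∑ w, N w : ℕ) : ℝ) + 1) ≤ Real.log (n + 1) :=
    Real.log_le_log (by positivity) (by exact_mod_cast Nat.succ_le_succ hn)
  rw [Finset.sum_sub_distrib] at h2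
  push_cast at h1 h3
  linarith

theorem le_log_multinomial {X : Type*} [Fintype X] (N : X → ℕ) {n : ℕ} (hn : ∑ w, N w ≤ n) :
    mulLog (∑ w, (N w : ℝ)) - ∑ w, mulLog (N w) - Fintype.card X * (1 + Real.log (n + 1)) ≤
      Real.log (Nat.multinomial Finset.univ N) := by
  rw [log_multinomial]
  have h1 := le_log_factorial (∑ w, N w)
  have h2 : ∑ w, Real.log (N w).factorial ≤
      ∑ w, (mulLog (N w) - N w + (1 + Real.log (n + 1))) := by
    refine Finset.sum_le_sum fun w _ => (log_factorial_le _).trans ?_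
    have h3 : N w ≤ n := (Finset.single_le_sum (fun _ _ => Nat.zero_le _) (Finset.mem_univ w)).trans hn
    have : Real.log ((N w : ℝ) + 1) ≤ Real.log (n + 1) :=
      Real.log_le_log (by positivity) (by exact_mod_cast Nat.succ_le_succ h3)
    linarith
  rw [Finset.sum_add_distrib, Finset.sum_sub_distrib, Finset.sum_const, Finset.card_univ,
    nsmul_eq_mul] at h2
  push_cast at h1
  linarith

/-! ### The dimension of the irreducible representation -/

theorem YoungFrame.row_le {d n : ℕ} (lam : YoungFrame d n) (i : Fin d) : lam.row i ≤ n := by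
  conv_rhs => rw [← lam.sum_eq]
  exact Finset.single_le_sum (fun _ _ => Nat.zero_le _) (Finset.mem_univ i)

theorem YoungFrame.finrank_specht_pos {d n : ℕ} (lam : YoungFrame d n) :
    0 < (Module.finrank ℂ lam.specht : ℝ) := by
  rw [Nat.cast_pos, Module.finrank_pos_iff]
  exact ⟨⟨lam.hwVec, lam.hwVec_mem_specht⟩, 0, fun h => lam.hwVec_ne_zero (congrArg Subtype.val h)⟩

theorem YoungFrame.log_finrank_le {d n : ℕ} (lam : YoungFrame d n) (hn : 0 < n) :
    Real.log (Module.finrank ℂ lam.specht) ≤ mulLog n - ∑ i, mulLog (lam.row i) := by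
  have hn' : (0 : ℝ) < n := by exact_mod_cast hn
  have h0 : ∀ i ∈ Finset.univ, ((lam.row i : ℝ) / n) ^ lam.row i ≠ 0 := by
    intro i _
    rcases Nat.eq_zero_or_pos (lam.row i) with h | h
    · rw [h]; simp
    · have : (0 : ℝ) < lam.row i := by exact_mod_cast h
      positivity
  have h1 := Real.log_le_log (mul_pos lam.finrank_specht_pos (Finset.prod_pos fun i hi =>
    lt_of_le_of_ne (by positivity) (h0 i hi).symm)) lam.finrank_specht_mul_prod_le
  rw [Real.log_one, Real.log_mul lam.finrank_specht_pos.ne' (Finset.prod_ne_zero_iff.2 h0),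
    Real.log_prod h0] at h1
  have h2 : ∑ i, Real.log (((lam.row i : ℝ) / n) ^ lam.row i) =
      ∑ i, mulLog (lam.row i) - mulLog n := by
    have h3 : ∀ i, Real.log (((lam.row i : ℝ) / n) ^ lam.row i) =
        mulLog (lam.row i) - lam.row i * Real.log n := by
      intro i
      rw [Real.log_pow, mulLog]
      rcases Nat.eq_zero_or_pos (lam.row i) with h | h
      · rw [h]; simp
      · have : (0 : ℝ) < lam.row i := by exact_mod_cast h
        rw [Real.log_div this.ne' hn'.ne']
        ring
    rw [Finset.sum_congr rfl fun i _ => h3 i, Finset.sum_sub_distrib, ← Finset.sum_mul,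
      ← Nat.cast_sum, lam.sum_eq]
    rfl
  linarith

theorem YoungFrame.le_log_finrank {d n : ℕ} (lam : YoungFrame d n) :
    mulLog n - ∑ i, mulLog (lam.row i) - d * (1 + Real.log (n + 1)) - d * (d * Real.log (n + d)) ≤
      Real.log (Module.finrank ℂ lam.specht) := by
  have h1 := Real.log_le_log (by positivity) lam.factorial_le_finrank_specht_mul
  rw [Real.log_mul lam.finrank_specht_pos.ne' (Finset.prod_pos fun _ _ => by positivity).ne',
    Real.log_prod fun _ _ => by positivity] at h1
  have h2 := le_log_factorial n
  have h3 : ∀ i : Fin d, Real.log ((lam.row i + (d - 1 - i)).factorial : ℝ) ≤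
      mulLog (lam.row i) - lam.row i + (1 + Real.log (n + 1)) + d * Real.log (n + d) := by
    intro i
    have hr := lam.row_le i
    have hd : 1 ≤ d := i.pos
    -- The shift by less than `d` costs only a factor polynomial in `n`.
    have h4 : ((lam.row i + (d - 1 - i)).factorial : ℝ) ≤
        (lam.row i).factorial * ((n : ℝ) + d) ^ d := by
      have h5 : (lam.row i + (d - 1 - i)).factorial ≤
          (lam.row i).factorial * (lam.row i + (d - 1 - i)) ^ (d - 1 - (i : ℕ)) := by
        rw [← Nat.factorial_mul_ascFactorial]
        exact Nat.mul_le_mul_left _ (Nat.ascFactorial_le_pow_add _ _)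
      have h6 : (lam.row i + (d - 1 - i)) ^ (d - 1 - (i : ℕ)) ≤ (n + d) ^ d :=
        (Nat.pow_le_pow_left (by omega) _).trans (Nat.pow_le_pow_right (by omega) (by omega))
      exact_mod_cast h5.trans (Nat.mul_le_mul_left _ h6)
    have hpos : (0 : ℝ) < (n : ℝ) + d := by
      have : (0 : ℝ) < d := by exact_mod_cast hd
      positivity
    have h7 := Real.log_le_log (by positivity) h4
    rw [Real.log_mul (by positivity) (by positivity), Real.log_pow] at h7
    have h8 := log_factorial_le (lam.row i)
    have h9 : Real.log ((lam.row i : ℝ) + 1) ≤ Real.log (n + 1) :=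
      Real.log_le_log (by positivity) (by exact_mod_cast Nat.succ_le_succ hr)
    linarith
  have h4 := Finset.sum_le_sum fun i (_ : i ∈ Finset.univ) => h3 i
  rw [Finset.sum_add_distrib, Finset.sum_add_distrib, Finset.sum_sub_distrib, Finset.sum_const,
    Finset.sum_const, Finset.card_univ, Fintype.card_fin, nsmul_eq_mul, nsmul_eq_mul,
    ← Nat.cast_sum, lam.sum_eq] at h4
  linarith

/-! ### The exponent of a type -/

/-- Families of (unnormalized) distributions on the words of each length. -/
abbrev BlockFamily (d : ℕ) : Type := (k : Fin d) → BlockWord d k → ℝ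

/-- `∑_k ‖P_k‖ D(P_k / ‖P_k‖ ‖ p_k)`, to the natural base. -/
def typeCost {d : ℕ} (A : Matrix (Fin d) (Fin d) ℂ) (P : BlockFamily d) : ℝ :=
  ∑ k, (∑ w, mulLog (P k w) - mulLog (∑ w, P k w) - ∑ w, P k w * Real.log (weight A k w))

theorem continuous_typeCost {d : ℕ} (A : Matrix (Fin d) (Fin d) ℂ) : Continuous (typeCost A) := by
  have := continuous_mulLog
  unfold typeCost
  fun_prop

/-- The extra terms `c log c` from the two entropy sums cancel. This homogeneity of degree one is
what allows passing from types `N` to rescaled types `N / n`. -/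
theorem typeCost_smul {d : ℕ} (A : Matrix (Fin d) (Fin d) ℂ) {c : ℝ} (hc : 0 < c)
    (P : BlockFamily d) : typeCost A (c • P) = c * typeCost A P := by
  unfold typeCost
  rw [Finset.mul_sum]
  refine Finset.sum_congr rfl fun k _ => ?_
  simp only [Pi.smul_apply, smul_eq_mul]
  rw [← Finset.mul_sum, mulLog_mul hc, Finset.sum_congr rfl fun w _ => mulLog_mul hc,
    Finset.sum_add_distrib, ← Finset.mul_sum, ← Finset.mul_sum]
  simp only [mul_assoc]
  rw [← Finset.mul_sum]
  ring

/-- The type of a family of columns as a family of real functions. -/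
def toFamily {d : ℕ} (N : (k : Fin d) → BlockWord d k → ℕ) : BlockFamily d := fun k w => N k w

theorem YoungFrame.width_le {d n : ℕ} (lam : YoungFrame d n) (k : Fin d) : lam.width k ≤ n :=
  (Nat.sub_le _ _).trans (lam.row_le k)

theorem typeWeight_pos {d : ℕ} {A : Matrix (Fin d) (Fin d) ℂ}
    {N : (k : Fin d) → BlockWord d k → ℕ} (hN : ∀ k w, weight A k w = 0 → N k w = 0) :
    0 < typeWeight A N := by
  refine Finset.prod_pos fun k _ => mul_pos (by exact_mod_cast Nat.multinomial_pos _ _)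
    (Finset.prod_pos fun w _ => ?_)
  by_cases h : weight A k w = 0
  · rw [hN k w h, pow_zero]; exact one_pos
  · exact pow_pos (lt_of_le_of_ne (weight_nonneg A k w) (Ne.symm h)) _

theorem support_of_typeWeight_ne_zero {d : ℕ} {A : Matrix (Fin d) (Fin d) ℂ}
    {N : (k : Fin d) → BlockWord d k → ℕ} (hN : typeWeight A N ≠ 0) :
    ∀ k w, weight A k w = 0 → N k w = 0 := by
  intro k w h
  by_contra h0
  apply hN
  refine Finset.prod_eq_zero (Finset.mem_univ k) ?_
  rw [Finset.prod_eq_zero (Finset.mem_univ w), mul_zero]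
  rw [h, zero_pow h0]

theorem typeWeight_nonneg {d : ℕ} (A : Matrix (Fin d) (Fin d) ℂ)
    (N : (k : Fin d) → BlockWord d k → ℕ) : 0 ≤ typeWeight A N :=
  Finset.prod_nonneg fun _ _ => mul_nonneg (Nat.cast_nonneg _)
    (Finset.prod_nonneg fun _ _ => pow_nonneg (weight_nonneg _ _ _) _)

theorem log_typeWeight {d : ℕ} {A : Matrix (Fin d) (Fin d) ℂ}
    {N : (k : Fin d) → BlockWord d k → ℕ} (hN : ∀ k w, weight A k w = 0 → N k w = 0) :
    Real.log (typeWeight A N) = ∑ k, (Real.log (Nat.multinomial Finset.univ (N k)) +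
      ∑ w, N k w * Real.log (weight A k w)) := by
  have h0 : ∀ k w, weight A k w ^ N k w ≠ 0 := by
    intro k w
    by_cases h : weight A k w = 0
    · rw [hN k w h, pow_zero]; exact one_ne_zero
    · exact pow_ne_zero _ h
  have h1 : ∀ k, (Nat.multinomial Finset.univ (N k) : ℝ) ≠ 0 := fun k => by
    exact_mod_cast (Nat.multinomial_pos _ _).ne'
  rw [typeWeight, Real.log_prod fun k _ =>
    mul_ne_zero (h1 k) (Finset.prod_ne_zero_iff.2 fun w _ => h0 k w)]
  refine Finset.sum_congr rfl fun k _ => ?_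
  rw [Real.log_mul (h1 k) (Finset.prod_ne_zero_iff.2 fun w _ => h0 k w),
    Real.log_prod fun w _ => h0 k w]
  simp only [Real.log_pow]

/-- The number of words of length at most `d`. -/
def wordCount (d : ℕ) : ℕ := ∑ k : Fin d, Fintype.card (BlockWord d k)

theorem log_typeWeight_le {d n : ℕ} {A : Matrix (Fin d) (Fin d) ℂ} {lam : YoungFrame d n}
    {f : Freq d n} {N : (k : Fin d) → BlockWord d k → ℕ} (hmem : N ∈ blockTypes lam f)
    (hN : ∀ k w, weight A k w = 0 → N k w = 0) :
    Real.log (typeWeight A N) ≤ -typeCost A (toFamily N) + d * (1 + Real.log (n + 1)) := by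
  rw [log_typeWeight hN, typeCost, ← Finset.sum_neg_distrib]
  have h1 : (d : ℝ) * (1 + Real.log (n + 1)) = ∑ _k : Fin d, (1 + Real.log ((n : ℝ) + 1)) := by
    rw [Finset.sum_const, Finset.card_univ, Fintype.card_fin, nsmul_eq_mul]
  rw [h1, ← Finset.sum_add_distrib]
  refine Finset.sum_le_sum fun k _ => ?_
  have h2 := log_multinomial_le (N k) (((mem_blockTypes.1 hmem).1 k).le.trans (lam.width_le k))
  simp only [toFamily]
  linarith

theorem le_log_typeWeight {d n : ℕ} {A : Matrix (Fin d) (Fin d) ℂ} {lam : YoungFrame d n}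
    {f : Freq d n} {N : (k : Fin d) → BlockWord d k → ℕ} (hmem : N ∈ blockTypes lam f)
    (hN : ∀ k w, weight A k w = 0 → N k w = 0) :
    -typeCost A (toFamily N) - wordCount d * (1 + Real.log (n + 1)) ≤
      Real.log (typeWeight A N) := by
  rw [log_typeWeight hN, typeCost, ← Finset.sum_neg_distrib, wordCount, Nat.cast_sum,
    Finset.sum_mul, ← Finset.sum_sub_distrib]
  refine Finset.sum_le_sum fun k _ => ?_
  have h2 := le_log_multinomial (N k) (((mem_blockTypes.1 hmem).1 k).le.trans (lam.width_le k))
  simp only [toFamily]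
  linarith

theorem card_blockTypes_le {d n : ℕ} (lam : YoungFrame d n) (f : Freq d n) :
    (blockTypes lam f).card ≤ (n + 1) ^ wordCount d := by
  have hsub : blockTypes lam f ⊆ Fintype.piFinset fun k : Fin d =>
      Fintype.piFinset fun _ : BlockWord d k => Finset.range (n + 1) := by
    intro N hN
    simp only [Fintype.mem_piFinset, Finset.mem_range]
    intro k w
    have h1 := (mem_blockTypes.1 hN).1 k
    have h2 : N k w ≤ ∑ w, N k w :=
      Finset.single_le_sum (fun _ _ => Nat.zero_le _) (Finset.mem_univ w)
    have := lam.width_le k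
    omega
  refine (Finset.card_le_card hsub).trans (le_of_eq ?_)
  simp only [Fintype.card_piFinset, Finset.card_range, Finset.prod_const, Finset.card_univ]
  rw [Finset.prod_pow_eq_pow_sum, wordCount]

/-- Upper bound for the sum over types. -/
theorem sum_typeWeight_le {d n : ℕ} {A : Matrix (Fin d) (Fin d) ℂ} {lam : YoungFrame d n}
    {f : Freq d n} {g : ℝ} (hg : ∀ N ∈ blockTypes lam f, (∀ k w, weight A k w = 0 → N k w = 0) →
      g ≤ typeCost A (toFamily N)) :
    ∑ N ∈ blockTypes lam f, typeWeight A N ≤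
      Real.exp (-g + (d + wordCount d) * (1 + Real.log (n + 1))) := by
  have hlog : 0 ≤ Real.log ((n : ℝ) + 1) := Real.log_nonneg (by
    have : (0 : ℝ) ≤ n := Nat.cast_nonneg n
    linarith)
  have h1 : ∀ N ∈ blockTypes lam f, typeWeight A N ≤ Real.exp (-g + d * (1 + Real.log (n + 1))) := by
    intro N hN
    by_cases h0 : typeWeight A N = 0
    · rw [h0]; exact (Real.exp_pos _).le
    · have hs := support_of_typeWeight_ne_zero h0
      rw [← Real.log_le_iff_le_exp (typeWeight_pos hs)]
      have := log_typeWeight_le hN hs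
      have := hg N hN hs
      linarith
  have h2 := Finset.sum_le_card_nsmul _ _ _ h1
  refine h2.trans ?_
  -- The number of types is polynomial in `n`, so the largest term decides on the exponential scale.
  have h3 : ((blockTypes lam f).card : ℝ) ≤ Real.exp (wordCount d * (1 + Real.log (n + 1))) := by
    calc ((blockTypes lam f).card : ℝ) ≤ ((n : ℝ) + 1) ^ wordCount d := by
          exact_mod_cast card_blockTypes_le lam f
      _ = Real.exp (wordCount d * Real.log (n + 1)) := by
          rw [mul_comm, Real.exp_mul, Real.exp_log (by positivity), Real.rpow_natCast]
      _ ≤ _ := Real.exp_le_exp.2 (mul_le_mul_of_nonneg_left (by linarith) (Nat.cast_nonneg _))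
  rw [nsmul_eq_mul]
  calc _ ≤ Real.exp (wordCount d * (1 + Real.log (n + 1))) *
        Real.exp (-g + d * (1 + Real.log (n + 1))) :=
        mul_le_mul_of_nonneg_right h3 (Real.exp_pos _).le
    _ = _ := by rw [← Real.exp_add]; congr 1; ring

/-! ### Integer points near real points of a polyhedron -/

/-- The integer kernel of an integer matrix contains a nonzero vector that is sign-compatible with
a given nonzero vector of the real kernel. -/
theorem exists_int_kernel_vector {E C : Type*} [Fintype E] [Fintype C] (M : C → E → ℤ) {y : E → ℝ}
    (hM : ∀ c, ∑ e, (M c e : ℝ) * y e = 0) (hy : y ≠ 0) :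
    ∃ z : E → ℤ, z ≠ 0 ∧ (∀ c, ∑ e, M c e * z e = 0) ∧
      ∀ e, (0 < z e → 0 < y e) ∧ (z e < 0 → y e < 0) := by
  obtain ⟨e₀, he₀⟩ := Function.ne_iff.1 hy
  -- Scaling by `T` makes one coordinate exceed one in absolute value, so that an integer
  -- approximation with error below one cannot vanish.
  obtain ⟨T, hT⟩ := exists_nat_gt (1 / |y e₀|)
  have hy0 : 0 < |y e₀| := abs_pos.2 he₀
  have hT1 : 1 < T * |y e₀| := by rwa [div_lt_iff₀ hy0] at hT
  -- Larger than every row sum of `|M|`: an error below `1 / B` in each coordinate changes `M z` by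
  -- less than one.
  set B : ℝ := 1 + ∑ c, ∑ e, |(M c e : ℝ)| with hB
  have hB1 : 1 ≤ B := by
    have : 0 ≤ ∑ c, ∑ e, |(M c e : ℝ)| :=
      Finset.sum_nonneg fun _ _ => Finset.sum_nonneg fun _ _ => abs_nonneg _
    linarith
  set δ : ℝ := 1 / B with hδ
  have hδ0 : 0 < δ := by positivity
  have hδ1 : δ ≤ 1 := by rw [hδ, div_le_one (by positivity)]; exact hB1
  -- Dirichlet's argument: by compactness two of these vectors of fractional parts are within `δ`.
  -- The difference of the corresponding integer parts approximates a positive multiple of `y`, so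
  -- `M z` is an integer vector with entries below one in absolute value, hence zero.
  let u : ℕ → E → ℝ := fun t e => Int.fract ((t : ℝ) * (T * y e))
  have hu : ∀ t, u t ∈ Set.Icc (0 : E → ℝ) 1 := fun t =>
    ⟨fun e => Int.fract_nonneg _, fun e => (Int.fract_lt_one _).le⟩
  obtain ⟨a, -, φ, hφ, hlim⟩ := (isCompact_Icc (a := (0 : E → ℝ)) (b := 1)).tendsto_subseq hu
  obtain ⟨K, hK⟩ := Metric.cauchySeq_iff'.1 hlim.cauchySeq δ hδ0
  have hdist := hK (K + 1) (Nat.le_succ K)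
  have hlt : φ K < φ (K + 1) := hφ (Nat.lt_succ_self K)
  set z : E → ℤ := fun e => ⌊(φ (K + 1) : ℝ) * (T * y e)⌋ - ⌊(φ K : ℝ) * (T * y e)⌋ with hz
  set Q : ℝ := ((φ (K + 1) : ℝ) - φ K) * T with hQ
  have hφ1 : (1 : ℝ) ≤ (φ (K + 1) : ℝ) - φ K := by
    have : (φ K : ℝ) + 1 ≤ φ (K + 1) := by exact_mod_cast hlt
    linarith
  have happrox : ∀ e, |Q * y e - z e| < δ := by
    intro e
    have h1 := (dist_pi_lt_iff hδ0).1 hdist e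
    rw [Real.dist_eq] at h1
    have h2 : Q * y e - z e = u (φ (K + 1)) e - u (φ K) e := by
      simp only [hQ, hz, u, Int.fract]
      push_cast
      ring
    rw [h2]
    exact h1
  have hT0 : (0 : ℝ) < T := by
    by_contra! h
    have : (T : ℝ) * |y e₀| ≤ 0 := mul_nonpos_of_nonpos_of_nonneg h hy0.le
    linarith
  have hQ0 : 0 < Q := mul_pos (by linarith) hT0
  refine ⟨z, ?_, ?_, ?_⟩
  · intro h0
    have h1 := happrox e₀
    rw [h0] at h1
    simp only [Pi.zero_apply, Int.cast_zero, sub_zero, abs_mul, abs_of_pos hQ0] at h1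
    have h2 : 1 * (T * |y e₀|) ≤ Q * |y e₀| := by
      rw [hQ, mul_assoc]
      exact mul_le_mul_of_nonneg_right hφ1 (by positivity)
    linarith
  · intro c
    have h1 : |((∑ e, M c e * z e : ℤ) : ℝ)| < 1 := by
      have h2 : ((∑ e, M c e * z e : ℤ) : ℝ) = -∑ e, (M c e : ℝ) * (Q * y e - z e) := by
        have h3 : ∑ e, (M c e : ℝ) * (Q * y e - z e) =
            Q * ∑ e, (M c e : ℝ) * y e - ∑ e, (M c e : ℝ) * z e := by
          rw [Finset.mul_sum, ← Finset.sum_sub_distrib]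
          exact Finset.sum_congr rfl fun e _ => by ring
        rw [h3, hM c]
        push_cast
        ring
      rw [h2, abs_neg]
      have hMc : ∑ e, |(M c e : ℝ)| < B := by
        have : ∑ e, |(M c e : ℝ)| ≤ ∑ c, ∑ e, |(M c e : ℝ)| :=
          Finset.single_le_sum (f := fun c => ∑ e, |(M c e : ℝ)|)
            (fun _ _ => Finset.sum_nonneg fun _ _ => abs_nonneg _) (Finset.mem_univ c)
        linarith
      calc |∑ e, (M c e : ℝ) * (Q * y e - z e)| ≤ ∑ e, |(M c e : ℝ) * (Q * y e - z e)| :=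
            Finset.abs_sum_le_sum_abs _ _
        _ ≤ ∑ e, |(M c e : ℝ)| * δ := Finset.sum_le_sum fun e _ => by
            rw [abs_mul]
            exact mul_le_mul_of_nonneg_left (happrox e).le (abs_nonneg _)
        _ = (∑ e, |(M c e : ℝ)|) * δ := (Finset.sum_mul _ _ _).symm
        _ < B * δ := mul_lt_mul_of_pos_right hMc hδ0
        _ = 1 := by rw [hδ]; field_simp
    rw [← Int.abs_lt_one_iff]
    exact_mod_cast h1
  · intro e
    have h1 := abs_lt.1 (happrox e)
    constructor
    · intro h
      have h2 : (1 : ℝ) ≤ z e := by exact_mod_cast h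
      exact (pos_iff_pos_of_mul_pos (show 0 < Q * y e by linarith)).1 hQ0
    · intro h
      have h2 : (z e : ℝ) ≤ -1 := by exact_mod_cast Int.le_sub_one_of_lt h
      by_contra! h3
      have := mul_nonneg hQ0.le h3
      linarith

/-- Bounded integer systems whose right-hand sides converge after rescaling have solutions near
every nonnegative real solution of the limit system, as soon as they are solvable. -/
theorem exists_tendsto_of_eventually_nonempty {E C : Type*} [Fintype E] [Fintype C]
    (M : C → E → ℤ) (b : ℕ → C → ℤ) {P : E → ℝ} (hP : ∀ e, 0 ≤ P e)
    (hb : ∀ c, Tendsto (fun n : ℕ => (b n c : ℝ) / n) atTop (𝓝 (∑ e, M c e * P e)))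
    (hbd : ∀ n (N : E → ℕ), (∀ c, ∑ e, M c e * (N e : ℤ) = b n c) → ∀ e, N e ≤ n)
    (hne : ∀ᶠ n in atTop, ∃ N : E → ℕ, ∀ c, ∑ e, M c e * (N e : ℤ) = b n c) :
    ∃ N : ℕ → E → ℕ, (∀ᶠ n in atTop, ∀ c, ∑ e, M c e * (N n e : ℤ) = b n c) ∧
      ∀ e, Tendsto (fun n : ℕ => (N n e : ℝ) / n) atTop (𝓝 (P e)) := by
  classical
  let S : ℕ → Set (E → ℕ) := fun n => {N | ∀ c, ∑ e, M c e * (N e : ℤ) = b n c}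
  have hfin : ∀ n, (S n).Finite := fun n =>
    (Set.finite_Iic (fun _ : E => n)).subset fun N hN => hbd n N hN
  -- For each solvable `n` take the solution nearest to `n P` in the `ℓ¹` norm. If it stayed away
  -- from `n P`, an integer kernel vector would bring it closer.
  let D : ℕ → (E → ℕ) → ℝ := fun n N => ∑ e, |(N e : ℝ) - n * P e|
  have hmin : ∀ n, ∃ N : E → ℕ, (S n).Nonempty → N ∈ S n ∧ ∀ N' ∈ S n, D n N ≤ D n N' := by
    intro n
    by_cases h : (S n).Nonempty
    · obtain ⟨N, hN, hle⟩ := Set.exists_min_image (S n) (D n) (hfin n) h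
      exact ⟨N, fun _ => ⟨hN, hle⟩⟩
    · exact ⟨0, fun h' => absurd h' h⟩
  choose N hN using hmin
  refine ⟨N, hne.mono fun n hn => (hN n hn).1, ?_⟩
  have hD : Tendsto (fun n : ℕ => D n (N n) / n) atTop (𝓝 0) := by
    by_contra hcon
    have hfreq : ∃ ε > 0, ∃ᶠ n : ℕ in atTop, ε ≤ D n (N n) / n := by
      rw [Metric.tendsto_nhds] at hcon
      push Not at hcon
      obtain ⟨ε, hε, h⟩ := hcon
      refine ⟨ε, hε, h.mono fun n hn => ?_⟩
      rw [Real.dist_eq, sub_zero, abs_of_nonneg] at hn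
      · exact hn
      · exact div_nonneg (Finset.sum_nonneg fun _ _ => abs_nonneg _) (Nat.cast_nonneg _)
    obtain ⟨ε, hε, hfreq⟩ := hfreq
    obtain ⟨φ, hφ, hφp⟩ := extraction_of_frequently_atTop
      (hfreq.and_eventually (hne.and (eventually_gt_atTop 0)))
    have hmem : ∀ t, (fun e => (N (φ t) e : ℝ) / φ t) ∈ Set.Icc (0 : E → ℝ) 1 := by
      intro t
      have h1 := (hφp t).2.2
      refine ⟨fun e => div_nonneg (Nat.cast_nonneg _) (Nat.cast_nonneg _), fun e => ?_⟩
      exact (div_le_one (Nat.cast_pos.2 h1)).2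
        (Nat.cast_le.2 (hbd _ _ (hN _ (hφp t).2.1).1 e))
    -- The rescaled solutions have a limit point `P'`, which solves the limit system as `P` does.
    -- Their difference is a nonzero real kernel vector, from which the sign-compatible integer step
    -- `z` comes.
    obtain ⟨P', -, ψ, hψ, hlim⟩ := (isCompact_Icc (a := (0 : E → ℝ)) (b := 1)).tendsto_subseq hmem
    have hlim' : ∀ e, Tendsto (fun t => (N (φ (ψ t)) e : ℝ) / φ (ψ t)) atTop (𝓝 (P' e)) :=
      tendsto_pi_nhds.1 hlim
    have hχ : Tendsto (fun t => φ (ψ t)) atTop atTop := (hφ.comp hψ).tendsto_atTop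
    have hker : ∀ c, ∑ e, (M c e : ℝ) * (P - P') e = 0 := by
      intro c
      have h1 : Tendsto (fun t => ∑ e, (M c e : ℝ) * ((N (φ (ψ t)) e : ℝ) / φ (ψ t))) atTop
          (𝓝 (∑ e, M c e * P' e)) := tendsto_finsetSum _ fun e _ => (hlim' e).const_mul _
      have h2 : Tendsto (fun t => ∑ e, (M c e : ℝ) * ((N (φ (ψ t)) e : ℝ) / φ (ψ t))) atTop
          (𝓝 (∑ e, M c e * P e)) := by
        refine ((hb c).comp hχ).congr fun t => ?_
        have h3 := (hN _ (hφp (ψ t)).2.1).1 c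
        rw [Function.comp_apply, ← h3]
        push_cast
        rw [Finset.sum_div]
        exact Finset.sum_congr rfl fun e _ => by ring
      have h3 := tendsto_nhds_unique h1 h2
      simp only [Pi.sub_apply, mul_sub, Finset.sum_sub_distrib]
      rw [h3, sub_self]
    have hne' : P - P' ≠ 0 := by
      intro h0
      have hPP : P = P' := sub_eq_zero.1 h0
      have h1 : Tendsto (fun t => ∑ e, |(N (φ (ψ t)) e : ℝ) / φ (ψ t) - P e|) atTop
          (𝓝 (∑ e, |P' e - P e|)) :=
        tendsto_finsetSum _ fun e _ => ((hlim' e).sub_const _).abs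
      rw [hPP] at h1
      simp only [sub_self, abs_zero, Finset.sum_const_zero] at h1
      have h2 : ε ≤ 0 := by
        refine ge_of_tendsto' h1 fun t => ?_
        have h3 := (hφp (ψ t)).1
        have h4 : (0 : ℝ) < φ (ψ t) := by exact_mod_cast (hφp (ψ t)).2.2
        refine h3.trans (le_of_eq ?_)
        simp only [D]
        rw [Finset.sum_div]
        refine Finset.sum_congr rfl fun e _ => ?_
        rw [← hPP, div_sub' h4.ne', abs_div, abs_of_pos h4]
      linarith
    obtain ⟨z, hz0, hzM, hzs⟩ := exists_int_kernel_vector M hker hne'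
    have hlarge : ∀ e, ∀ᶠ t in atTop, |(z e : ℝ)| ≤ φ (ψ t) * |P e - P' e| / 2 ∧
        |(N (φ (ψ t)) e : ℝ) / φ (ψ t) - P' e| ≤ |P e - P' e| / 2 ∨ z e = 0 := by
      intro e
      by_cases h0 : z e = 0
      · exact Eventually.of_forall fun _ => Or.inr h0
      have hpos : 0 < |P e - P' e| := by
        rw [abs_pos]
        rcases lt_or_gt_of_ne h0 with h | h
        · exact ((hzs e).2 h).ne
        · exact ((hzs e).1 h).ne'
      have h1 : Tendsto (fun t => (φ (ψ t) : ℝ) * (|P e - P' e| / 2)) atTop atTop :=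
        (tendsto_natCast_atTop_atTop.comp hχ).atTop_mul_const (by positivity)
      have h2 := Metric.tendsto_nhds.1 (hlim' e) (|P e - P' e| / 2) (by positivity)
      filter_upwards [h1.eventually_ge_atTop |(z e : ℝ)|, h2] with t ht1 ht2
      rw [Real.dist_eq] at ht2
      exact Or.inl ⟨by linarith, ht2.le⟩
    obtain ⟨t, ht⟩ := (eventually_all.2 hlarge).exists
    set n := φ (ψ t) with hn
    have hn0 : (0 : ℝ) < n := by exact_mod_cast (hφp (ψ t)).2.2
    obtain ⟨hNn, hNmin⟩ := hN n (hφp (ψ t)).2.1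
    -- Where `z e ≠ 0`, `N` stays at distance at least `n |P e - P' e| / 2` from `n P e`, on the
    -- side from which `z e` points towards `n P e`, and `|z e|` is no larger. So the step does not
    -- overshoot and shortens the distance by exactly `|z e|`; nonnegativity follows from `P e ≥ 0`.
    have hstep : ∀ e, 0 ≤ (N n e : ℤ) + z e ∧
        |(N n e : ℝ) + z e - n * P e| = |(N n e : ℝ) - n * P e| - |(z e : ℝ)| := by
      intro e
      rcases ht e with ⟨h1, h2⟩ | h0
      · have h3 : |(N n e : ℝ) - n * P' e| ≤ n * |P e - P' e| / 2 := by
          have h4 : (N n e : ℝ) - n * P' e = n * ((N n e : ℝ) / n - P' e) := by field_simp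
          rw [h4, abs_mul, abs_of_pos hn0]
          have := mul_le_mul_of_nonneg_left h2 hn0.le
          linarith
        have h5 := abs_le.1 h3
        rcases lt_trichotomy (z e) 0 with hz | hz | hz
        · have hy : P e - P' e < 0 := (hzs e).2 hz
          have hz' : (z e : ℝ) < 0 := by exact_mod_cast hz
          rw [abs_of_neg hy] at h1 h5
          rw [abs_of_neg hz'] at h1 ⊢
          have hPe := mul_nonneg hn0.le (hP e)
          constructor
          · have : (0 : ℝ) ≤ (N n e : ℝ) + z e := by nlinarith
            exact_mod_cast this
          · rw [abs_of_nonneg (by nlinarith), abs_of_nonneg (by nlinarith)]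
            ring
        · rw [hz]; simp
        · have hy : 0 < P e - P' e := (hzs e).1 hz
          have hz' : (0 : ℝ) < z e := by exact_mod_cast hz
          rw [abs_of_pos hy] at h1 h5
          rw [abs_of_pos hz'] at h1 ⊢
          constructor
          · positivity
          · rw [abs_of_nonpos (by nlinarith), abs_of_nonpos (by nlinarith)]
            ring
      · rw [h0]; simp
    let N' : E → ℕ := fun e => ((N n e : ℤ) + z e).toNat
    have hN' : ∀ e, (N' e : ℤ) = (N n e : ℤ) + z e := fun e => Int.toNat_of_nonneg (hstep e).1
    have hN'S : N' ∈ S n := by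
      intro c
      simp only [hN', mul_add, Finset.sum_add_distrib, hzM, add_zero]
      exact hNn c
    have hle := hNmin N' hN'S
    have hD' : D n N' = D n (N n) - ∑ e, |(z e : ℝ)| := by
      simp only [D]
      rw [← Finset.sum_sub_distrib]
      refine Finset.sum_congr rfl fun e _ => ?_
      have : (N' e : ℝ) = (N n e : ℝ) + z e := by exact_mod_cast hN' e
      rw [this, (hstep e).2]
    obtain ⟨e₁, he₁⟩ := Function.ne_iff.1 hz0
    have hpos : 0 < ∑ e, |(z e : ℝ)| := Finset.sum_pos' (fun _ _ => abs_nonneg _)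
      ⟨e₁, Finset.mem_univ _, abs_pos.2 (by exact_mod_cast he₁)⟩
    linarith
  intro e
  rw [tendsto_iff_dist_tendsto_zero]
  refine squeeze_zero' (Eventually.of_forall fun _ => dist_nonneg) ?_ hD
  filter_upwards [eventually_gt_atTop 0] with n hn
  have hn' : (0 : ℝ) < n := by exact_mod_cast hn
  rw [Real.dist_eq, div_sub' hn'.ne', abs_div, abs_of_pos hn']
  gcongr
  exact Finset.single_le_sum (f := fun e => |(N n e : ℝ) - n * P e|) (fun _ _ => abs_nonneg _)
    (Finset.mem_univ e)

/-! ### The limit polytope -/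

/-- The asymptotic fraction `s(k) - s(k+1)` of columns of length `k`. -/
def gap {d : ℕ} (s : Fin d → ℝ) (k : Fin d) : ℝ :=
  s k - if h : (k : ℕ) + 1 < d then s ⟨(k : ℕ) + 1, h⟩ else 0

theorem hatS_eq {d : ℕ} (s : Fin d → ℝ) (k : Fin d) : hatS s k = ((k : ℕ) + 1 : ℝ) * gap s k := rfl

/-- Sums of differences over the indices `k ≥ i` telescope. -/
theorem sum_gap_ge {d : ℕ} (s : Fin d → ℝ) (i : Fin d) :
    ∑ k, (if i ≤ k then gap s k else 0) = s i := by
  let s' : ℕ → ℝ := fun j => if h : j < d then s ⟨j, h⟩ else 0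
  have h1 : ∀ k : Fin d, (if i ≤ k then gap s k else 0) =
      s' (max i k) - s' (max i ((k : ℕ) + 1)) := by
    intro k
    split_ifs with h
    · rw [max_eq_right (Fin.le_def.1 h), max_eq_right ((Fin.le_def.1 h).trans (Nat.le_succ _))]
      simp [s', gap]
    · have h2 : (k : ℕ) + 1 ≤ i := Nat.succ_le_of_lt (not_le.1 h)
      rw [max_eq_left ((Nat.le_succ _).trans h2), max_eq_left h2, sub_self]
  rw [Finset.sum_congr rfl fun k _ => h1 k,
    Fin.sum_univ_eq_sum_range (fun j => s' (max i j) - s' (max i (j + 1))) d,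
    Finset.sum_range_sub' fun j => s' (max i j)]
  rw [max_eq_left (Nat.zero_le _), max_eq_right i.2.le]
  simp [s']

theorem sum_sum_ge {d : ℕ} {R : Type*} [CommSemiring R] (m : Fin d → R) :
    ∑ i : Fin d, ∑ k, (if i ≤ k then m k else 0) = ∑ k : Fin d, ((k : ℕ) + 1 : R) * m k := by
  rw [Finset.sum_comm]
  refine Finset.sum_congr rfl fun k _ => ?_
  rw [← Finset.sum_filter, Finset.sum_const, nsmul_eq_mul]
  have : (Finset.univ.filter fun i : Fin d => i ≤ k) = Finset.Iic k := by ext; simp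
  rw [this, Fin.card_Iic]
  push_cast
  rfl

theorem sum_hatS {d : ℕ} (s : Fin d → ℝ) : ∑ k, hatS s k = ∑ i, s i := by
  simp only [hatS_eq]
  rw [← sum_sum_ge, Finset.sum_congr rfl fun i _ => sum_gap_ge s i]

theorem gap_nonneg {d : ℕ} {s : Fin d → ℝ} (hs : ∀ i, 0 ≤ s i) (ha : Antitone s) (k : Fin d) :
    0 ≤ gap s k := by
  unfold gap
  split_ifs with h
  · have := ha (show k ≤ ⟨(k : ℕ) + 1, h⟩ from Fin.le_def.2 (Nat.le_succ _))
    linarith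
  · rw [sub_zero]; exact hs k

/-- The limits of rescaled types that are compatible with the shape `s`, the frequency `q` and the
supports of the distributions `p_k`. -/
def blockPolytope {d : ℕ} (s q : Fin d → ℝ) (A : Matrix (Fin d) (Fin d) ℂ) :
    Set (BlockFamily d) :=
  {P | (∀ k w, 0 ≤ P k w) ∧ (∀ k w, weight A k w = 0 → P k w = 0) ∧
    (∀ k, ∑ w, P k w = gap s k) ∧ ∀ i, ∑ k, ∑ w, P k w * count w i = q i}

theorem isCompact_blockPolytope {d : ℕ} (s q : Fin d → ℝ) (A : Matrix (Fin d) (Fin d) ℂ) :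
    IsCompact (blockPolytope s q A) := by
  refine IsCompact.of_isClosed_subset
    (isCompact_Icc (a := (0 : BlockFamily d)) (b := fun k _ => gap s k)) ?_ ?_
  · have h : blockPolytope s q A = (⋂ k, ⋂ w, {P | 0 ≤ P k w}) ∩
        (⋂ k, ⋂ w, ⋂ _ : weight A k w = 0, {P : BlockFamily d | P k w = 0}) ∩
        (⋂ k, {P | ∑ w, P k w = gap s k}) ∩
        (⋂ i, {P | ∑ k, ∑ w, P k w * count w i = q i}) := by
      ext P
      simp [blockPolytope, and_assoc]
    rw [h]
    refine ((IsClosed.inter ?_ ?_).inter ?_).inter ?_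
    · exact isClosed_iInter fun k => isClosed_iInter fun w =>
        isClosed_le continuous_const (by fun_prop)
    · exact isClosed_iInter fun k => isClosed_iInter fun w => isClosed_iInter fun _ =>
        isClosed_eq (by fun_prop) continuous_const
    · exact isClosed_iInter fun k => isClosed_eq (by fun_prop) continuous_const
    · exact isClosed_iInter fun i => isClosed_eq (by fun_prop) continuous_const
  · rintro P ⟨h1, -, h3, -⟩
    refine ⟨fun k w => h1 k w, fun k w => ?_⟩
    exact (Finset.single_le_sum (fun w _ => h1 k w) (Finset.mem_univ w)).trans (h3 k).le

theorem ShapeLimit.width {d : ℕ} {lam : ∀ n, YoungFrame d n} {s : Fin d → ℝ}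
    (h : ShapeLimit lam s) (k : Fin d) :
    Tendsto (fun n : ℕ => ((lam n).width k : ℝ) / n) atTop (𝓝 (gap s k)) := by
  have h1 : ∀ n, ((lam n).width k : ℝ) / n = ((lam n).row k : ℝ) / n - ((lam n).next k : ℝ) / n := by
    intro n
    rw [YoungFrame.width, Nat.cast_sub ((lam n).next_le k), sub_div]
  simp only [h1]
  refine (h k).sub ?_
  unfold YoungFrame.next
  split_ifs with hk
  · exact h _
  · simp

theorem typeCost_toFamily {d : ℕ} (A : Matrix (Fin d) (Fin d) ℂ)
    (N : (k : Fin d) → BlockWord d k → ℕ) {n : ℕ} (hn : 0 < n) :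
    typeCost A (fun k w => (N k w : ℝ) / n) = typeCost A (toFamily N) / n := by
  have hn' : (0 : ℝ) < (n : ℝ)⁻¹ := by positivity
  have : (fun k w => (N k w : ℝ) / n) = (n : ℝ)⁻¹ • toFamily N := by
    ext k w
    simp [toFamily, div_eq_inv_mul]
  rw [this, typeCost_smul A hn', div_eq_inv_mul]

/-- Lower semicontinuity: a strict lower bound for the cost on the limit polytope is eventually a
lower bound for the costs of all admissible types. -/
theorem eventually_le_typeCost {d : ℕ} {lam : ∀ n, YoungFrame d n} {f : ∀ n, Freq d n}
    {s q : Fin d → ℝ} (hl : ShapeLimit lam s) (hf : FreqLimit f q) {A : Matrix (Fin d) (Fin d) ℂ}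
    {c : ℝ} (hc : ∀ P ∈ blockPolytope s q A, c < typeCost A P) :
    ∀ᶠ n : ℕ in atTop, ∀ N ∈ blockTypes (lam n) (f n), (∀ k w, weight A k w = 0 → N k w = 0) →
      n * c ≤ typeCost A (toFamily N) := by
  by_contra hcon
  have hfreq : ∃ᶠ n : ℕ in atTop, ∃ N ∈ blockTypes (lam n) (f n),
      (∀ k w, weight A k w = 0 → N k w = 0) ∧ typeCost A (toFamily N) < n * c := by
    rw [Filter.Frequently]
    intro h
    apply hcon
    filter_upwards [h] with n hn N hN hs
    by_contra! hlt
    exact hn ⟨N, hN, hs, hlt⟩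
  obtain ⟨φ, hφ, hφp⟩ := extraction_of_frequently_atTop
    (hfreq.and_eventually (eventually_gt_atTop 0))
  choose N hNmem hNs hNlt using fun t => (hφp t).1
  have hpos : ∀ t, 0 < φ t := fun t => (hφp t).2
  let Q : ℕ → BlockFamily d := fun t k w => (N t k w : ℝ) / φ t
  have hQ : ∀ t, Q t ∈ Set.Icc (0 : BlockFamily d) 1 := by
    intro t
    refine ⟨fun k w => div_nonneg (Nat.cast_nonneg _) (Nat.cast_nonneg _), fun k w => ?_⟩
    refine (div_le_one (Nat.cast_pos.2 (hpos t))).2 (Nat.cast_le.2 ?_)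
    have h1 := (mem_blockTypes.1 (hNmem t)).1 k
    exact (Finset.single_le_sum (fun _ _ => Nat.zero_le _) (Finset.mem_univ w)).trans
      (h1.le.trans ((lam (φ t)).width_le k))
  obtain ⟨P, -, ψ, hψ, hlim⟩ := (isCompact_Icc (a := (0 : BlockFamily d)) (b := 1)).tendsto_subseq hQ
  have hlim' : ∀ k w, Tendsto (fun t => Q (ψ t) k w) atTop (𝓝 (P k w)) := fun k w =>
    tendsto_pi_nhds.1 (tendsto_pi_nhds.1 hlim k) w
  have hχ : Tendsto (fun t => φ (ψ t)) atTop atTop := (hφ.comp hψ).tendsto_atTop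
  -- The constraints on types are closed and pass to limits; continuity of the cost then contradicts
  -- the strict bound `c`.
  have hP : P ∈ blockPolytope s q A := by
    refine ⟨fun k w => ge_of_tendsto' (hlim' k w) fun t => (hQ _).1 k w, fun k w hw => ?_,
      fun k => ?_, fun i => ?_⟩
    · refine tendsto_nhds_unique (hlim' k w) ?_
      have : ∀ t, Q (ψ t) k w = 0 := fun t => by simp [Q, hNs _ k w hw]
      simp only [this]
      exact tendsto_const_nhds
    · refine tendsto_nhds_unique (tendsto_finsetSum _ fun w _ => hlim' k w) ?_
      refine ((hl.width k).comp hχ).congr fun t => ?_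
      rw [Function.comp_apply, ← (mem_blockTypes.1 (hNmem (ψ t))).1 k]
      push_cast
      rw [Finset.sum_div]
    · refine tendsto_nhds_unique (tendsto_finsetSum _ fun k _ => tendsto_finsetSum _ fun w _ =>
        (hlim' k w).mul_const _) ?_
      refine ((hf i).comp hχ).congr fun t => ?_
      rw [Function.comp_apply, ← (mem_blockTypes.1 (hNmem (ψ t))).2 i]
      push_cast
      rw [Finset.sum_div]
      refine Finset.sum_congr rfl fun k _ => ?_
      rw [Finset.sum_div]
      exact Finset.sum_congr rfl fun w _ => by simp only [Q]; ring
  have h1 : Tendsto (fun t => typeCost A (Q (ψ t))) atTop (𝓝 (typeCost A P)) :=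
    ((continuous_typeCost A).tendsto P).comp hlim
  have h2 : typeCost A P ≤ c := by
    refine le_of_tendsto' h1 fun t => ?_
    simp only [Q]
    rw [typeCost_toFamily A _ (hpos _), div_le_iff₀ (Nat.cast_pos.2 (hpos _)), mul_comm]
    exact (hNlt _).le
  exact absurd (hc P hP) (not_lt.2 h2)

theorem exists_type_of_overlap_ne_zero {d n : ℕ} {lam : YoungFrame d n} {f : Freq d n}
    {A : Matrix (Fin d) (Fin d) ℂ} (h : overlap A lam f ≠ 0) :
    ∃ N ∈ blockTypes lam f, ∀ k w, weight A k w = 0 → N k w = 0 := by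
  rw [overlap_eq_sum_types] at h
  obtain ⟨N, hN, h0⟩ := Finset.exists_ne_zero_of_sum_ne_zero (right_ne_zero_of_mul h)
  exact ⟨N, hN, support_of_typeWeight_ne_zero h0⟩

/-- Every point of the limit polytope is a limit of rescaled admissible types along every pair of
sequences that has admissible types at all. -/
theorem exists_types_tendsto {d : ℕ} {lam : ∀ n, YoungFrame d n} {f : ∀ n, Freq d n}
    {s q : Fin d → ℝ} (hl : ShapeLimit lam s) (hf : FreqLimit f q) {A : Matrix (Fin d) (Fin d) ℂ}
    (hne : ∀ᶠ n in atTop, overlap A (lam n) (f n) ≠ 0) {P : BlockFamily d}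
    (hP : P ∈ blockPolytope s q A) :
    ∃ N : ℕ → (k : Fin d) → BlockWord d k → ℕ,
      (∀ᶠ n in atTop, N n ∈ blockTypes (lam n) (f n) ∧ ∀ k w, weight A k w = 0 → N n k w = 0) ∧
      Tendsto (fun n : ℕ => (fun k w => (N n k w : ℝ) / n : BlockFamily d)) atTop (𝓝 P) := by
  classical
  -- Only words of positive weight become unknowns, so the support condition is built into the
  -- integer system. Its rows are the numbers of columns of each length and the letter counts.
  let E : Type := {p : (k : Fin d) × BlockWord d k // weight A p.1 p.2 ≠ 0}
  have hsum : ∀ {R : Type} [CommRing R] (F : (k : Fin d) → BlockWord d k → R),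
      (∀ k w, weight A k w = 0 → F k w = 0) → ∑ e : E, F e.1.1 e.1.2 = ∑ k, ∑ w, F k w := by
    intro R _ F hF
    rw [← Fintype.sum_sigma' F]
    have h1 : ∑ p : (k : Fin d) × BlockWord d k, F p.1 p.2 =
        ∑ p ∈ Finset.univ.filter fun p : (k : Fin d) × BlockWord d k => weight A p.1 p.2 ≠ 0,
          F p.1 p.2 := by
      symm
      refine Finset.sum_subset (Finset.subset_univ _) fun p _ hp => hF _ _ ?_
      simpa using hp
    rw [h1]
    symm
    exact Finset.sum_subtype _ (by simp) _
  let M : Fin d ⊕ Fin d → E → ℤ := fun c e =>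
    Sum.elim (fun k => if e.1.1 = k then 1 else 0) (fun i => (count e.1.2 i : ℤ)) c
  let b : ℕ → Fin d ⊕ Fin d → ℤ := fun n c =>
    Sum.elim (fun k => ((lam n).width k : ℤ)) (fun i => ((f n).toFun i : ℤ)) c
  have hMk : ∀ {R : Type} [CommRing R] (F : (k : Fin d) → BlockWord d k → R),
      (∀ k w, weight A k w = 0 → F k w = 0) → ∀ k,
      ∑ e : E, ((M (Sum.inl k) e : ℤ) : R) * F e.1.1 e.1.2 = ∑ w, F k w := by
    intro R _ F hF k
    have h1 := hsum (fun k' w => (if k' = k then 1 else 0) * F k' w) (fun k' w hw => by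
      rw [hF k' w hw, mul_zero])
    have h2 : ∑ k', ∑ w, (if k' = k then (1 : R) else 0) * F k' w = ∑ w, F k w := by
      rw [Finset.sum_eq_single k]
      · simp
      · intro k' _ hk'; simp [hk']
      · simp
    rw [← h2, ← h1]
    refine Finset.sum_congr rfl fun e _ => ?_
    simp [M]
  have hMi : ∀ {R : Type} [CommRing R] (F : (k : Fin d) → BlockWord d k → R),
      (∀ k w, weight A k w = 0 → F k w = 0) → ∀ i,
      ∑ e : E, ((M (Sum.inr i) e : ℤ) : R) * F e.1.1 e.1.2 = ∑ k, ∑ w, F k w * count w i := by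
    intro R _ F hF i
    rw [← hsum (fun k w => F k w * (count w i : R)) (fun k w hw => by rw [hF k w hw, zero_mul])]
    refine Finset.sum_congr rfl fun e _ => ?_
    simp [M, mul_comm]
  obtain ⟨hP0, hPs, hPg, hPq⟩ := hP
  obtain ⟨N, hN, hNlim⟩ := exists_tendsto_of_eventually_nonempty M b
    (P := fun e => P e.1.1 e.1.2) (fun e => hP0 _ _) (by
      rintro (k | i)
      · rw [hMk P hPs, hPg]
        exact hl.width k
      · rw [hMi P hPs, hPq]
        exact hf i) (by
      intro n N hN e
      have h1 := hN (Sum.inl e.1.1)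
      have h2 : (N e : ℤ) ≤ ∑ e', M (Sum.inl e.1.1) e' * (N e' : ℤ) := by
        have h3 := Finset.single_le_sum (f := fun e' => M (Sum.inl e.1.1) e' * (N e' : ℤ))
          (fun e' _ => mul_nonneg (by simp only [M, Sum.elim_inl]; split_ifs <;> simp)
            (Nat.cast_nonneg _)) (Finset.mem_univ e)
        simpa [M] using h3
      have h4 := (lam n).width_le e.1.1
      have h5 : b n (Sum.inl e.1.1) = ((lam n).width e.1.1 : ℤ) := rfl
      omega) (by
      filter_upwards [hne] with n hn
      obtain ⟨N, hN, hs⟩ := exists_type_of_overlap_ne_zero hn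
      obtain ⟨h1, h2⟩ := mem_blockTypes.1 hN
      refine ⟨fun e => N e.1.1 e.1.2, ?_⟩
      have h0 : ∀ k w, weight A k w = 0 → (N k w : ℤ) = 0 := fun k w hw => by rw [hs k w hw]; rfl
      rintro (k | i)
      · refine (hMk (fun k w => (N k w : ℤ)) h0 k).trans ?_
        simp only [b, Sum.elim_inl, ← h1 k]
        push_cast; rfl
      · refine (hMi (fun k w => (N k w : ℤ)) h0 i).trans ?_
        simp only [b, Sum.elim_inr, ← h2 i]
        push_cast; rfl)
  let N' : ℕ → (k : Fin d) → BlockWord d k → ℕ := fun n k w =>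
    if h : weight A k w ≠ 0 then N n ⟨⟨k, w⟩, h⟩ else 0
  have hN's : ∀ n k w, weight A k w = 0 → N' n k w = 0 := fun n k w hw => by simp [N', hw]
  have hN'e : ∀ n (e : E), N n e = N' n e.1.1 e.1.2 := by
    rintro n ⟨⟨k, w⟩, h⟩
    simp only [N']
    rw [dif_pos h]
  refine ⟨N', ?_, ?_⟩
  · filter_upwards [hN] with n hn
    have h0 : ∀ k w, weight A k w = 0 → (N' n k w : ℤ) = 0 := fun k w hw => by
      rw [hN's n k w hw]; rfl
    refine ⟨mem_blockTypes.2 ⟨fun k => ?_, fun i => ?_⟩, hN's n⟩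
    · have h1 := hn (Sum.inl k)
      simp only [hN'e] at h1
      have h2 := (hMk (fun k w => (N' n k w : ℤ)) h0 k).symm.trans h1
      simp only [b, Sum.elim_inl] at h2
      exact_mod_cast h2
    · have h1 := hn (Sum.inr i)
      simp only [hN'e] at h1
      have h2 := (hMi (fun k w => (N' n k w : ℤ)) h0 i).symm.trans h1
      simp only [b, Sum.elim_inr] at h2
      exact_mod_cast h2
  · rw [tendsto_pi_nhds]
    intro k
    rw [tendsto_pi_nhds]
    intro w
    by_cases h : weight A k w = 0
    · simp [hN's _ k w h, hPs k w h]
    · have := hNlim ⟨⟨k, w⟩, h⟩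
      simpa only [hN'e] using this

/-! ### Existence of sequences with nonvanishing traces -/

theorem overlap_pos {d n : ℕ} {lam : YoungFrame d n} {f : Freq d n} {A : Matrix (Fin d) (Fin d) ℂ}
    {N : (k : Fin d) → BlockWord d k → ℕ} (hN : N ∈ blockTypes lam f)
    (hs : ∀ k w, weight A k w = 0 → N k w = 0) : 0 < overlap A lam f := by
  rw [overlap_eq_sum_types]
  refine mul_pos lam.finrank_specht_pos ?_
  exact Finset.sum_pos' (fun _ _ => typeWeight_nonneg _ _) ⟨N, hN, typeWeight_pos hs⟩

theorem sum_count {d n : ℕ} (x : Fin n → Fin d) : ∑ i, count x i = n := by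
  have := sum_eq_sum_count x fun _ => 1
  simpa using this.symm

/-- The Young frame with `m k` columns of length `k + 1`. -/
def frameOfWidths {d n : ℕ} (m : Fin d → ℕ) (hm : ∑ k : Fin d, ((k : ℕ) + 1) * m k = n) :
    YoungFrame d n where
  row i := ∑ k, if i ≤ k then m k else 0
  antitone i j hij := Finset.sum_le_sum fun k _ => by
    split_ifs with h1 h2
    · exact le_rfl
    · exact absurd (hij.trans h1) h2
    · exact Nat.zero_le _
    · exact le_rfl
  sum_eq := by
    rw [← hm]
    exact sum_sum_ge m

theorem width_frameOfWidths {d n : ℕ} (m : Fin d → ℕ)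
    (hm : ∑ k : Fin d, ((k : ℕ) + 1) * m k = n) (k : Fin d) :
    (frameOfWidths m hm).width k = m k := by
  have h1 : (frameOfWidths m hm).next k = ∑ k', if k < k' then m k' else 0 := by
    unfold YoungFrame.next
    split_ifs with h
    · change (∑ k', if (⟨(k : ℕ) + 1, h⟩ : Fin d) ≤ k' then m k' else 0) = _
      refine Finset.sum_congr rfl fun k' _ => if_congr ?_ rfl rfl
      rw [Fin.le_def, Fin.lt_def]
      exact Nat.succ_le_iff
    · symm
      refine Finset.sum_eq_zero fun k' _ => ?_
      rw [if_neg]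
      exact fun h' => h (lt_of_le_of_lt (Nat.succ_le_of_lt (Fin.lt_def.1 h')) k'.2)
  have h2 : (frameOfWidths m hm).row k = m k + ∑ k', if k < k' then m k' else 0 := by
    change (∑ k', if k ≤ k' then m k' else 0) = _
    rw [← Finset.add_sum_erase _ _ (Finset.mem_univ k),
      ← Finset.add_sum_erase _ (fun k' => if k < k' then m k' else 0) (Finset.mem_univ k),
      if_pos le_rfl, if_neg (lt_irrefl k), zero_add]
    congr 1
    refine Finset.sum_congr rfl fun k' hk' => if_congr ?_ rfl rfl
    have := (Finset.mem_erase.1 hk').1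
    exact ⟨fun h => lt_of_le_of_ne h (Ne.symm this), le_of_lt⟩
  rw [YoungFrame.width, h1, h2, Nat.add_sub_cancel]

/-- A nonvanishing minor has a nonzero entry in its first column, which is a nonvanishing minor of
size one. This supplies the letter that fills up rounding losses. -/
theorem exists_weight_zero_ne_zero {d : ℕ} (hd : 0 < d) {A : Matrix (Fin d) (Fin d) ℂ} {k : Fin d}
    {w : BlockWord d k} (h : weight A k w ≠ 0) : ∃ w₀, weight A ⟨0, hd⟩ w₀ ≠ 0 := by
  have h1 : ∃ a, A.conjTranspose (w a) ⟨0, hd⟩ ≠ 0 := by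
    by_contra! hcon
    apply h
    rw [weight, blockWeight_eq, Matrix.det_eq_zero_of_column_eq_zero 0]
    · simp
    · intro a
      exact hcon a
  obtain ⟨a, ha⟩ := h1
  refine ⟨fun _ => w a, ?_⟩
  rw [weight, blockWeight_eq]
  have h2 : (Matrix.of fun i j : Fin (0 + 1) =>
      A.conjTranspose (w a) (Fin.castLE (show 0 + 1 ≤ d from hd) j)).det =
      A.conjTranspose (w a) ⟨0, hd⟩ := Matrix.det_fin_one _
  have h3 : ‖(Matrix.of fun i j : Fin (0 + 1) =>
      A.conjTranspose (w a) (Fin.castLE (show 0 + 1 ≤ d from hd) j)).det‖ ^ 2 /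
      ((0 + 1).factorial : ℝ) ≠ 0 := by
    rw [h2]
    have := norm_ne_zero_iff.2 ha
    positivity
  exact h3

theorem tendsto_floor_div {a : ℝ} (ha : 0 ≤ a) :
    Tendsto (fun n : ℕ => (⌊(n : ℝ) * a⌋₊ : ℝ) / n) atTop (𝓝 a) := by
  have h := (tendsto_nat_floor_mul_div_atTop ha).comp (tendsto_natCast_atTop_atTop (R := ℝ))
  refine h.congr fun n => ?_
  simp [mul_comm]

/-- Round `n P` down and put the missing `r n = o(n)` boxes into columns of length one that carry a
letter of nonzero weight. Frame and frequency are then read off from the resulting types, so an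
admissible type exists for every `n`. -/
theorem exists_sequences {d : ℕ} (hd : 0 < d) {s q : Fin d → ℝ} (hs : s ∈ stdSimplex ℝ (Fin d))
    {A : Matrix (Fin d) (Fin d) ℂ} {P : BlockFamily d} (hP : P ∈ blockPolytope s q A) :
    ∃ (lam : ∀ n, YoungFrame d n) (f : ∀ n, Freq d n), ShapeLimit lam s ∧ FreqLimit f q ∧
      ∀ n, overlap A (lam n) (f n) ≠ 0 := by
  classical
  obtain ⟨hP0, hPs, hPg, hPq⟩ := hP
  have hgap1 : ∑ k : Fin d, ((k : ℕ) + 1 : ℝ) * gap s k = 1 := by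
    exact (sum_hatS s).trans hs.2
  obtain ⟨w₀, hw₀⟩ : ∃ w₀, weight A ⟨0, hd⟩ w₀ ≠ 0 := by
    obtain ⟨k, -, hk⟩ := Finset.exists_ne_zero_of_sum_ne_zero (hgap1.trans_ne one_ne_zero)
    rw [← hPg k] at hk
    obtain ⟨w, -, hw⟩ := Finset.exists_ne_zero_of_sum_ne_zero (right_ne_zero_of_mul hk)
    exact exists_weight_zero_ne_zero hd fun h => hw (hPs k w h)
  let B : ℕ → (k : Fin d) → BlockWord d k → ℕ := fun n k w => ⌊(n : ℝ) * P k w⌋₊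
  have hB : ∀ n, ∑ k : Fin d, ((k : ℕ) + 1) * ∑ w, B n k w ≤ n := by
    intro n
    have h1 : ((∑ k : Fin d, ((k : ℕ) + 1) * ∑ w, B n k w : ℕ) : ℝ) ≤ n := by
      push_cast
      calc ∑ k : Fin d, ((k : ℕ) + 1 : ℝ) * ∑ w, (B n k w : ℝ)
          ≤ ∑ k : Fin d, ((k : ℕ) + 1 : ℝ) * ∑ w, (n : ℝ) * P k w := by
            refine Finset.sum_le_sum fun k _ => mul_le_mul_of_nonneg_left
              (Finset.sum_le_sum fun w _ => ?_) (by positivity)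
            exact Nat.floor_le (mul_nonneg (Nat.cast_nonneg _) (hP0 k w))
        _ = n * ∑ k : Fin d, ((k : ℕ) + 1 : ℝ) * gap s k := by
            rw [Finset.mul_sum]
            refine Finset.sum_congr rfl fun k _ => ?_
            rw [← Finset.mul_sum, hPg]
            ring
        _ = n := by rw [hgap1, mul_one]
    exact_mod_cast h1
  let r : ℕ → ℕ := fun n => n - ∑ k : Fin d, ((k : ℕ) + 1) * ∑ w, B n k w
  let δ : (k : Fin d) → BlockWord d k → ℕ := fun k w =>
    if (⟨k, w⟩ : (k : Fin d) × BlockWord d k) = ⟨⟨0, hd⟩, w₀⟩ then 1 else 0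
  have hδ0 : ∀ w, δ ⟨0, hd⟩ w = if w = w₀ then 1 else 0 := by
    intro w
    simp [δ]
  have hδ1 : ∀ k, k ≠ ⟨0, hd⟩ → ∀ w, δ k w = 0 := by
    intro k hk w
    refine if_neg fun h => hk ?_
    exact congrArg Sigma.fst h
  let N : ℕ → (k : Fin d) → BlockWord d k → ℕ := fun n k w => B n k w + r n * δ k w
  have hNs : ∀ n k w, weight A k w = 0 → N n k w = 0 := by
    intro n k w hw
    have h1 : δ k w = 0 := by
      refine if_neg fun h => ?_
      have : weight A (⟨k, w⟩ : (k : Fin d) × BlockWord d k).1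
          (⟨k, w⟩ : (k : Fin d) × BlockWord d k).2 ≠ 0 := by rw [h]; exact hw₀
      exact this hw
    simp [N, B, h1, hPs k w hw]
  have hδsum : ∑ k : Fin d, ((k : ℕ) + 1) * ∑ w, δ k w = 1 := by
    rw [Finset.sum_eq_single ⟨0, hd⟩]
    · simp [hδ0]
    · intro k _ hk; simp [hδ1 k hk]
    · simp
  have hNsum : ∀ n, ∑ k : Fin d, ((k : ℕ) + 1) * ∑ w, N n k w = n := by
    intro n
    have h1 : ∑ k : Fin d, ((k : ℕ) + 1) * ∑ w, N n k w =
        ∑ k : Fin d, ((k : ℕ) + 1) * ∑ w, B n k w +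
          r n * ∑ k : Fin d, ((k : ℕ) + 1) * ∑ w, δ k w := by
      rw [Finset.mul_sum, ← Finset.sum_add_distrib]
      refine Finset.sum_congr rfl fun k _ => ?_
      simp only [N, Finset.sum_add_distrib, ← Finset.mul_sum]
      ring
    rw [h1, hδsum, mul_one]
    have := hB n
    simp only [r]
    omega
  have hBlim : ∀ k w, Tendsto (fun n : ℕ => (B n k w : ℝ) / n) atTop (𝓝 (P k w)) := fun k w =>
    tendsto_floor_div (hP0 k w)
  have hrlim : Tendsto (fun n : ℕ => (r n : ℝ) / n) atTop (𝓝 0) := by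
    have h1 : Tendsto (fun n : ℕ => (1 : ℝ) - ∑ k : Fin d, ((k : ℕ) + 1 : ℝ) *
        ∑ w, (B n k w : ℝ) / n) atTop (𝓝 (1 - ∑ k : Fin d, ((k : ℕ) + 1 : ℝ) * ∑ w, P k w)) :=
      (tendsto_finsetSum _ fun k _ =>
        (tendsto_finsetSum _ fun w _ => hBlim k w).const_mul _).const_sub _
    simp only [hPg, hgap1, sub_self] at h1
    refine h1.congr' ?_
    filter_upwards [eventually_gt_atTop 0] with n hn
    have hn' : (n : ℝ) ≠ 0 := by exact_mod_cast hn.ne'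
    simp only [r]
    rw [Nat.cast_sub (hB n), sub_div, div_self hn']
    push_cast
    rw [Finset.sum_div]
    congr 1
    refine Finset.sum_congr rfl fun k _ => ?_
    rw [← Finset.sum_div, mul_div_assoc]
  have hNlim : ∀ k w, Tendsto (fun n : ℕ => (N n k w : ℝ) / n) atTop (𝓝 (P k w)) := by
    intro k w
    have h1 := (hBlim k w).add (hrlim.mul_const (δ k w : ℝ))
    rw [zero_mul, add_zero] at h1
    refine h1.congr fun n => ?_
    simp only [N]
    push_cast
    ring
  have hfsum : ∀ n, ∑ i, ∑ k, ∑ w, N n k w * count w i = n := by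
    intro n
    conv_rhs => rw [← hNsum n]
    rw [Finset.sum_comm]
    refine Finset.sum_congr rfl fun k _ => ?_
    rw [Finset.sum_comm, Finset.mul_sum]
    refine Finset.sum_congr rfl fun w _ => ?_
    rw [← Finset.mul_sum, sum_count, mul_comm]
  refine ⟨fun n => frameOfWidths (fun k => ∑ w, N n k w) (hNsum n),
    fun n => ⟨fun i => ∑ k, ∑ w, N n k w * count w i, hfsum n⟩, fun i => ?_, fun i => ?_,
    fun n => ?_⟩
  · rw [← sum_gap_ge s i]
    have h1 : Tendsto (fun n : ℕ => ∑ k, (if i ≤ k then ∑ w, (N n k w : ℝ) / n else 0)) atTop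
        (𝓝 (∑ k, (if i ≤ k then gap s k else 0))) := by
      refine tendsto_finsetSum _ fun k _ => ?_
      split_ifs
      · rw [← hPg k]
        exact tendsto_finsetSum _ fun w _ => hNlim k w
      · exact tendsto_const_nhds
    refine h1.congr fun n => ?_
    change _ = ((∑ k, (if i ≤ k then ∑ w, N n k w else 0) : ℕ) : ℝ) / n
    push_cast
    rw [Finset.sum_div]
    refine Finset.sum_congr rfl fun k _ => ?_
    split_ifs
    · rw [Finset.sum_div]
    · simp
  · rw [← hPq i]
    have h1 : Tendsto (fun n : ℕ => ∑ k, ∑ w, (N n k w : ℝ) / n * count w i) atTop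
        (𝓝 (∑ k, ∑ w, P k w * count w i)) :=
      tendsto_finsetSum _ fun k _ => tendsto_finsetSum _ fun w _ => (hNlim k w).mul_const _
    refine h1.congr fun n => ?_
    push_cast
    rw [Finset.sum_div]
    refine Finset.sum_congr rfl fun k _ => ?_
    rw [Finset.sum_div]
    exact Finset.sum_congr rfl fun w _ => by ring
  · refine (overlap_pos (mem_blockTypes.2 ⟨fun k => ?_, fun i => rfl⟩) (hNs n)).ne'
    rw [width_frameOfWidths]

/-! ### The exponent -/

theorem tendsto_log_add_div (c : ℝ) :
    Tendsto (fun n : ℕ => Real.log ((n : ℝ) + c) / n) atTop (𝓝 0) := by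
  have h1 : Tendsto (fun x : ℝ => Real.log x / (x - c)) atTop (𝓝 0) := by
    simpa [← sub_eq_add_neg] using Real.tendsto_pow_log_div_mul_add_atTop 1 (-c) 1 one_ne_zero
  have h2 : Tendsto (fun n : ℕ => (n : ℝ) + c) atTop atTop :=
    tendsto_atTop_add_const_right _ _ tendsto_natCast_atTop_atTop
  refine (h1.comp h2).congr fun n => ?_
  simp

theorem tendsto_logError :
    Tendsto (fun n : ℕ => (1 + Real.log ((n : ℝ) + 1)) / n) atTop (𝓝 0) := by
  have h := tendsto_one_div_atTop_nhds_zero_nat (𝕜 := ℝ).add (tendsto_log_add_div 1)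
  rw [add_zero] at h
  exact h.congr fun n => by ring

theorem sum_mulLog_row {d n : ℕ} (lam : YoungFrame d n) (hn : 0 < n) :
    (mulLog n - ∑ i, mulLog (lam.row i)) / n = -∑ i, mulLog ((lam.row i : ℝ) / n) := by
  have hn' : (0 : ℝ) < n := by exact_mod_cast hn
  have h1 : ∀ i, mulLog (lam.row i) = n * mulLog ((lam.row i : ℝ) / n) +
      Real.log n * lam.row i := by
    intro i
    have h2 : (lam.row i : ℝ) = n * ((lam.row i : ℝ) / n) := by field_simp
    conv_lhs => rw [h2]
    rw [mulLog_mul hn', mul_comm (n : ℝ) (Real.log n), mul_assoc, ← h2]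
  rw [Finset.sum_congr rfl fun i _ => h1 i, Finset.sum_add_distrib, ← Finset.mul_sum,
    ← Finset.mul_sum, ← Nat.cast_sum, lam.sum_eq, div_eq_iff hn'.ne', mulLog]
  ring

theorem tendsto_log_finrank {d : ℕ} {lam : ∀ n, YoungFrame d n} {s : Fin d → ℝ}
    (hl : ShapeLimit lam s) :
    Tendsto (fun n : ℕ => Real.log (Module.finrank ℂ (lam n).specht) / n) atTop
      (𝓝 (-∑ i, mulLog (s i))) := by
  have h1 : Tendsto (fun n : ℕ => -∑ i, mulLog (((lam n).row i : ℝ) / n)) atTop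
      (𝓝 (-∑ i, mulLog (s i))) :=
    (tendsto_finsetSum _ fun i _ => (continuous_mulLog.tendsto _).comp (hl i)).neg
  have h2 : Tendsto (fun n : ℕ => -∑ i, mulLog (((lam n).row i : ℝ) / n) -
      d * ((1 + Real.log ((n : ℝ) + 1)) / n) - d * (d * (Real.log ((n : ℝ) + d) / n))) atTop
      (𝓝 (-∑ i, mulLog (s i))) := by
    have := (h1.sub (tendsto_logError.const_mul (d : ℝ))).sub
      (((tendsto_log_add_div d).const_mul (d : ℝ)).const_mul (d : ℝ))
    simpa using this
  refine tendsto_of_tendsto_of_tendsto_of_le_of_le' h2 h1 ?_ ?_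
  · filter_upwards [eventually_gt_atTop 0] with n hn
    have hn' : (0 : ℝ) < n := by exact_mod_cast hn
    have h3 := div_le_div_of_nonneg_right (lam n).le_log_finrank hn'.le
    rw [sub_div, sub_div, sum_mulLog_row (lam n) hn] at h3
    refine le_trans (le_of_eq ?_) h3
    ring
  · filter_upwards [eventually_gt_atTop 0] with n hn
    have hn' : (0 : ℝ) < n := by exact_mod_cast hn
    rw [← sum_mulLog_row (lam n) hn]
    exact div_le_div_of_nonneg_right ((lam n).log_finrank_le hn) hn'.le

theorem log_overlap {d n : ℕ} {lam : YoungFrame d n} {f : Freq d n} {A : Matrix (Fin d) (Fin d) ℂ}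
    (h : overlap A lam f ≠ 0) :
    Real.log (overlap A lam f) = Real.log (Module.finrank ℂ lam.specht) +
      Real.log (∑ N ∈ blockTypes lam f, typeWeight A N) := by
  rw [overlap_eq_sum_types] at h ⊢
  exact Real.log_mul (left_ne_zero_of_mul h) (right_ne_zero_of_mul h)

theorem sum_typeWeight_pos {d n : ℕ} {lam : YoungFrame d n} {f : Freq d n}
    {A : Matrix (Fin d) (Fin d) ℂ} (h : overlap A lam f ≠ 0) :
    0 < ∑ N ∈ blockTypes lam f, typeWeight A N := by
  rw [overlap_eq_sum_types] at h
  exact lt_of_le_of_ne (Finset.sum_nonneg fun _ _ => typeWeight_nonneg _ _)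
    (right_ne_zero_of_mul h).symm

/-- Eventually the sum over types decays at least as fast as any cost that lies below the costs on
the limit polytope. -/
theorem eventually_log_sum_le {d : ℕ} {lam : ∀ n, YoungFrame d n} {f : ∀ n, Freq d n}
    {s q : Fin d → ℝ} (hl : ShapeLimit lam s) (hf : FreqLimit f q) {A : Matrix (Fin d) (Fin d) ℂ}
    {c : ℝ} (hc : ∀ P ∈ blockPolytope s q A, c < typeCost A P) :
    ∀ᶠ n : ℕ in atTop, overlap A (lam n) (f n) ≠ 0 →
      Real.log (∑ N ∈ blockTypes (lam n) (f n), typeWeight A N) / n ≤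
        -c + (d + wordCount d) * ((1 + Real.log ((n : ℝ) + 1)) / n) := by
  filter_upwards [eventually_le_typeCost hl hf hc, eventually_gt_atTop 0] with n hn hn0 hne
  have hn' : (0 : ℝ) < n := by exact_mod_cast hn0
  have h1 := sum_typeWeight_le hn
  rw [← Real.log_le_iff_le_exp (sum_typeWeight_pos hne)] at h1
  have h2 := div_le_div_of_nonneg_right h1 hn'.le
  refine h2.trans (le_of_eq ?_)
  field_simp

/-- From below, a single sequence of types converging to the minimizer suffices; from above, every
constant below the minimal cost eventually bounds all types at once. -/
theorem tendsto_log_sum {d : ℕ} {lam : ∀ n, YoungFrame d n} {f : ∀ n, Freq d n}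
    {s q : Fin d → ℝ} (hl : ShapeLimit lam s) (hf : FreqLimit f q) {A : Matrix (Fin d) (Fin d) ℂ}
    (hne : ∀ᶠ n in atTop, overlap A (lam n) (f n) ≠ 0) {P : BlockFamily d}
    (hP : P ∈ blockPolytope s q A) (hmin : ∀ P' ∈ blockPolytope s q A, typeCost A P ≤ typeCost A P') :
    Tendsto (fun n : ℕ => Real.log (∑ N ∈ blockTypes (lam n) (f n), typeWeight A N) / n) atTop
      (𝓝 (-typeCost A P)) := by
  have herr := tendsto_logError
  rw [tendsto_order]
  constructor
  · intro a ha
    obtain ⟨N, hN, hlim⟩ := exists_types_tendsto hl hf hne hP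
    have h1 : Tendsto (fun n : ℕ => -typeCost A (fun k w => (N n k w : ℝ) / n) -
        wordCount d * ((1 + Real.log ((n : ℝ) + 1)) / n)) atTop (𝓝 (-typeCost A P)) := by
      have := (((continuous_typeCost A).tendsto P).comp hlim).neg.sub
        (herr.const_mul (wordCount d : ℝ))
      simpa using this
    filter_upwards [h1.eventually_const_lt ha, hN, eventually_gt_atTop 0] with n hn hNn hn0
    refine hn.trans_le ?_
    have hn' : (0 : ℝ) < n := by exact_mod_cast hn0
    have h2 := le_log_typeWeight hNn.1 hNn.2
    have h3 : typeWeight A (N n) ≤ ∑ N ∈ blockTypes (lam n) (f n), typeWeight A N :=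
      Finset.single_le_sum (f := typeWeight A) (fun _ _ => typeWeight_nonneg _ _) hNn.1
    have h4 := h2.trans (Real.log_le_log (typeWeight_pos hNn.2) h3)
    rw [typeCost_toFamily A _ hn0]
    refine le_trans (le_of_eq ?_) (div_le_div_of_nonneg_right h4 hn'.le)
    field_simp
  · intro a ha
    -- Half of the distance from `-typeCost A P` to `a`: it is positive, and `-(typeCost A P - ε)`
    -- still lies below `a`.
    set ε := (a + typeCost A P) / 2 with hε
    have h1 := eventually_log_sum_le hl hf (A := A) (c := typeCost A P - ε)
      (fun P' hP' => by have := hmin P' hP'; linarith)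
    have h2 : Tendsto (fun n : ℕ => -(typeCost A P - ε) +
        ((d : ℝ) + wordCount d) * ((1 + Real.log ((n : ℝ) + 1)) / n)) atTop
        (𝓝 (-(typeCost A P - ε))) := by
      have := (herr.const_mul ((d : ℝ) + wordCount d)).const_add (-(typeCost A P - ε))
      simpa using this
    filter_upwards [h1, hne, h2.eventually_lt_const (show -(typeCost A P - ε) < a by linarith)]
      with n hn1 hn2 hn3
    exact (hn1 hn2).trans_lt hn3

theorem rate_eq {d : ℕ} {A : Matrix (Fin d) (Fin d) ℂ} {lam : ∀ n, YoungFrame d n}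
    {f : ∀ n, Freq d n} {n : ℕ} (h : overlap A (lam n) (f n) ≠ 0) :
    rate A lam f n = ((-(Real.log (overlap A (lam n) (f n)) / n) / Real.log 2 : ℝ) : EReal) := by
  rw [rate, log2, if_neg h, ← EReal.coe_mul, ← EReal.coe_neg, Real.logb]
  congr 1
  ring

theorem rate_eq_top {d : ℕ} {A : Matrix (Fin d) (Fin d) ℂ} {lam : ∀ n, YoungFrame d n}
    {f : ∀ n, Freq d n} {n : ℕ} (hn : 0 < n) (h : overlap A (lam n) (f n) = 0) :
    rate A lam f n = ⊤ := by
  rw [rate, log2, if_pos h, EReal.coe_mul_bot_of_pos (by positivity), EReal.neg_bot]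

theorem entropy_eq {d : ℕ} (s : Fin d → ℝ) : entropy s = -(∑ i, mulLog (s i)) / Real.log 2 := by
  rw [entropy, neg_div, Finset.sum_div]
  congr 1
  refine Finset.sum_congr rfl fun i _ => ?_
  rw [Real.logb, mulLog]
  ring

/-- If the limit polytope is nonempty, then the exponent is finite and given by the minimal cost. -/
theorem hasTheta_of_isMin {d : ℕ} (hd : 0 < d) {s q : Fin d → ℝ} (hs : s ∈ stdSimplex ℝ (Fin d))
    {A : Matrix (Fin d) (Fin d) ℂ} {P : BlockFamily d} (hP : P ∈ blockPolytope s q A)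
    (hmin : ∀ P' ∈ blockPolytope s q A, typeCost A P ≤ typeCost A P') :
    HasTheta q s A ((-entropy s + typeCost A P / Real.log 2 : ℝ) : EReal) := by
  constructor
  · intro lam f hl hf hne
    replace hne := hne.resolve_left (EReal.coe_ne_top _)
    have h1 : Tendsto (fun n : ℕ => Real.log (overlap A (lam n) (f n)) / n) atTop
        (𝓝 (-∑ i, mulLog (s i) + -typeCost A P)) := by
      refine ((tendsto_log_finrank hl).add (tendsto_log_sum hl hf hne hP hmin)).congr' ?_
      filter_upwards [hne] with n hn
      rw [log_overlap hn, add_div]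
    have h2 : Tendsto (fun n : ℕ => -(Real.log (overlap A (lam n) (f n)) / n) / Real.log 2) atTop
        (𝓝 (-entropy s + typeCost A P / Real.log 2)) := by
      have h3 : -entropy s + typeCost A P / Real.log 2 =
          -(-∑ i, mulLog (s i) + -typeCost A P) / Real.log 2 := by
        rw [entropy_eq]
        ring
      rw [h3]
      exact h1.neg.div_const _
    refine ((continuous_coe_real_ereal.tendsto _).comp h2).congr' ?_
    filter_upwards [hne] with n hn
    rw [rate_eq hn]
    rfl
  · intro _
    obtain ⟨lam, f, hl, hf, hne⟩ := exists_sequences hd hs hP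
    exact ⟨lam, f, hl, hf, Eventually.of_forall hne⟩

/-- If the limit polytope is empty, then the exponent is infinite. -/
theorem hasTheta_top {d : ℕ} {s q : Fin d → ℝ} {A : Matrix (Fin d) (Fin d) ℂ}
    (hempty : blockPolytope s q A = ∅) : HasTheta q s A ⊤ := by
  refine ⟨fun lam f hl hf _ => ?_, fun h => absurd rfl h⟩
  rw [EReal.tendsto_nhds_top_iff_real]
  intro c
  -- On an empty polytope every real number is a lower bound for the cost. This one outweighs the
  -- dimension factor and leaves room for the error terms.
  set C : ℝ := c * Real.log 2 + (-∑ i, mulLog (s i)) + 2 with hC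
  have h3 := eventually_log_sum_le hl hf (A := A) (c := C) (by rw [hempty]; simp)
  have h4 : Tendsto (fun n : ℕ => Real.log (Module.finrank ℂ (lam n).specht) / n +
      ((d : ℝ) + wordCount d) * ((1 + Real.log ((n : ℝ) + 1)) / n)) atTop
      (𝓝 (-∑ i, mulLog (s i))) := by
    have := (tendsto_log_finrank hl).add (tendsto_logError.const_mul ((d : ℝ) + wordCount d))
    simpa using this
  filter_upwards [h3, h4.eventually_lt_const (lt_add_one _), eventually_gt_atTop 0]
    with n hn3 hn4 hn0
  by_cases h0 : overlap A (lam n) (f n) = 0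
  · rw [rate_eq_top hn0 h0]
    exact EReal.coe_lt_top c
  · rw [rate_eq h0, EReal.coe_lt_coe_iff, lt_div_iff₀ (Real.log_pos one_lt_two), log_overlap h0,
      add_div]
    have := hn3 h0
    linarith

/-! ### Sums of extended real numbers -/

theorem coe_sum_ereal {ι : Type*} (t : Finset ι) (g : ι → ℝ) :
    ((∑ i ∈ t, g i : ℝ) : EReal) = ∑ i ∈ t, (g i : EReal) := by
  classical
  induction t using Finset.induction_on with
  | empty => simp
  | insert a t ha ih => rw [Finset.sum_insert ha, Finset.sum_insert ha, EReal.coe_add, ih]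

theorem sum_ereal_ne_bot {ι : Type*} (t : Finset ι) {g : ι → EReal} (h : ∀ i ∈ t, g i ≠ ⊥) :
    ∑ i ∈ t, g i ≠ ⊥ := by
  classical
  induction t using Finset.induction_on with
  | empty => simp
  | insert a t ha ih =>
    rw [Finset.sum_insert ha, EReal.add_ne_bot_iff]
    exact ⟨h a (Finset.mem_insert_self _ _), ih fun i hi => h i (Finset.mem_insert_of_mem hi)⟩

/-- The summands must avoid `⊥` because it absorbs `⊤` in sums of extended reals. -/
theorem ne_top_of_sum_ereal_ne_top {ι : Type*} {t : Finset ι} {g : ι → EReal}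
    (h : ∀ i ∈ t, g i ≠ ⊥) (hs : ∑ i ∈ t, g i ≠ ⊤) {i : ι} (hi : i ∈ t) : g i ≠ ⊤ := by
  classical
  intro h0
  apply hs
  rw [← Finset.add_sum_erase t g hi, h0]
  exact EReal.top_add_of_ne_bot (sum_ereal_ne_bot _ fun j hj => h j (Finset.mem_of_mem_erase hj))

/-! ### The inner minimum -/

theorem relEntropy_of_support {X : Type} [Fintype X] {p r : X → ℝ} (h : ∀ x, r x = 0 → p x = 0) :
    relEntropy p r =
      (((∑ x, mulLog (p x) - ∑ x, p x * Real.log (r x)) / Real.log 2 : ℝ) : EReal) := by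
  rw [relEntropy, if_pos fun x hx hr => hx (h x hr)]
  congr 1
  rw [← Finset.sum_sub_distrib, Finset.sum_div]
  refine Finset.sum_congr rfl fun x _ => ?_
  rw [mulLog, Real.logb, Real.logb]
  ring

theorem relEntropy_of_not_support {X : Type} [Fintype X] {p r : X → ℝ}
    (h : ¬ ∀ x, r x = 0 → p x = 0) : relEntropy p r = ⊤ := by
  rw [relEntropy, if_neg]
  intro h'
  apply h
  intro x hx
  by_contra hp
  exact h' x hp hx

theorem relEntropy_ne_bot {X : Type} [Fintype X] (p r : X → ℝ) : relEntropy p r ≠ ⊥ := by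
  by_cases h : ∀ x, r x = 0 → p x = 0
  · rw [relEntropy_of_support h]
    exact EReal.coe_ne_bot _
  · rw [relEntropy_of_not_support h]
    exact top_ne_bot

theorem isCompact_blockDist {d : ℕ} (r : Fin d → ℝ) (k : ℕ) : IsCompact (blockDist r k) := by
  classical
  refine (isCompact_stdSimplex ℝ (Fin k → Fin d)).of_isClosed_subset ?_ fun p hp => hp.1
  have h : blockDist r k = stdSimplex ℝ (Fin k → Fin d) ∩
      (⋂ x, ⋂ _ : ∃ i, 1 < count x i, {p : (Fin k → Fin d) → ℝ | p x = 0}) ∩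
      ⋂ i, {p | (∑ x ∈ Finset.univ.filter fun x : Fin k → Fin d => ∃! l, x l = i, p x) =
        k * r i} := by
    ext p
    simp only [blockDist, Set.mem_ofPred_eq, Set.mem_inter_iff, Set.mem_iInter, and_assoc]
  rw [h]
  refine ((isClosed_stdSimplex ℝ _).inter ?_).inter ?_
  · exact isClosed_iInter fun x => isClosed_iInter fun _ =>
      isClosed_eq (continuous_apply x) continuous_const
  · exact isClosed_iInter fun i => isClosed_eq
      (continuous_finsetSum _ fun x _ => continuous_apply x) continuous_const

/-- On the compact set of those `p` that are supported where the weight is nonzero, relative entropy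
is continuous; elsewhere it is infinite. If that set is empty, every `p` attains the value `⊤`. -/
theorem exists_relEntropy_eq_blockMin {d : ℕ} (A : Matrix (Fin d) (Fin d) ℂ) (r : Fin d → ℝ)
    (k : Fin d) (hne : (blockDist r ((k : ℕ) + 1)).Nonempty) :
    ∃ p ∈ blockDist r ((k : ℕ) + 1),
      relEntropy p (blockWeight A (show (k : ℕ) + 1 ≤ d from k.isLt)) = blockMin A r k := by
  set g : BlockWord d k → ℝ := blockWeight A (show (k : ℕ) + 1 ≤ d from k.isLt) with hg
  set K : Set (BlockWord d k → ℝ) := blockDist r ((k : ℕ) + 1) ∩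
    ⋂ x, ⋂ _ : g x = 0, {p | p x = 0} with hK
  have hKmem : ∀ p, p ∈ K ↔ p ∈ blockDist r ((k : ℕ) + 1) ∧ ∀ x, g x = 0 → p x = 0 := by
    intro p
    simp [hK]
  have hKc : IsCompact K := (isCompact_blockDist r _).inter_right
    (isClosed_iInter fun x => isClosed_iInter fun _ =>
      isClosed_eq (continuous_apply x) continuous_const)
  by_cases hKne : K.Nonempty
  · have hcont : Continuous fun p : BlockWord d k → ℝ =>
        (∑ x, mulLog (p x) - ∑ x, p x * Real.log (g x)) / Real.log 2 := by
      have := continuous_mulLog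
      fun_prop
    obtain ⟨p, hp, hmin⟩ := hKc.exists_isMinOn hKne hcont.continuousOn
    obtain ⟨hp1, hp2⟩ := (hKmem p).1 hp
    refine ⟨p, hp1, le_antisymm (le_iInf₂ fun p' hp' => ?_) (iInf₂_le p hp1)⟩
    by_cases h : ∀ x, g x = 0 → p' x = 0
    · rw [relEntropy_of_support hp2, relEntropy_of_support h, EReal.coe_le_coe_iff]
      exact hmin ((hKmem p').2 ⟨hp', h⟩)
    · rw [relEntropy_of_not_support h]
      exact le_top
  · obtain ⟨p, hp⟩ := hne
    have htop : ∀ p' ∈ blockDist r ((k : ℕ) + 1), relEntropy p' g = ⊤ := fun p' hp' =>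
      relEntropy_of_not_support fun h => hKne ⟨p', (hKmem p').2 ⟨hp', h⟩⟩
    refine ⟨p, hp, le_antisymm (le_iInf₂ fun p' hp' => ?_) (iInf₂_le p hp)⟩
    rw [htop p hp]
    exact (htop p' hp').ge

theorem blockMin_ne_bot {d : ℕ} (A : Matrix (Fin d) (Fin d) ℂ) (r : Fin d → ℝ) (k : Fin d) :
    blockMin A r k ≠ ⊥ := by
  by_cases hne : (blockDist r ((k : ℕ) + 1)).Nonempty
  · obtain ⟨p, -, hp⟩ := exists_relEntropy_eq_blockMin A r k hne
    rw [← hp]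
    exact relEntropy_ne_bot _ _
  · have : blockMin A r k = ⊤ := by
      rw [eq_top_iff]
      exact le_iInf₂ fun p hp => absurd ⟨p, hp⟩ hne
    rw [this]
    exact top_ne_bot

theorem exists_of_blockMin_ne_top {d : ℕ} {A : Matrix (Fin d) (Fin d) ℂ} {r : Fin d → ℝ}
    {k : Fin d} (h : blockMin A r k ≠ ⊤) :
    ∃ p ∈ blockDist r ((k : ℕ) + 1), (∀ w, weight A k w = 0 → p w = 0) ∧ blockMin A r k =
      (((∑ w, mulLog (p w) - ∑ w, p w * Real.log (weight A k w)) / Real.log 2 : ℝ) : EReal) := by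
  have hne : (blockDist r ((k : ℕ) + 1)).Nonempty := by
    by_contra hne
    apply h
    rw [eq_top_iff]
    exact le_iInf₂ fun p hp => absurd ⟨p, hp⟩ hne
  obtain ⟨p, hp, hpm⟩ := exists_relEntropy_eq_blockMin A r k hne
  by_cases hs : ∀ w, weight A k w = 0 → p w = 0
  · refine ⟨p, hp, hs, ?_⟩
    rw [← hpm]
    exact relEntropy_of_support hs
  · rw [← hpm] at h
    exact absurd (relEntropy_of_not_support hs) h

/-! ### Marginals of distributions on words with distinct letters -/

theorem count_le_one_iff_injective {d k : ℕ} {x : Fin k → Fin d} :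
    (¬ ∃ i, 1 < count x i) ↔ Function.Injective x := by
  constructor
  · intro h a b hab
    by_contra hne
    refine h ⟨x a, Finset.one_lt_card.2 ⟨a, by simp, b, by simp [hab], hne⟩⟩
  · rintro h ⟨i, hi⟩
    obtain ⟨a, ha, b, hb, hne⟩ := Finset.one_lt_card.1 hi
    simp only [Finset.mem_filter, Finset.mem_univ, true_and] at ha hb
    exact hne (h (ha.trans hb.symm))

theorem count_of_injective {d k : ℕ} {x : Fin k → Fin d} (hx : Function.Injective x) (i : Fin d)
    [Decidable (∃! l, x l = i)] : count x i = if ∃! l, x l = i then 1 else 0 := by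
  split_ifs with h
  · obtain ⟨l, hl, huniq⟩ := h
    rw [count, Finset.card_eq_one]
    refine ⟨l, ?_⟩
    ext a
    simp only [Finset.mem_filter, Finset.mem_univ, true_and, Finset.mem_singleton]
    exact ⟨huniq a, fun h => h ▸ hl⟩
  · rw [count, Finset.card_eq_zero, Finset.filter_eq_empty_iff]
    intro l _ hl
    exact h ⟨l, hl, fun a ha => hx (ha.trans hl.symm)⟩

/-- On words without repetition the count of a letter is the indicator of its occurring exactly
once. This makes the marginal condition match the linear frequency constraint of the polytope. -/
theorem mem_blockDist_iff {d k : ℕ} {r : Fin d → ℝ} {p : (Fin k → Fin d) → ℝ} :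
    p ∈ blockDist r k ↔ p ∈ stdSimplex ℝ (Fin k → Fin d) ∧
      (∀ x, ¬ Function.Injective x → p x = 0) ∧ ∀ i, ∑ x, p x * count x i = k * r i := by
  classical
  have h1 : (∀ x : Fin k → Fin d, (∃ i, 1 < count x i) → p x = 0) ↔
      ∀ x, ¬ Function.Injective x → p x = 0 := by
    refine forall_congr' fun x => ?_
    rw [← count_le_one_iff_injective, not_not]
  unfold blockDist
  rw [Set.mem_ofPred_eq, h1]
  refine and_congr_right fun _ => and_congr_right fun hp => forall_congr' fun i => ?_
  refine Eq.congr_left ?_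
  rw [Finset.sum_filter]
  refine Finset.sum_congr rfl fun x _ => ?_
  by_cases hx : Function.Injective x
  · rw [count_of_injective hx i]
    split_ifs <;> simp
  · rw [hp x hx]
    simp

/-! ### From the limit polytope to channels and back -/

/-- The summand of `typeCost` that belongs to the words of length `k + 1`. -/
def blockCost {d : ℕ} (A : Matrix (Fin d) (Fin d) ℂ) (k : Fin d) (p : BlockWord d k → ℝ) : ℝ :=
  ∑ w, mulLog (p w) - mulLog (∑ w, p w) - ∑ w, p w * Real.log (weight A k w)

theorem blockCost_smul {d : ℕ} (A : Matrix (Fin d) (Fin d) ℂ) (k : Fin d) {p : BlockWord d k → ℝ}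
    (hp : ∑ w, p w = 1) {g : ℝ} (hg : 0 < g) :
    blockCost A k (fun w => g * p w) =
      g * (∑ w, mulLog (p w) - ∑ w, p w * Real.log (weight A k w)) := by
  unfold blockCost
  rw [← Finset.mul_sum, hp, Finset.sum_congr rfl fun w _ => mulLog_mul hg, Finset.sum_add_distrib,
    ← Finset.mul_sum, ← Finset.mul_sum, hp]
  simp only [mul_assoc]
  rw [← Finset.mul_sum, mulLog]
  ring_nf

theorem hatS_mul {d : ℕ} (s : Fin d → ℝ) (k : Fin d) :
    hatS s k * (1 / ((k : ℕ) + 1 : ℝ)) = gap s k := by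
  have : ((k : ℕ) + 1 : ℝ) ≠ 0 := by positivity
  rw [hatS_eq]
  field_simp

theorem hatS_eq_zero_iff {d : ℕ} (s : Fin d → ℝ) (k : Fin d) : hatS s k = 0 ↔ gap s k = 0 := by
  have : ((k : ℕ) + 1 : ℝ) ≠ 0 := by positivity
  rw [hatS_eq]
  simp [this]

theorem sum_mul_count {d k : ℕ} (p : (Fin k → Fin d) → ℝ) :
    ∑ i, ∑ w, p w * count w i = k * ∑ w, p w := by
  rw [Finset.sum_comm, Finset.mul_sum]
  refine Finset.sum_congr rfl fun w _ => ?_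
  rw [← Finset.mul_sum, ← Nat.cast_sum, sum_count, mul_comm]

/-- Normalize `P k` by its mass `gap s k` and let `W k` be its letter marginal; the normalized
distribution is a competitor in the inner minimum. Zero weights at words with repeated letters
supply the vanishing condition. -/
theorem exists_channel_of_mem_blockPolytope {d : ℕ} {s q : Fin d → ℝ} (hq : q ∈ stdSimplex ℝ (Fin d))
    (hgap : ∀ k, 0 ≤ gap s k) {A : Matrix (Fin d) (Fin d) ℂ} {P : BlockFamily d}
    (hP : P ∈ blockPolytope s q A) :
    ∃ W ∈ channels s q, channelCost s A W ≤ ((typeCost A P / Real.log 2 : ℝ) : EReal) := by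
  obtain ⟨hP0, hPs, hPg, hPq⟩ := hP
  have hPz : ∀ k, gap s k = 0 → ∀ w, P k w = 0 := by
    intro k hk w
    rw [← hPg k] at hk
    exact (Finset.sum_eq_zero_iff_of_nonneg fun w _ => hP0 k w).1 hk w (Finset.mem_univ w)
  let p : BlockFamily d := fun k w => P k w / gap s k
  -- Where the gap vanishes, `W k` has no effect on output or cost (`0 · ∞ = 0`); `q` is just some
  -- distribution.
  let W : Fin d → Fin d → ℝ := fun k i =>
    if gap s k = 0 then q i else (∑ w, p k w * count w i) / ((k : ℕ) + 1 : ℝ)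
  have hp1 : ∀ k, gap s k ≠ 0 → ∑ w, p k w = 1 := by
    intro k hk
    rw [← Finset.sum_div, hPg, div_self hk]
  have hp0 : ∀ k w, 0 ≤ p k w := fun k w => div_nonneg (hP0 k w) (hgap k)
  have hpP : ∀ k w, gap s k * p k w = P k w := by
    intro k w
    by_cases hk : gap s k = 0
    · rw [hk, zero_mul, hPz k hk]
    · simp only [p]
      field_simp
  have hWi : ∀ k, gap s k ≠ 0 → ∀ i, ∑ w, p k w * count w i = ((k : ℕ) + 1 : ℝ) * W k i := by
    intro k hk i
    have : ((k : ℕ) + 1 : ℝ) ≠ 0 := by positivity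
    simp only [W]
    rw [if_neg hk]
    field_simp
  refine ⟨W, ⟨fun k => ?_, fun i => ?_⟩, ?_⟩
  · by_cases hk : gap s k = 0
    · have : W k = q := by
        ext i
        simp [W, hk]
      rw [this]
      exact hq
    · refine ⟨fun i => ?_, ?_⟩
      · simp only [W]
        rw [if_neg hk]
        exact div_nonneg (Finset.sum_nonneg fun w _ => mul_nonneg (hp0 k w) (Nat.cast_nonneg _))
          (by positivity)
      · simp only [W]
        simp only [if_neg hk]
        rw [← Finset.sum_div, sum_mul_count, hp1 k hk]
        push_cast
        field_simp
  · rw [← hPq i]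
    refine Finset.sum_congr rfl fun k _ => ?_
    by_cases hk : gap s k = 0
    · rw [(hatS_eq_zero_iff s k).2 hk, zero_mul]
      simp [hPz k hk]
    · rw [hatS_eq, mul_comm ((k : ℕ) + 1 : ℝ), mul_assoc, ← hWi k hk, Finset.mul_sum]
      refine Finset.sum_congr rfl fun w _ => ?_
      rw [← mul_assoc, hpP]
  · have h1 : typeCost A P / Real.log 2 = ∑ k, blockCost A k (P k) / Real.log 2 := by
      rw [← Finset.sum_div]
      rfl
    rw [h1, coe_sum_ereal, channelCost]
    refine Finset.sum_le_sum fun k _ => ?_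
    rw [hatS_mul]
    by_cases hk : gap s k = 0
    · have h2 : blockCost A k (P k) = 0 := by
        simp [blockCost, hPz k hk, mulLog]
      rw [hk, h2]
      simp
    · have hk' : 0 < gap s k := lt_of_le_of_ne (hgap k) (Ne.symm hk)
      have hps : ∀ w, weight A k w = 0 → p k w = 0 := fun w hw => by simp [p, hPs k w hw]
      have hmem : p k ∈ blockDist (W k) ((k : ℕ) + 1) := by
        refine mem_blockDist_iff.2 ⟨⟨hp0 k, hp1 k hk⟩, fun x hx => hps x ?_, fun i => ?_⟩
        · exact blockWeight_eq_zero_of_not_injective _ _ hx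
        · rw [hWi k hk]
          push_cast
          rfl
      have h2 : blockMin A (W k) k ≤ relEntropy (p k) (weight A k) := iInf₂_le (p k) hmem
      rw [relEntropy_of_support hps] at h2
      have h3 : blockCost A k (P k) / Real.log 2 = gap s k *
          ((∑ w, mulLog (p k w) - ∑ w, p k w * Real.log (weight A k w)) / Real.log 2) := by
        have h4 : P k = fun w => gap s k * p k w := funext fun w => (hpP k w).symm
        rw [h4, blockCost_smul A k (hp1 k hk) hk', mul_div_assoc]
      rw [h3, EReal.coe_mul]
      exact mul_le_mul_of_nonneg_left h2 (EReal.coe_nonneg.2 hk'.le)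

/-- Finite cost makes every inner minimum with positive gap finite, hence attained by a distribution
of the right support; scaled by the gaps, the minimizers form `P`. -/
theorem exists_mem_blockPolytope_of_channel {d : ℕ} {s q : Fin d → ℝ} (hgap : ∀ k, 0 ≤ gap s k)
    {A : Matrix (Fin d) (Fin d) ℂ} {W : Fin d → Fin d → ℝ} (hW : W ∈ channels s q)
    (hcost : channelCost s A W ≠ ⊤) :
    ∃ P ∈ blockPolytope s q A, channelCost s A W = ((typeCost A P / Real.log 2 : ℝ) : EReal) := by
  have hterm : ∀ k, gap s k ≠ 0 → blockMin A (W k) k ≠ ⊤ := by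
    intro k hk htop
    have hpos : ∀ k, gap s k ≠ 0 → 0 < gap s k := fun k hk => lt_of_le_of_ne (hgap k) (Ne.symm hk)
    have hbot : ∀ k ∈ Finset.univ, ((hatS s k * (1 / ((k : ℕ) + 1 : ℝ)) : ℝ) : EReal) *
        blockMin A (W k) k ≠ ⊥ := by
      intro k _
      rw [hatS_mul]
      by_cases hk : gap s k = 0
      · rw [hk]; simp
      · by_cases ht : blockMin A (W k) k = ⊤
        · rw [ht, EReal.coe_mul_top_of_pos (hpos k hk)]
          exact top_ne_bot
        · lift blockMin A (W k) k to ℝ using ⟨ht, blockMin_ne_bot _ _ _⟩ with y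
          rw [← EReal.coe_mul]
          exact EReal.coe_ne_bot _
    refine ne_top_of_sum_ereal_ne_top hbot hcost (Finset.mem_univ k) ?_
    rw [hatS_mul, htop, EReal.coe_mul_top_of_pos (hpos k hk)]
  have hex : ∀ k, ∃ p : BlockWord d k → ℝ, gap s k ≠ 0 →
      p ∈ blockDist (W k) ((k : ℕ) + 1) ∧ (∀ w, weight A k w = 0 → p w = 0) ∧ blockMin A (W k) k =
      (((∑ w, mulLog (p w) - ∑ w, p w * Real.log (weight A k w)) / Real.log 2 : ℝ) : EReal) := by
    intro k
    by_cases hk : gap s k = 0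
    · exact ⟨0, fun h => absurd hk h⟩
    · obtain ⟨p, h1, h2, h3⟩ := exists_of_blockMin_ne_top (hterm k hk)
      exact ⟨p, fun _ => ⟨h1, h2, h3⟩⟩
  choose p hp using hex
  have hpz : ∀ k, gap s k = 0 → (fun w => gap s k * p k w) = 0 := fun k hk => by
    ext w
    simp [hk]
  refine ⟨fun k w => gap s k * p k w, ⟨fun k w => ?_, fun k w hw => ?_, fun k => ?_, fun i => ?_⟩, ?_⟩
  · change 0 ≤ gap s k * p k w
    by_cases hk : gap s k = 0
    · rw [hk, zero_mul]
    · exact mul_nonneg (hgap k) ((hp k hk).1.1.1 w)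
  · change gap s k * p k w = 0
    by_cases hk : gap s k = 0
    · rw [hk, zero_mul]
    · rw [(hp k hk).2.1 w hw, mul_zero]
  · rw [← Finset.mul_sum]
    by_cases hk : gap s k = 0
    · rw [hk, zero_mul]
    · rw [(hp k hk).1.1.2, mul_one]
  · rw [← hW.2 i]
    refine Finset.sum_congr rfl fun k _ => ?_
    change ∑ w, gap s k * p k w * count w i = _
    by_cases hk : gap s k = 0
    · rw [(hatS_eq_zero_iff s k).2 hk, hk]
      simp
    · have h1 := (mem_blockDist_iff.1 (hp k hk).1).2.2 i
      simp only [mul_assoc]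
      rw [← Finset.mul_sum, h1, hatS_eq]
      push_cast
      ring
  · have h1 : typeCost A (fun k w => gap s k * p k w) / Real.log 2 =
        ∑ k, blockCost A k (fun w => gap s k * p k w) / Real.log 2 := by
      rw [← Finset.sum_div]
      rfl
    rw [h1, coe_sum_ereal, channelCost]
    refine Finset.sum_congr rfl fun k _ => ?_
    rw [hatS_mul]
    by_cases hk : gap s k = 0
    · rw [hpz k hk, hk]
      simp [blockCost, mulLog]
    · have hk' : 0 < gap s k := lt_of_le_of_ne (hgap k) (Ne.symm hk)
      rw [(hp k hk).2.2, blockCost_smul A k (hp k hk).1.1.2 hk', mul_div_assoc, EReal.coe_mul]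

/-! ### The exponent as a minimum over channels -/

theorem const_mem_channels {d : ℕ} {s q : Fin d → ℝ} (hs : s ∈ stdSimplex ℝ (Fin d))
    (hq : q ∈ stdSimplex ℝ (Fin d)) : (fun _ => q) ∈ channels s q := by
  refine ⟨fun _ => hq, fun i => ?_⟩
  rw [← Finset.sum_mul, sum_hatS, hs.2, one_mul]

theorem theta_eq {d : ℕ} {q s : Fin d → ℝ} {A : Matrix (Fin d) (Fin d) ℂ} {θ : EReal}
    (h : HasTheta q s A θ) : Theta q s A = θ :=
  (Classical.epsilon_spec (p := HasTheta q s A) ⟨θ, h⟩).unique h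

theorem exists_theta_eq {d : ℕ} (hd : 0 < d) {s : Fin d → ℝ} (hs : s ∈ stdSimplex ℝ (Fin d))
    (hs_anti : Antitone s) (A : Matrix (Fin d) (Fin d) ℂ) {q : Fin d → ℝ}
    (hq : q ∈ stdSimplex ℝ (Fin d)) :
    HasTheta q s A (Theta q s A) ∧ ∃ W ∈ channels s q,
      (∀ W' ∈ channels s q, channelCost s A W ≤ channelCost s A W') ∧
        Theta q s A = ((-entropy s : ℝ) : EReal) + channelCost s A W := by
  have hgap := gap_nonneg hs.1 hs_anti
  by_cases hne : (blockPolytope s q A).Nonempty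
  · obtain ⟨P, hP, hmin⟩ := (isCompact_blockPolytope s q A).exists_isMinOn hne
      (continuous_typeCost A).continuousOn
    have hΘ := hasTheta_of_isMin hd hs hP fun P' hP' => hmin hP'
    rw [theta_eq hΘ]
    refine ⟨hΘ, ?_⟩
    obtain ⟨W, hW, hcost⟩ := exists_channel_of_mem_blockPolytope hq hgap hP
    have hlow : ∀ W' ∈ channels s q,
        ((typeCost A P / Real.log 2 : ℝ) : EReal) ≤ channelCost s A W' := by
      intro W' hW'
      by_cases htop : channelCost s A W' = ⊤
      · rw [htop]; exact le_top
      · obtain ⟨P', hP', h⟩ := exists_mem_blockPolytope_of_channel hgap hW' htop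
        rw [h, EReal.coe_le_coe_iff]
        exact div_le_div_of_nonneg_right (hmin hP') (Real.log_nonneg one_le_two)
    refine ⟨W, hW, fun W' hW' => hcost.trans (hlow W' hW'), ?_⟩
    rw [le_antisymm hcost (hlow W hW), ← EReal.coe_add]
  · have hempty := Set.not_nonempty_iff_eq_empty.1 hne
    have hΘ := hasTheta_top hempty
    rw [theta_eq hΘ]
    have htop : ∀ W' ∈ channels s q, channelCost s A W' = ⊤ := by
      intro W' hW'
      by_contra h
      obtain ⟨P', hP', -⟩ := exists_mem_blockPolytope_of_channel hgap hW' h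
      exact hne ⟨P', hP'⟩
    -- Every channel has infinite cost here, but attainment still needs one channel.
    have hmem := const_mem_channels hs hq
    refine ⟨hΘ, _, hmem, fun W' hW' => ?_, ?_⟩
    · rw [htop W' hW']; exact le_top
    · rw [htop _ hmem, EReal.coe_add_top]

/-! ### The marginals of the distributions `p_k` of a unitary matrix -/

theorem perm_eq_of_eq_off {α : Type*} [Finite α] {σ τ : Equiv.Perm α} {a₀ : α}
    (h : ∀ a, a ≠ a₀ → σ a = τ a) : σ = τ := by
  have h1 : ∀ a, a ≠ a₀ → (τ⁻¹ * σ) a = a := fun a ha => by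
    rw [Equiv.Perm.mul_apply, h a ha]
    exact τ.symm_apply_apply a
  have h2 : (τ⁻¹ * σ) a₀ = a₀ := by
    by_contra hne
    exact hne ((τ⁻¹ * σ).injective (h1 _ hne))
  ext a
  by_cases ha : a = a₀
  · rw [Equiv.Perm.mul_apply, ← ha] at h2
    rw [← Equiv.Perm.eq_inv_iff_eq.1 h2.symm]
  · exact h a ha

/-- Expand `|det|²` over pairs of permutations; the sum over words factors over positions.
Orthonormality of the rows of `U` forces the two permutations to agree at every position except
`a₀`, hence everywhere. -/
theorem sum_norm_det_sq {d k : ℕ} {U : Matrix (Fin d) (Fin d) ℂ}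
    (hU : U ∈ Matrix.unitaryGroup (Fin d) ℂ) (hk : k ≤ d) (a₀ : Fin k) (i : Fin d) :
    ∑ w : Fin k → Fin d, ‖(Matrix.of fun a b : Fin k =>
        U.conjTranspose (w a) (Fin.castLE hk b)).det‖ ^ 2 * (if w a₀ = i then 1 else 0) =
      ∑ σ : Equiv.Perm (Fin k), ‖U (Fin.castLE hk (σ a₀)) i‖ ^ 2 := by
  have hrow : ∀ l l' : Fin d, ∑ j, star (U l j) * U l' j = if l = l' then 1 else 0 := by
    intro l l'
    have h := congrFun (congrFun (Matrix.mem_unitaryGroup_iff.1 hU) l') l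
    rw [Matrix.mul_apply, Matrix.one_apply] at h
    rw [← if_congr (eq_comm (a := l') (b := l)) rfl rfl, ← h]
    refine Finset.sum_congr rfl fun j _ => ?_
    rw [mul_comm, Matrix.star_apply]
  -- This writes the constraint `w a₀ = i` as a product over positions, so that the sum over words
  -- still factors.
  let g : Fin k → Fin d → ℂ := fun a j => if a = a₀ then (if j = i then 1 else 0) else 1
  let ε : Equiv.Perm (Fin k) → ℂ := fun σ => ((Equiv.Perm.sign σ : ℤ) : ℂ)
  let F : Equiv.Perm (Fin k) → Equiv.Perm (Fin k) → Fin k → Fin d → ℂ := fun σ τ a j =>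
    star (U (Fin.castLE hk (σ a)) j) * U (Fin.castLE hk (τ a)) j * g a j
  have hε : ∀ σ, star (ε σ) = ε σ := fun σ => by simp [ε]
  have hεε : ∀ σ, ε σ * ε σ = 1 := fun σ => by
    rcases Int.units_eq_one_or (Equiv.Perm.sign σ) with h | h <;> simp [ε, h]
  have hdet : ∀ w : Fin k → Fin d, (Matrix.of fun a b : Fin k =>
      U.conjTranspose (w a) (Fin.castLE hk b)).det =
      ∑ σ, ε σ * ∏ a, star (U (Fin.castLE hk (σ a)) (w a)) := by
    intro w
    rw [← Matrix.det_transpose, Matrix.det_apply']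
    rfl
  have hterm : ∀ w : Fin k → Fin d, (((‖(Matrix.of fun a b : Fin k =>
        U.conjTranspose (w a) (Fin.castLE hk b)).det‖ ^ 2 *
        (if w a₀ = i then 1 else 0) : ℝ)) : ℂ) =
      ∑ σ, ∑ τ, ε σ * ε τ * ∏ a, F σ τ a (w a) := by
    intro w
    have hg : (((if w a₀ = i then 1 else 0 : ℝ)) : ℂ) = ∏ a, g a (w a) := by
      rw [Finset.prod_eq_single a₀ (fun a _ ha => if_neg ha) (fun h => absurd (Finset.mem_univ _) h)]
      by_cases h : w a₀ = i <;> simp [h]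
    rw [Complex.ofReal_mul, hg, Complex.ofReal_pow, ← Complex.mul_conj', hdet, map_sum,
      Finset.sum_mul_sum, Finset.sum_mul]
    refine Finset.sum_congr rfl fun σ _ => ?_
    rw [Finset.sum_mul]
    refine Finset.sum_congr rfl fun τ _ => ?_
    rw [map_mul, map_prod, Finset.prod_mul_distrib, Finset.prod_mul_distrib]
    simp only [starRingEnd_apply, star_star, hε]
    ring
  have hsum : ∀ σ τ, ∑ w : Fin k → Fin d, ε σ * ε τ * ∏ a, F σ τ a (w a) =
      if σ = τ then ((‖U (Fin.castLE hk (σ a₀)) i‖ ^ 2 : ℝ) : ℂ) else 0 := by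
    intro σ τ
    have hprod : ∑ w : Fin k → Fin d, ∏ a, F σ τ a (w a) = ∏ a, ∑ j, F σ τ a j := by
      rw [Finset.prod_univ_sum]
      simp
    have hoff : ∀ a, a ≠ a₀ → ∑ j, F σ τ a j = if σ a = τ a then 1 else 0 := by
      intro a ha
      simp only [F, g, if_neg ha, mul_one]
      rw [hrow, if_congr (Fin.castLE_injective hk).eq_iff rfl rfl]
    rw [← Finset.mul_sum, hprod]
    split_ifs with h
    · subst h
      rw [hεε, one_mul, Finset.prod_eq_single a₀ (fun a _ ha => by rw [hoff a ha, if_pos rfl])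
        (fun h => absurd (Finset.mem_univ _) h)]
      simp only [F, g, if_true, mul_ite, mul_one, mul_zero]
      rw [Finset.sum_ite_eq' Finset.univ i, if_pos (Finset.mem_univ _), Complex.ofReal_pow,
        ← Complex.conj_mul']
      rfl
    · have : ∃ a, a ≠ a₀ ∧ σ a ≠ τ a := by
        by_contra hcon
        push Not at hcon
        exact h (perm_eq_of_eq_off hcon)
      obtain ⟨a, ha, hne⟩ := this
      rw [Finset.prod_eq_zero (Finset.mem_univ a) (by rw [hoff a ha, if_neg hne]), mul_zero]
  have key : ((∑ w : Fin k → Fin d, ‖(Matrix.of fun a b : Fin k =>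
        U.conjTranspose (w a) (Fin.castLE hk b)).det‖ ^ 2 * (if w a₀ = i then 1 else 0) : ℝ) : ℂ) =
      ((∑ σ : Equiv.Perm (Fin k), ‖U (Fin.castLE hk (σ a₀)) i‖ ^ 2 : ℝ) : ℂ) := by
    rw [Complex.ofReal_sum, Finset.sum_congr rfl fun w _ => hterm w, Finset.sum_comm,
      Complex.ofReal_sum]
    refine Finset.sum_congr rfl fun σ _ => ?_
    rw [Finset.sum_comm, Finset.sum_congr rfl fun τ _ => hsum σ τ, Finset.sum_ite_eq,
      if_pos (Finset.mem_univ _)]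
  exact_mod_cast key

/-- Add the previous identity over the positions `a`. For fixed `σ` the positions run through all of
the first `k` rows, and the `k!` permutations cancel the normalization. -/
theorem sum_blockWeight_mul_count {d k : ℕ} {U : Matrix (Fin d) (Fin d) ℂ}
    (hU : U ∈ Matrix.unitaryGroup (Fin d) ℂ) (hk : k ≤ d) (i : Fin d) :
    ∑ w, blockWeight U hk w * count w i = ∑ b : Fin k, ‖U (Fin.castLE hk b) i‖ ^ 2 := by
  have hk0 : (k.factorial : ℝ) ≠ 0 := by positivity
  have h1 : ∀ w : Fin k → Fin d, blockWeight U hk w * count w i =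
      (∑ a, ‖(Matrix.of fun a b : Fin k => U.conjTranspose (w a) (Fin.castLE hk b)).det‖ ^ 2 *
        (if w a = i then 1 else 0)) / k.factorial := by
    intro w
    rw [blockWeight_eq, ← Finset.mul_sum, count, Finset.card_filter]
    push_cast
    ring
  rw [Finset.sum_congr rfl fun w _ => h1 w, ← Finset.sum_div, Finset.sum_comm,
    Finset.sum_congr rfl fun a _ => sum_norm_det_sq hU hk a i, Finset.sum_comm,
    Finset.sum_congr rfl fun (σ : Equiv.Perm (Fin k)) _ =>
      Equiv.sum_comp σ fun b => ‖U (Fin.castLE hk b) i‖ ^ 2,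
    Finset.sum_const, Finset.card_univ, Fintype.card_perm, Fintype.card_fin, nsmul_eq_mul,
    mul_div_cancel_left₀ _ hk0]

theorem sum_weight_of_unitary {d : ℕ} {U : Matrix (Fin d) (Fin d) ℂ}
    (hU : U ∈ Matrix.unitaryGroup (Fin d) ℂ) (k : Fin d) : ∑ w, weight U k w = 1 :=
  sum_blockWeight_of_unitary hU _

theorem sum_weight_mul_count {d : ℕ} {U : Matrix (Fin d) (Fin d) ℂ}
    (hU : U ∈ Matrix.unitaryGroup (Fin d) ℂ) (k i : Fin d) :
    ∑ w, weight U k w * count w i =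
      ∑ l ∈ Finset.univ.filter fun l : Fin d => l ≤ k, ‖U l i‖ ^ 2 := by
  refine (sum_blockWeight_mul_count hU k.isLt i).trans ?_
  refine Finset.sum_nbij (Fin.castLE k.isLt) (fun b _ => ?_)
    (Fin.castLE_injective _).injOn (fun l hl => ?_) fun _ _ => rfl
  · exact Finset.mem_coe.2 (Finset.mem_filter.2 ⟨Finset.mem_univ _, Nat.lt_succ_iff.1 b.isLt⟩)
  · have : l ≤ k := by simpa using hl
    exact ⟨⟨l, Nat.lt_succ_of_le this⟩, by simp, rfl⟩

/-! ### The minimum of the exponent of a unitary matrix -/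

/-- The channel that sends `δ_k` to the marginal of the uniform mixture of the first rows. -/
def rowChannel {d : ℕ} (U : Matrix (Fin d) (Fin d) ℂ) (k i : Fin d) : ℝ :=
  ∑ l ∈ Finset.univ.filter fun l : Fin d => l ≤ k, ‖U l i‖ ^ 2 / ((k : ℕ) + 1 : ℝ)

theorem mul_rowChannel {d : ℕ} {U : Matrix (Fin d) (Fin d) ℂ}
    (hU : U ∈ Matrix.unitaryGroup (Fin d) ℂ) (k i : Fin d) :
    ((k : ℕ) + 1 : ℝ) * rowChannel U k i = ∑ w, weight U k w * count w i := by
  have : ((k : ℕ) + 1 : ℝ) ≠ 0 := by positivity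
  rw [sum_weight_mul_count hU, rowChannel, ← Finset.sum_div, mul_div_cancel₀ _ this]

/-- So `q̃` is the frequency of the point `gap s k * p_k`, the zero of the cost. -/
theorem tildeQ_eq {d : ℕ} {U : Matrix (Fin d) (Fin d) ℂ} (hU : U ∈ Matrix.unitaryGroup (Fin d) ℂ)
    (s : Fin d → ℝ) (i : Fin d) :
    tildeQ s U i = ∑ k, ∑ w, gap s k * weight U k w * count w i := by
  refine Finset.sum_congr rfl fun k _ => ?_
  simp only [mul_assoc]
  rw [← Finset.mul_sum, ← mul_rowChannel hU, hatS_eq, rowChannel]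
  ring

theorem rowChannel_mem_stdSimplex {d : ℕ} {U : Matrix (Fin d) (Fin d) ℂ}
    (hU : U ∈ Matrix.unitaryGroup (Fin d) ℂ) (k : Fin d) :
    rowChannel U k ∈ stdSimplex ℝ (Fin d) := by
  have h0 : ((k : ℕ) + 1 : ℝ) ≠ 0 := by positivity
  refine ⟨fun i => Finset.sum_nonneg fun l _ => by positivity, ?_⟩
  refine mul_left_cancel₀ h0 ?_
  rw [Finset.mul_sum, Finset.sum_congr rfl fun i _ => mul_rowChannel hU k i, sum_mul_count,
    sum_weight_of_unitary hU]
  push_cast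
  ring

theorem rowChannel_mem_channels {d : ℕ} {U : Matrix (Fin d) (Fin d) ℂ}
    (hU : U ∈ Matrix.unitaryGroup (Fin d) ℂ) (s : Fin d → ℝ) :
    rowChannel U ∈ channels s (tildeQ s U) :=
  ⟨rowChannel_mem_stdSimplex hU, fun _ => rfl⟩

theorem mem_stdSimplex_of_mem_channels {d : ℕ} {s q : Fin d → ℝ} {W : Fin d → Fin d → ℝ}
    (hs : s ∈ stdSimplex ℝ (Fin d)) (hgap : ∀ k, 0 ≤ gap s k) (hW : W ∈ channels s q) :
    q ∈ stdSimplex ℝ (Fin d) := by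
  refine ⟨fun i => ?_, ?_⟩
  · rw [← hW.2 i]
    refine Finset.sum_nonneg fun k _ => mul_nonneg ?_ ((hW.1 k).1 i)
    rw [hatS_eq]
    exact mul_nonneg (by positivity) (hgap k)
  · rw [← Finset.sum_congr rfl fun i _ => hW.2 i, Finset.sum_comm]
    simp only [← Finset.mul_sum]
    rw [Finset.sum_congr rfl fun k _ => by rw [(hW.1 k).2, mul_one], sum_hatS, hs.2]

theorem weight_mem_blockDist {d : ℕ} {U : Matrix (Fin d) (Fin d) ℂ}
    (hU : U ∈ Matrix.unitaryGroup (Fin d) ℂ) (k : Fin d) :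
    weight U k ∈ blockDist (rowChannel U k) ((k : ℕ) + 1) := by
  refine mem_blockDist_iff.2 ⟨⟨weight_nonneg U k, sum_weight_of_unitary hU k⟩,
    fun x hx => blockWeight_eq_zero_of_not_injective U _ hx, fun i => ?_⟩
  rw [← mul_rowChannel hU]
  push_cast
  rfl

theorem relEntropy_self {X : Type} [Fintype X] (p : X → ℝ) : relEntropy p p = 0 := by
  rw [relEntropy, if_pos fun _ h => h]
  simp

theorem channelCost_rowChannel_le {d : ℕ} {s : Fin d → ℝ} (hgap : ∀ k, 0 ≤ gap s k)
    {U : Matrix (Fin d) (Fin d) ℂ} (hU : U ∈ Matrix.unitaryGroup (Fin d) ℂ) :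
    channelCost s U (rowChannel U) ≤ 0 := by
  refine Finset.sum_nonpos fun k _ => ?_
  have h1 : blockMin U (rowChannel U k) k ≤ 0 :=
    (iInf₂_le _ (weight_mem_blockDist hU k)).trans (relEntropy_self (weight U k)).le
  rw [hatS_mul]
  exact mul_nonpos_of_nonneg_of_nonpos (EReal.coe_nonneg.2 (hgap k)) h1

/-- The Gibbs inequality for one summand. -/
theorem sub_le_mulLog_sub {a b : ℝ} (ha : 0 ≤ a) (hb : 0 ≤ b) (h : b = 0 → a = 0) :
    a - b ≤ mulLog a - a * Real.log b ∧ (mulLog a - a * Real.log b = a - b → a = b) := by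
  rcases ha.eq_or_lt with rfl | ha
  · simp only [mulLog, zero_mul, sub_zero, zero_sub]
    exact ⟨by linarith, fun h => by linarith⟩
  · have hb : 0 < b := hb.lt_of_ne fun h0 => ha.ne' (h h0.symm)
    have hlog : mulLog a - a * Real.log b = -(a * Real.log (b / a)) := by
      rw [mulLog, Real.log_div hb.ne' ha.ne']
      ring
    have hba : a * (b / a - 1) = b - a := by field_simp
    refine ⟨?_, fun heq => ?_⟩
    · have := mul_le_mul_of_nonneg_left (Real.log_le_sub_one_of_pos (div_pos hb ha)) ha.le
      rw [hlog]
      linarith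
    · by_contra hne
      have := mul_lt_mul_of_pos_left (Real.log_lt_sub_one_of_pos (div_pos hb ha)
        fun h1 => hne ((div_eq_one_iff_eq ha.ne').1 h1).symm) ha
      rw [hlog] at heq
      linarith

/-- For each `k` the functions `P k` and `gap s k * p_k` have equal mass, so subtracting `P - gap *
p_k` under the sum changes nothing and makes every term nonnegative. A nonpositive cost is then the
equality case of Gibbs' inequality in each term. -/
theorem eq_tildeQ_of_typeCost_nonpos {d : ℕ} {s q : Fin d → ℝ} (hgap : ∀ k, 0 ≤ gap s k)
    {U : Matrix (Fin d) (Fin d) ℂ} (hU : U ∈ Matrix.unitaryGroup (Fin d) ℂ) {P : BlockFamily d}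
    (hP : P ∈ blockPolytope s q U) (hcost : typeCost U P ≤ 0) : q = tildeQ s U := by
  obtain ⟨h1, h2, h3, h4⟩ := hP
  have hzero : ∀ k w, gap s k * weight U k w = 0 → P k w = 0 := by
    intro k w h
    rcases mul_eq_zero.1 h with h | h
    · have h3k := h3 k
      rw [h] at h3k
      exact (Finset.sum_eq_zero_iff_of_nonneg fun w _ => h1 k w).1 h3k w (Finset.mem_univ w)
    · exact h2 k w h
  have hgibbs := fun k w => sub_le_mulLog_sub (h1 k w)
    (mul_nonneg (hgap k) (weight_nonneg U k w)) (hzero k w)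
  have hsum : typeCost U P = ∑ k, ∑ w, (mulLog (P k w) -
      P k w * Real.log (gap s k * weight U k w) - (P k w - gap s k * weight U k w)) := by
    refine Finset.sum_congr rfl fun k _ => ?_
    have hlog : ∀ w, P k w * Real.log (gap s k * weight U k w) =
        P k w * Real.log (gap s k) + P k w * Real.log (weight U k w) := by
      intro w
      by_cases h : gap s k * weight U k w = 0
      · rw [hzero k w h]
        ring
      · rw [Real.log_mul (left_ne_zero_of_mul h) (right_ne_zero_of_mul h)]
        ring
    simp only [Finset.sum_sub_distrib, hlog, Finset.sum_add_distrib]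
    rw [← Finset.sum_mul, ← Finset.mul_sum, sum_weight_of_unitary hU, h3, mulLog]
    ring
  have hnonneg : ∀ k w, 0 ≤ mulLog (P k w) -
      P k w * Real.log (gap s k * weight U k w) - (P k w - gap s k * weight U k w) :=
    fun k w => sub_nonneg.2 (hgibbs k w).1
  have h0 := le_antisymm (hsum ▸ hcost)
    (Finset.sum_nonneg fun k _ => Finset.sum_nonneg fun w _ => hnonneg k w)
  have heq : ∀ k w, P k w = gap s k * weight U k w := by
    intro k w
    have hk := (Finset.sum_eq_zero_iff_of_nonneg fun k _ =>
      Finset.sum_nonneg fun w _ => hnonneg k w).1 h0 k (Finset.mem_univ k)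
    have hw := (Finset.sum_eq_zero_iff_of_nonneg fun w _ => hnonneg k w).1 hk w (Finset.mem_univ w)
    exact (hgibbs k w).2 (sub_eq_zero.1 hw)
  ext i
  rw [tildeQ_eq hU, ← h4 i]
  simp only [heq]

theorem channelCost_pos {d : ℕ} {s q : Fin d → ℝ} (hgap : ∀ k, 0 ≤ gap s k)
    {U : Matrix (Fin d) (Fin d) ℂ} (hU : U ∈ Matrix.unitaryGroup (Fin d) ℂ)
    {W : Fin d → Fin d → ℝ} (hW : W ∈ channels s q) (hq : q ≠ tildeQ s U) :
    0 < channelCost s U W := by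
  by_contra hle
  rw [not_lt] at hle
  obtain ⟨P, hP, hcost⟩ := exists_mem_blockPolytope_of_channel hgap hW
    (hle.trans_lt EReal.zero_lt_top).ne
  rw [hcost, ← EReal.coe_zero, EReal.coe_le_coe_iff] at hle
  have hlog : 0 < Real.log 2 := Real.log_pos one_lt_two
  refine hq (eq_tildeQ_of_typeCost_nonpos hgap hU hP ?_)
  by_contra hpos
  exact absurd (div_pos (not_le.1 hpos) hlog) (not_lt.2 hle)

theorem theta_tildeQ_lt {d : ℕ} (hd : 0 < d) {s q : Fin d → ℝ} (hs : s ∈ stdSimplex ℝ (Fin d))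
    (hs_anti : Antitone s) {U : Matrix (Fin d) (Fin d) ℂ}
    (hU : U ∈ Matrix.unitaryGroup (Fin d) ℂ) (hq : q ∈ stdSimplex ℝ (Fin d))
    (hne : q ≠ tildeQ s U) : Theta (tildeQ s U) s U < Theta q s U := by
  have hgap := gap_nonneg hs.1 hs_anti
  have hmem := rowChannel_mem_channels hU s
  obtain ⟨-, W, hW, -, hΘ⟩ := exists_theta_eq hd hs hs_anti U hq
  obtain ⟨-, W', -, hmin, hΘ'⟩ := exists_theta_eq hd hs hs_anti U
    (mem_stdSimplex_of_mem_channels hs hgap hmem)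
  rw [hΘ, hΘ']
  exact EReal.add_lt_add_left_coe (((hmin _ hmem).trans (channelCost_rowChannel_le hgap hU)).trans_lt
    (channelCost_pos hgap hU hW hne)) _

end

end QTypes

theorem mainTheorem3 (d : ℕ) (hd : 2 ≤ d) (s : Fin d → ℝ) (hs : s ∈ stdSimplex ℝ (Fin d))
    (hs_anti : Antitone s) :
    (∀ (A : Matrix (Fin d) (Fin d) ℂ) (q : Fin d → ℝ), q ∈ stdSimplex ℝ (Fin d) →
      HasTheta q s A (Theta q s A) ∧
      (∀ (r : Fin d → ℝ) (k : Fin d), r ∈ stdSimplex ℝ (Fin d) →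
        (blockDist r ((k : ℕ) + 1)).Nonempty →
          ∃ p ∈ blockDist r ((k : ℕ) + 1),
            relEntropy p (blockWeight A (show (k : ℕ) + 1 ≤ d from k.isLt)) = blockMin A r k) ∧
      ∃ W ∈ channels s q,
        (∀ W' ∈ channels s q, channelCost s A W ≤ channelCost s A W') ∧
        Theta q s A = ((-entropy s : ℝ) : EReal) + channelCost s A W) ∧
    (∀ U ∈ Matrix.unitaryGroup (Fin d) ℂ,
      tildeQ s U ∈ stdSimplex ℝ (Fin d) ∧
      ∀ q ∈ stdSimplex ℝ (Fin d), q ≠ tildeQ s U →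
        Theta (tildeQ s U) s U < Theta q s U) := by
  have hd0 : 0 < d := by omega
  refine ⟨fun A q hq => ?_, fun U hU => ⟨?_, fun q hq hne => ?_⟩⟩
  · obtain ⟨h1, h2⟩ := exists_theta_eq hd0 hs hs_anti A hq
    exact ⟨h1, fun r k _ hne => exists_relEntropy_eq_blockMin A r k hne, h2⟩
  · exact mem_stdSimplex_of_mem_channels hs (gap_nonneg hs.1 hs_anti)
      (rowChannel_mem_channels hU s)
  · exact theta_tildeQ_lt hd0 hs hs_anti hU hq hne
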